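/- Let $n,d\ge 1$, $2\le k\le\infty$ and $\mathbb T=\mathbb R/\mathbb Z$. Functions on tori are identified with $1$-periodic functions of real variables. A function is called $C^m$-bounded on an open set if it is $C^m$ there and all its (finite order) derivatives of order $\le m$ are bounded there. **Unperturbed system.** Consider on $\mathbb R^n\times\mathbb T^n\times\mathbb R^d\times\mathbb T^d\ni(p,q,I,\varphi)$ the Hamiltonian $$H_0(p,q,I)=h_0(I)+\sum_{i=1}^n s_i\left(\tfrac12p_i^2+V_i(q_i)\right),\qquad s_i\in\{1,-1\},$$ where each $V_i:\mathbb T\to\mathbb R$ is $C^{k+1}$ and has a local maximum at $0$ with $V_i''(0)<0$, and $h_0$ is $C^{k+1}$-bounded on an open ball $\mathcal O_2\subset\mathbb R^d$ of positive radius. Put $\omega(I)=\partial h_0/\partial I$. For each $i$ let $(p^0_i,q^0_i)$ be a homoclinic orbit of the $i$-th pendulum, that is, a non-constant solution of $\dot p=-s_iV_i'(q)$, $\dot q=s_ip$ in $\mathbb R\times\mathbb T$ that tends to $(0,0)$ as $t\to\pm\infty$. For $\tau\in\mathbb R^n$ and $\sigma\in\mathbb R$ put $p^0(\tau+\sigma\bar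 1)=(p_i^0(\tau_i+\sigma))_i$ and $q^0(\tau+\sigma\bar 1)=(q_i^0(\tau_i+\sigma))_i$. **Perturbations.** Let $\mathcal O_1\subset\mathbb R^n\times\mathbb T^n$ be an open neighbourhood of the product of the $n$ separatrices $\{(0,0)\}\cup\{(p_i^0(\sigma),q_i^0(\sigma)):\sigma\in\mathbb R\}$, let $\varepsilon_1>0$, and let $$\mathcal D=\{(p,q,I,\varphi,t,\varepsilon): (p,q)\in\mathcal O_1,\ I\in\mathcal O_2,\ \varphi\in\mathbb T^d,\ t\in\mathbb T,\ |\varepsilon|<\varepsilon_1\}.$$ Let $\mathcal H^{m}$ be the set of all $C^{m}$-bounded functions $h(p,q,I,\varphi,t;\varepsilon)$ on $\mathcal D$; each $h\in\mathcal H^m$ is the Hamiltonian of a time-periodic perturbation $H_0+\varepsilon h$. The Melnikov potential of $h$ is $$\widetilde{\mathcal M}(\tau,I,\varphi,t)=-\int_{-\infty}^\infty\Big[h\big(p^0(\tau+\sigma\bar1),q^0(\tau+\sigma\bar1),I,\varphi+\sigma\omega(I),t+\sigma;0\big)-h\big(0,0,I,\varphi+\sigma\omega(I),t+\sigma;0\big)\Big]d\sigma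 .$$ **Conditions.** A *critical family* of $h$ consists of an open ball $\mathcal I^*\subseteq\mathcal O_2$ of positive radius, a nonempty open set $\mathcal O\subseteq\mathbb T^d\times\mathbb R$ and a $C^1$ map $\tau^*:\mathcal I^*\times\mathcal O\to\mathbb R^n$ such that for all $(I,\varphi,t)\in\mathcal I^*\times\mathcal O$ the point $\tau^*(I,\varphi,t)$ is a non-degenerate critical point (zero gradient, invertible Hessian) of $\tau\mapsto\widetilde{\mathcal M}(\tau,I,\varphi,t)$. * **H3** holds for $h$ if $h$ has a critical family. * **H4** holds for $h$ if $h$ has a critical family $(\mathcal I^*,\mathcal O,\tau^*)$ with a well-defined reduced Melnikov potential $\widetilde{\mathcal M}^*$, that is, a function with $$\widetilde{\mathcal M}^*(I,\varphi-t\omega(I))=\widetilde{\mathcal M}(\tau^*(I,\varphi,t),I,\varphi,t)\qquad\text{for all }(I,\varphi,t)\in\mathcal I^*\times\mathcal O,$$ and an open ball $\mathcal I^{**}\subseteq\mathcal I^*$ of positive radius such that for all $(I,\varphi,t)\in\mathcal I^{**}\times\mathcal O$ the derivative $\frac{\partial\widetilde{\mathcal M}^*}{\partial\theta}(I,\theta)$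 at $\theta=\varphi-t\omega(I)$ exists and is nonzero. **Proposition.** Each of the conditions H3 and H4 is $C^3$-open and $C^\infty$-dense in $h$: * (open) if $h\in\mathcal H^{k+1}$ satisfies the condition, there is $\delta>0$ such that every $h'\in\mathcal H^{k+1}$ for which all derivatives of $h'-h$ of order $\le 3$ are smaller than $\delta$ on $\mathcal D$ satisfies it; * (dense) for all $h\in\mathcal H^{k+1}$, $r\in\mathbb N$ and $\delta>0$ there is $g\in\mathcal H^{\infty}$, all of whose derivatives of order $\le r$ are smaller than $\delta$ on $\mathcal D$, such that $h+g$ satisfies the condition. -/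

import Mathlib

noncomputable section

namespace GlobalMelnikov

/-- `m`-dimensional Euclidean space. -/
abbrev E (m : ℕ) : Type := EuclideanSpace ℝ (Fin m)

/-- The space of the variables `(p, q, I, φ, t, ε)`.  The angles `q ∈ 𝕋ⁿ`, `φ ∈ 𝕋ᵈ` and the time
`t ∈ 𝕋` (with `𝕋 = ℝ/ℤ`) are represented by real lifts; functions on the tori are functions of the
lifts of period `1`. -/
abbrev Phase (n d : ℕ) : Type := E n × E n × E d × E d × ℝ × ℝ

/-- An integer vector, as a vector of `ℝᵐ`. -/
def intVec {m : ℕ} (a : Fin m → ℤ) : E m := WithLp.toLp 2 fun i => (a i : ℝ)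

/-- The vector `(1, …, 1)`. -/
def oneVec (m : ℕ) : E m := WithLp.toLp 2 fun _ => (1 : ℝ)

/-- The point of `ℝⁿ` with coordinates `x i (τ i + σ)`. -/
def shifted {n : ℕ} (x : Fin n → ℝ → ℝ) (τ : E n) (σ : ℝ) : E n :=
  WithLp.toLp 2 fun i => x i (τ i + σ)

section Regularity

variable {F : Type*} [NormedAddCommGroup F] [NormedSpace ℝ F]

/-- `f` is of class `C^m` on the open set `Ω`, and all its derivatives of (finite) order `≤ m` are
bounded on `Ω`. -/
def IsCkBounded (m : ℕ∞) (Ω : Set F) (f : F → ℝ) : Prop :=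
  ContDiffOn ℝ (m : WithTop ℕ∞) f Ω ∧
    ∀ j : ℕ, (j : ℕ∞) ≤ m → ∃ C : ℝ, ∀ x ∈ Ω, ‖iteratedFDeriv ℝ j f x‖ ≤ C

/-- All derivatives of `f` of order at most `r` are smaller than `δ` on the open set `Ω`. -/
def IsCrSmall (r : ℕ) (δ : ℝ) (Ω : Set F) (f : F → ℝ) : Prop :=
  ∀ j : ℕ, j ≤ r → ∀ x ∈ Ω, ‖iteratedFDeriv ℝ j f x‖ < δ

/-- `x` is a non-degenerate critical point of `f`: the differential vanishes and the Hessian, as a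
linear map from the space to its dual, is injective. -/
def IsNondegCritPt (f : F → ℝ) (x : F) : Prop :=
  ContDiffAt ℝ 2 f x ∧ fderiv ℝ f x = 0 ∧ Function.Injective (fderiv ℝ (fderiv ℝ f) x)

end Regularity

/-- `(p, q)` is a (lifted) homoclinic orbit to the equilibrium `(0, 0) ∈ ℝ × 𝕋` of the pendulum
with Hamiltonian `s (p² / 2 + V q)`, where `s = ± 1`: a solution of `p' = - s V'(q)`, `q' = s p`
which tends to the equilibrium in both time directions and is not the equilibrium itself. -/
structure IsHomoclinic (s : ℝ) (V p q : ℝ → ℝ) : Prop where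
  hasDerivAt_p : ∀ t, HasDerivAt p (-(s * deriv V (q t))) t
  hasDerivAt_q : ∀ t, HasDerivAt q (s * p t) t
  p_atBot : Filter.Tendsto p Filter.atBot (nhds 0)
  p_atTop : Filter.Tendsto p Filter.atTop (nhds 0)
  q_atBot : ∃ a : ℤ, Filter.Tendsto q Filter.atBot (nhds (a : ℝ))
  q_atTop : ∃ b : ℤ, Filter.Tendsto q Filter.atTop (nhds (b : ℝ))
  nontrivial : ∃ t, ¬ (p t = 0 ∧ ∃ m : ℤ, q t = m)

/-- `𝒪₁` is (the lift of) a neighbourhood in `ℝⁿ × 𝕋ⁿ` of the product of the separatrices of the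
pendula; the separatrix of a pendulum consists of its homoclinic orbit and of the equilibrium. -/
def IsSeparatrixNhd {n : ℕ} (p₀ q₀ : Fin n → ℝ → ℝ) (O₁ : Set (E n × E n)) : Prop :=
  IsOpen O₁ ∧
  (∀ (a : Fin n → ℤ) (p q : E n), (p, q) ∈ O₁ → (p, q + intVec a) ∈ O₁) ∧
  ∀ p q : E n,
    (∀ i, (p i = 0 ∧ q i = 0) ∨ ∃ s : ℝ, p i = p₀ i s ∧ q i = q₀ i s) → (p, q) ∈ O₁

/-- The domain of the perturbing Hamiltonian: `(p, q) ∈ 𝒪₁`, `I ∈ 𝒪₂`, `|ε| < ε₁`, with `φ` and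
`t` arbitrary. -/
def domain {n d : ℕ} (O₁ : Set (E n × E n)) (O₂ : Set (E d)) (ε₁ : ℝ) : Set (Phase n d) :=
  {x | (x.1, x.2.1) ∈ O₁ ∧ x.2.2.1 ∈ O₂ ∧ |x.2.2.2.2.2| < ε₁}

/-- Perturbing Hamiltonians `h(p, q, I, φ, t; ε)` of class `C^m` with bounded derivatives on the
domain `Ω`, of period `1` in each `q_i`, in each `φ_j` and in `t`. -/
def IsPerturbation {n d : ℕ} (m : ℕ∞) (Ω : Set (Phase n d)) (h : Phase n d → ℝ) : Prop :=
  IsCkBounded m Ω h ∧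
  ∀ (a : Fin n → ℤ) (b : Fin d → ℤ) (c : ℤ) (p q : E n) (I φ : E d) (t ε : ℝ),
    (p, q, I, φ, t, ε) ∈ Ω →
      h (p, q + intVec a, I, φ + intVec b, t + c, ε) = h (p, q, I, φ, t, ε)

/-- The frequency map `ω(I) = ∂h₀/∂I`. -/
def freq {d : ℕ} (h₀ : E d → ℝ) (I : E d) : E d := gradient h₀ I

/-- The Melnikov potential `M(τ, I, φ, t)`. -/
def melnikovPotential {n d : ℕ} (h₀ : E d → ℝ) (p₀ q₀ : Fin n → ℝ → ℝ) (h : Phase n d → ℝ)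
    (τ : E n) (I φ : E d) (t : ℝ) : ℝ :=
  -∫ σ : ℝ,
    (h (shifted p₀ τ σ, shifted q₀ τ σ, I, φ + σ • freq h₀ I, t + σ, 0)
      - h (0, 0, I, φ + σ • freq h₀ I, t + σ, 0))

/-- `τ*` is a family of non-degenerate critical points of `τ ↦ M(τ, I, φ, t)`, defined for `I` in
`B` and `(φ, t)` in the nonempty open set `O` of `𝕋ᵈ × ℝ`, and depending in a `C¹` way on
`(I, φ, t)`.  The set `O` and the family are given by their (periodic) lifts. -/
structure IsCriticalFamily {n d : ℕ} (h₀ : E d → ℝ) (p₀ q₀ : Fin n → ℝ → ℝ) (h : Phase n d → ℝ)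
    (B : Set (E d)) (O : Set (E d × ℝ)) (τs : E d → E d → ℝ → E n) : Prop where
  isOpen : IsOpen O
  nonempty : O.Nonempty
  periodic_set : ∀ (b : Fin d → ℤ) (φ : E d) (t : ℝ), (φ, t) ∈ O → (φ + intVec b, t) ∈ O
  periodic : ∀ I ∈ B, ∀ (b : Fin d → ℤ) (φ : E d) (t : ℝ), (φ, t) ∈ O →
    τs I (φ + intVec b) t = τs I φ t
  contDiffOn : ContDiffOn ℝ 1 (fun x : E d × E d × ℝ => τs x.1 x.2.1 x.2.2) (B ×ˢ O)
  critical : ∀ I ∈ B, ∀ (φ : E d) (t : ℝ), (φ, t) ∈ O →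
    IsNondegCritPt (fun τ => melnikovPotential h₀ p₀ q₀ h τ I φ t) (τs I φ t)

/-- `R` is the reduced Melnikov potential of the family `τ*`: the function of `(I, θ)` with
`R(I, φ - t ω(I)) = M(τ*(I, φ, t), I, φ, t)` for all `I ∈ B`, `(φ, t) ∈ O`.  It is determined by
this for `I ∈ B` and `θ` in the open set of the points of the form `φ - t ω(I)`,
`(φ, t) ∈ O`. -/
def IsReducedPotential {n d : ℕ} (h₀ : E d → ℝ) (p₀ q₀ : Fin n → ℝ → ℝ) (h : Phase n d → ℝ)
    (B : Set (E d)) (O : Set (E d × ℝ)) (τs : E d → E d → ℝ → E n) (R : E d → E d → ℝ) : Prop :=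
  ∀ I ∈ B, ∀ (φ : E d) (t : ℝ), (φ, t) ∈ O →
    R I (φ - t • freq h₀ I) = melnikovPotential h₀ p₀ q₀ h (τs I φ t) I φ t

/-- Condition **H3** for the perturbation `h`. -/
def H3 {n d : ℕ} (h₀ : E d → ℝ) (p₀ q₀ : Fin n → ℝ → ℝ) (O₂ : Set (E d))
    (h : Phase n d → ℝ) : Prop :=
  ∃ (c : E d) (r : ℝ) (O : Set (E d × ℝ)) (τs : E d → E d → ℝ → E n),
    0 < r ∧ Metric.ball c r ⊆ O₂ ∧ IsCriticalFamily h₀ p₀ q₀ h (Metric.ball c r) O τs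

/-- Condition **H4** for the perturbation `h`. -/
def H4 {n d : ℕ} (h₀ : E d → ℝ) (p₀ q₀ : Fin n → ℝ → ℝ) (O₂ : Set (E d))
    (h : Phase n d → ℝ) : Prop :=
  ∃ (c : E d) (r : ℝ) (O : Set (E d × ℝ)) (τs : E d → E d → ℝ → E n) (R : E d → E d → ℝ),
    0 < r ∧ Metric.ball c r ⊆ O₂ ∧ IsCriticalFamily h₀ p₀ q₀ h (Metric.ball c r) O τs ∧
    IsReducedPotential h₀ p₀ q₀ h (Metric.ball c r) O τs R ∧
    ∃ (c' : E d) (r' : ℝ), 0 < r' ∧ Metric.ball c' r' ⊆ Metric.ball c r ∧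
      ∀ I ∈ Metric.ball c' r', ∀ (φ : E d) (t : ℝ), (φ, t) ∈ O →
        DifferentiableAt ℝ (R I) (φ - t • freq h₀ I) ∧
        fderiv ℝ (R I) (φ - t • freq h₀ I) ≠ 0

/-- The condition `P` is open in the `C^r` topology, among the perturbations of class `C^m`. -/
def IsCrOpen {n d : ℕ} (r : ℕ) (m : ℕ∞) (Ω : Set (Phase n d))
    (P : (Phase n d → ℝ) → Prop) : Prop :=
  ∀ h, IsPerturbation m Ω h → P h →
    ∃ δ : ℝ, 0 < δ ∧ ∀ h', IsPerturbation m Ω h' → IsCrSmall r δ Ω (fun x => h' x - h x) → P h'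

/-- The condition `P` is `C^∞`-dense among the perturbations of class `C^m`: each of these can be
made to satisfy `P` by adding a smooth perturbation that is as small as one wishes in the `C^∞`
topology (whose basic neighbourhoods of `0` are the balls of all the `C^r` norms, `r` finite). -/
def IsSmoothDense {n d : ℕ} (m : ℕ∞) (Ω : Set (Phase n d))
    (P : (Phase n d → ℝ) → Prop) : Prop :=
  ∀ h, IsPerturbation m Ω h → ∀ (r : ℕ) (δ : ℝ), 0 < δ →
    ∃ g, IsPerturbation ⊤ Ω g ∧ IsCrSmall r δ Ω g ∧ P (fun x => h x + g x)

end GlobalMelnikov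

end

/-! Write M for the Melnikov potential. Shifting the integration variable gives M(τ, I, φ, t) = M(τ
- t·1, I, φ - tω(I), 0). By the implicit function theorem one non-degenerate critical point
therefore spreads to a whole critical family, and the family comes with a reduced potential: the
critical value at t = 0 (`exists_criticalFamily`). By the envelope formula the θ-derivative of a
reduced potential is ∂M/∂φ at the critical point. Hence H3 only asks for one non-degenerate critical
point of M(·, I, φ, t), for some I in the ball and some φ, t, and H4 asks in addition that ∂M/∂φ ≠ 0
there (`H3_iff`, `H4_iff`).

Openness. Near each point M is C², with C² norm at most a constant times the C³ norm of h
(`exists_bound_extMelnikov`). Indeed the integrand decays exponentially because the homoclinic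
orbits do, its derivatives up to order three in the parameters grow at most like (1 + |σ|)³, and
interpolation between these two facts makes the first two derivatives decay exponentially as well. A
C³-small change of h is thus a C²-small change of M: the critical point survives nearby
(`IsNondegCritPt.exists_of_close`) and ∂M/∂φ changes little.

Density. M is bounded in τ, so its τ-gradient is as small as desired at some τ₀
(`exists_norm_fderiv_lt`). A bump near one point of the i-th loop, multiplied by a trigonometric
function of time, has as Melnikov potential a sinusoid in τ_i; every small amplitude and phase is
reached because some bump has a non-zero Fourier coefficient along the orbit
(`IsPendulumLoop.exists_bump`, `exists_wave`). Small waves of this kind cancel the gradient at τ₀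
and shift the Hessian by a multiple of the identity, chosen off a finite set of eigenvalues
(`exists_isNondegCritPt_add_trigSum`). For H4 a wave in one angle is added beforehand, if needed, to
make ∂M/∂φ non-zero at τ₀; the waves in time alone do not affect it. -/

noncomputable section

namespace GlobalMelnikov

open Filter Topology MeasureTheory Metric Set

/-! ### Interpolation, differentiation under the integral, derivatives of compositions -/

section Calculus

/-- An interpolation inequality for the first derivative at the centre of a ball. -/
theorem norm_fderiv_le_interpolation {X Y : Type*} [NormedAddCommGroup X] [NormedSpace ℝ X]
    [NormedAddCommGroup Y] [NormedSpace ℝ Y] {f : X → Y} {x : X} {s ε K : ℝ} (hs : 0 < s)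
    (hd : ∀ y ∈ closedBall x s, DifferentiableAt ℝ f y)
    (hd' : ∀ y ∈ closedBall x s, DifferentiableAt ℝ (fderiv ℝ f) y)
    (hε : ∀ y ∈ closedBall x s, ‖f y‖ ≤ ε)
    (hK : ∀ y ∈ closedBall x s, ‖fderiv ℝ (fderiv ℝ f) y‖ ≤ K) :
    ‖fderiv ℝ f x‖ ≤ 2 * ε / s + K * s := by
  have hx : x ∈ closedBall x s := mem_closedBall_self hs.le
  have hK0 : 0 ≤ K := (norm_nonneg (fderiv ℝ (fderiv ℝ f) x)).trans (hK x hx)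
  have h1 : ∀ y ∈ closedBall x s, ‖fderiv ℝ f y - fderiv ℝ f x‖ ≤ K * s := fun y hy =>
    ((convex_closedBall x s).norm_image_sub_le_of_norm_fderiv_le hd' hK hx hy).trans
      (mul_le_mul_of_nonneg_left (mem_closedBall_iff_norm.1 hy) hK0)
  have h2 : ∀ y ∈ closedBall x s, ‖f y - f x - fderiv ℝ f x (y - x)‖ ≤ K * s * ‖y - x‖ :=
    fun y hy => (convex_closedBall x s).norm_image_sub_le_of_norm_fderiv_le' hd h1 hx hy
  have hε0 : 0 ≤ ε := (norm_nonneg _).trans (hε x hx)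
  refine ContinuousLinearMap.opNorm_le_of_unit_norm (by positivity) fun v hv => ?_
  -- Taylor expansion over a step of length s: s f'(x)v is a difference of two values of f, at most
  -- 2ε, plus a remainder of at most K s².
  have hy : x + s • v ∈ closedBall x s := by
    simp [norm_smul, hv, abs_of_pos hs]
  have h3 := h2 _ hy
  simp only [add_sub_cancel_left, map_smul, norm_smul, hv, Real.norm_eq_abs, abs_of_pos hs,
    mul_one] at h3
  have h4 : ‖s • fderiv ℝ f x v‖ ≤ 2 * ε + K * s * s := by
    calc ‖s • fderiv ℝ f x v‖ = ‖f (x + s • v) - f x - (f (x + s • v) - f x - s • fderiv ℝ f x v)‖ := by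
          congr 1; abel
      _ ≤ ‖f (x + s • v) - f x‖ + ‖f (x + s • v) - f x - s • fderiv ℝ f x v‖ := norm_sub_le _ _
      _ ≤ (‖f (x + s • v)‖ + ‖f x‖) + K * s * s := add_le_add (norm_sub_le _ _) h3
      _ ≤ _ := by have := hε _ hy; have := hε _ hx; linarith
  rw [norm_smul, Real.norm_eq_abs, abs_of_pos hs] at h4
  rw [show 2 * ε / s + K * s = (2 * ε + K * s * s) / s by field_simp, le_div_iff₀ hs]
  linarith

/-- Dominated integrals of `C^m` families are `C^m`. -/
theorem contDiffOn_integral {X : Type} [NormedAddCommGroup X] [NormedSpace ℝ X] (m : ℕ) :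
    ∀ {Y : Type} [NormedAddCommGroup Y] [NormedSpace ℝ Y] {F : ℝ → X → Y}
    {U : Set X} (_ : IsOpen U)
    (_ : ∀ σ, ∀ x ∈ U, ContDiffAt ℝ m (Function.uncurry F) (σ, x))
    {b : ℝ → ℝ} (_ : Integrable b)
    (_ : ∀ j ≤ m, ∀ σ, ∀ x ∈ U, ‖iteratedFDeriv ℝ j (F σ) x‖ ≤ b σ),
    ContDiffOn ℝ m (fun x => ∫ σ, F σ x) U ∧
      ∀ j ≤ m, ∀ x ∈ U, ‖iteratedFDeriv ℝ j (fun x => ∫ σ, F σ x) x‖ ≤ ∫ σ, b σ := by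
  -- The target Y varies in the induction, since the derivative takes values in `X →L[ℝ] Y`.
  induction m with
  | zero =>
    intro Y _ _ F U hU hF b hb hbd
    have hbd0 : ∀ σ, ∀ x ∈ U, ‖F σ x‖ ≤ b σ := fun σ x hx => by
      simpa using hbd 0 le_rfl σ x hx
    have hc : ∀ σ, ∀ x ∈ U, ContinuousAt (Function.uncurry F) (σ, x) := fun σ x hx =>
      (hF σ x hx).continuousAt
    constructor
    · rw [Nat.cast_zero, contDiffOn_zero]
      refine continuousOn_of_dominated (bound := b) (fun x hx => ?_) (fun x hx => ?_) hb ?_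
      · refine Continuous.aestronglyMeasurable (continuous_iff_continuousAt.2 fun σ => ?_)
        exact ContinuousAt.comp (f := fun σ => (σ, x)) (hc σ x hx) (by fun_prop)
      · exact Eventually.of_forall fun σ => hbd0 σ x hx
      · refine Eventually.of_forall fun σ x hx => ContinuousAt.continuousWithinAt ?_
        exact ContinuousAt.comp (f := fun x => (σ, x)) (hc σ x hx) (by fun_prop)
    · intro j hj x hx
      obtain rfl : j = 0 := by omega
      rw [norm_iteratedFDeriv_zero]
      exact norm_integral_le_of_norm_le hb (Eventually.of_forall fun σ => hbd0 σ x hx)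
  | succ m ih =>
    intro Y _ _ F U hU hF b hb hbd
    have hbd0 : ∀ σ, ∀ x ∈ U, ‖F σ x‖ ≤ b σ := fun σ x hx => by
      simpa using hbd 0 (Nat.zero_le _) σ x hx
    -- Joint smoothness in (σ, x) passes to the partial derivative in x; its continuity in σ gives
    -- the measurability needed below.
    have hF' : ∀ σ, ∀ x ∈ U,
        ContDiffAt ℝ m (Function.uncurry fun σ x => fderiv ℝ (F σ) x) (σ, x) := fun σ x hx => by
      have h1 : ContDiffAt ℝ (m + 1 : ℕ) (Function.uncurry fun (z : ℝ × X) (x : X) => F z.1 x)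
          ((σ, x), x) := by
        have : (Function.uncurry fun (z : ℝ × X) (x : X) => F z.1 x) =
          Function.uncurry F ∘ fun y : (ℝ × X) × X => (y.1.1, y.2) := rfl
        rw [this]
        exact ContDiffAt.comp _ (hF σ x hx) (by fun_prop)
      exact ContDiffAt.fderiv (g := fun z : ℝ × X => z.2) h1 contDiffAt_snd (by norm_cast)
    have hbd' : ∀ j ≤ m, ∀ σ, ∀ x ∈ U, ‖iteratedFDeriv ℝ j (fun x => fderiv ℝ (F σ) x) x‖ ≤ b σ :=
      fun j hj σ x hx => by
        have := hbd (j + 1) (by omega) σ x hx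
        rwa [← norm_iteratedFDeriv_fderiv] at this
    obtain ⟨h1, h2⟩ := ih hU hF' hb hbd'
    have hmeas : ∀ x ∈ U, AEStronglyMeasurable (fun σ => F σ x) volume := fun x hx => by
      refine Continuous.aestronglyMeasurable (continuous_iff_continuousAt.2 fun σ => ?_)
      exact ContinuousAt.comp (f := fun σ => (σ, x)) (hF σ x hx).continuousAt (by fun_prop)
    have hmeas' : ∀ x ∈ U, AEStronglyMeasurable (fun σ => fderiv ℝ (F σ) x) volume := fun x hx => by
      refine Continuous.aestronglyMeasurable (continuous_iff_continuousAt.2 fun σ => ?_)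
      exact ContinuousAt.comp (f := fun σ => (σ, x)) (hF' σ x hx).continuousAt (by fun_prop)
    have hder : ∀ x ∈ U, HasFDerivAt (fun x => ∫ σ, F σ x) (∫ σ, fderiv ℝ (F σ) x) x := by
      intro x hx
      refine hasFDerivAt_integral_of_dominated_of_fderiv_le (F := fun x σ => F σ x)
        (F' := fun x σ => fderiv ℝ (F σ) x) (bound := b) (hU.mem_nhds hx) ?_ ?_ (hmeas' x hx) ?_ hb ?_
      · filter_upwards [hU.mem_nhds hx] with y hy using hmeas y hy
      · exact hb.mono' (hmeas x hx) (Eventually.of_forall fun σ => hbd0 σ x hx)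
      · exact Eventually.of_forall fun σ y hy => by
          simpa using hbd' 0 (Nat.zero_le _) σ y hy
      · refine Eventually.of_forall fun σ y hy => ?_
        have h : ContDiffAt ℝ (m + 1 : ℕ) (F σ) y :=
          ContDiffAt.comp (f := fun x => (σ, x)) y (hF σ y hy) (by fun_prop)
        exact (h.differentiableAt (by simp)).hasFDerivAt
    constructor
    · rw [Nat.cast_succ, contDiffOn_succ_iff_fderiv_of_isOpen hU]
      refine ⟨fun x hx => (hder x hx).differentiableAt.differentiableWithinAt, by simp, ?_⟩
      exact h1.congr fun x hx => (hder x hx).fderiv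
    · intro j hj x hx
      rcases j with _ | j
      · rw [norm_iteratedFDeriv_zero]
        exact norm_integral_le_of_norm_le hb (Eventually.of_forall fun σ => hbd0 σ x hx)
      · rw [← norm_iteratedFDeriv_fderiv]
        have : fderiv ℝ (fun x => ∫ σ, F σ x) =ᶠ[𝓝 x] fun x => ∫ σ, fderiv ℝ (F σ) x := by
          filter_upwards [hU.mem_nhds hx] with y hy using (hder y hy).fderiv
        rw [(this.iteratedFDeriv ℝ j).eq_of_nhds]
        exact h2 j (by omega) x hx

theorem norm_iteratedFDeriv_comp_le_of_isOpen {X Y Z : Type*} [NormedAddCommGroup X]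
    [NormedSpace ℝ X] [NormedAddCommGroup Y] [NormedSpace ℝ Y] [NormedAddCommGroup Z]
    [NormedSpace ℝ Z] {g : Y → Z} {f : X → Y} {n : ℕ} {s : Set X} {t : Set Y} (hs : IsOpen s)
    (ht : IsOpen t) (hg : ContDiffOn ℝ n g t) (hf : ContDiffOn ℝ n f s) (hst : MapsTo f s t) {x : X}
    (hx : x ∈ s) {C D : ℝ} (hC : ∀ i ≤ n, ‖iteratedFDeriv ℝ i g (f x)‖ ≤ C)
    (hD : ∀ i, 1 ≤ i → i ≤ n → ‖iteratedFDeriv ℝ i f x‖ ≤ D ^ i) :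
    ‖iteratedFDeriv ℝ n (fun x => g (f x)) x‖ ≤ n.factorial * C * D ^ n := by
  have h := norm_iteratedFDerivWithin_comp_le hg hf le_rfl ht.uniqueDiffOn hs.uniqueDiffOn hst hx
    (C := C) (D := D) (fun i hi => ?_) (fun i h1 hi => ?_)
  · rwa [iteratedFDerivWithin_of_isOpen n hs hx] at h
  · rw [iteratedFDerivWithin_of_isOpen i ht (hst hx)]; exact hC i hi
  · rw [iteratedFDerivWithin_of_isOpen i hs hx]; exact hD i h1 hi

/-- The bound has the form D ^ i required of the inner function in the composition estimate. -/
theorem norm_iteratedFDeriv_affine_le {X Y : Type*} [NormedAddCommGroup X]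
    [NormedSpace ℝ X] [NormedAddCommGroup Y] [NormedSpace ℝ Y] (L : X →L[ℝ] Y) (c : Y) {D : ℝ}
    (hD : ‖L‖ ≤ D) (i : ℕ) (hi : 1 ≤ i) (x : X) :
    ‖iteratedFDeriv ℝ i (fun y => L y + c) x‖ ≤ D ^ i := by
  have hD0 : 0 ≤ D := (norm_nonneg _).trans hD
  obtain ⟨j, rfl⟩ : ∃ j, i = j + 1 := ⟨i - 1, by omega⟩
  rw [← norm_iteratedFDeriv_fderiv]
  have : fderiv ℝ (fun y => L y + c) = fun _ => L := by
    ext1 y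
    rw [fderiv_add_const, ContinuousLinearMap.fderiv]
  rw [this]
  rcases j with _ | j
  · simpa using hD
  · rw [iteratedFDeriv_const_of_ne (by omega)]
    simp only [Pi.zero_apply, norm_zero]
    positivity

end Calculus

/-! ### Critical points: persistence, near-critical points, generic non-degeneracy -/

section Critical

theorem exists_equiv_of_injective {n : ℕ} {L : E n →L[ℝ] (E n →L[ℝ] ℝ)}
    (hL : Function.Injective L) :
    ∃ e : E n ≃L[ℝ] (E n →L[ℝ] ℝ), (e : E n →L[ℝ] (E n →L[ℝ] ℝ)) = L := by
  have hf : Module.finrank ℝ (E n) = Module.finrank ℝ (E n →L[ℝ] ℝ) :=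
    (InnerProductSpace.toDual ℝ (E n)).toLinearEquiv.finrank_eq
  refine ⟨(LinearEquiv.ofInjectiveOfFinrankEq (L : E n →ₗ[ℝ] (E n →L[ℝ] ℝ)) hL hf).toContinuousLinearEquiv, ?_⟩
  ext v w
  rfl

/-- If A v = 0, then ‖v‖ ≤ ‖e⁻¹‖ ‖e v‖ = ‖e⁻¹‖ ‖(A - e) v‖ ≤ ‖e⁻¹‖ c ‖v‖, which forces v = 0. -/
theorem injective_of_norm_sub_lt {n : ℕ} (e : E n ≃L[ℝ] (E n →L[ℝ] ℝ))
    {A : E n →L[ℝ] (E n →L[ℝ] ℝ)} {c : ℝ} (hc : ‖(e.symm : (E n →L[ℝ] ℝ) →L[ℝ] E n)‖ * c < 1)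
    (hA : ‖A - e‖ ≤ c) : Function.Injective A := by
  rw [injective_iff_map_eq_zero]
  intro v hv
  by_contra hne
  have hv0 : 0 < ‖v‖ := norm_pos_iff.2 hne
  have h1 : ‖e v‖ ≤ c * ‖v‖ := by
    have h := (A - (e : E n →L[ℝ] (E n →L[ℝ] ℝ))).le_of_opNorm_le hA v
    simpa [hv] using h
  have h2 : ‖v‖ ≤ ‖(e.symm : (E n →L[ℝ] ℝ) →L[ℝ] E n)‖ * ‖e v‖ := by
    simpa using (e.symm : (E n →L[ℝ] ℝ) →L[ℝ] E n).le_opNorm (e v)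
  have h3 := h2.trans (mul_le_mul_of_nonneg_left h1
    (norm_nonneg (e.symm : (E n →L[ℝ] ℝ) →L[ℝ] E n)))
  nlinarith

/-- Non-degenerate critical points persist under `C²`-small perturbations. -/
theorem IsNondegCritPt.exists_of_close {n : ℕ} (hn : 1 ≤ n) {f : E n → ℝ} {x₀ : E n}
    (hf : IsNondegCritPt f x₀) {ρ : ℝ} (hρ : 0 < ρ) :
    ∃ δ : ℝ, 0 < δ ∧ ∀ e : E n → ℝ, ContDiffOn ℝ 2 e (ball x₀ ρ) →
      (∀ x ∈ ball x₀ ρ, ‖fderiv ℝ e x‖ ≤ δ) →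
      (∀ x ∈ ball x₀ ρ, ‖fderiv ℝ (fderiv ℝ e) x‖ ≤ δ) →
      ∃ x ∈ ball x₀ ρ, IsNondegCritPt (fun x => f x + e x) x := by
  obtain ⟨hC2, hcrit, hinj⟩ := hf
  obtain ⟨L, hL⟩ := exists_equiv_of_injective hinj
  have : Nonempty (Fin n) := ⟨⟨0, hn⟩⟩
  have : Nontrivial (E n) := inferInstance
  set N : ℝ := ‖(L.symm : (E n →L[ℝ] ℝ) →L[ℝ] E n)‖ with hN
  have hNpos : 0 < N := L.norm_symm_pos
  -- The total Hessian may differ from L by c, half of what invertibility tolerates. The variation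
  -- of the Hessian of f and the Hessian of e use c / 2 each.
  set c : ℝ := N⁻¹ / 2 with hc
  have hcpos : 0 < c := by positivity
  have hcont : ContinuousAt (fderiv ℝ (fderiv ℝ f)) x₀ :=
    ((hC2.fderiv_right (m := 1) (by norm_num)).fderiv_right (m := 0) (by norm_num)).continuousAt
  have hev : ∀ᶠ x in 𝓝 x₀, ContDiffAt ℝ 2 f x ∧ ‖fderiv ℝ (fderiv ℝ f) x - L‖ < c / 2 := by
    refine (hC2.eventually (by simp)).and ?_
    have h := hcont.eventually (Metric.ball_mem_nhds (fderiv ℝ (fderiv ℝ f) x₀)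
      (show 0 < c / 2 by positivity))
    rw [← hL] at h
    filter_upwards [h] with x hx
    exact (dist_eq_norm (fderiv ℝ (fderiv ℝ f) x)
      (L : E n →L[ℝ] (E n →L[ℝ] ℝ))).symm.trans_lt hx
  obtain ⟨r, hr, hball⟩ := Metric.eventually_nhds_iff_ball.1 (hev.and (ball_mem_nhds x₀ hρ))
  -- The first bound is for the Hessian of e. The second places 0 within distance c * (r / 2) of the
  -- perturbed gradient at x₀.
  refine ⟨min (c / 2) (c * (r / 2)), by positivity, fun e he he1 he2 => ?_⟩
  have hsub : closedBall x₀ (r / 2) ⊆ ball x₀ r := closedBall_subset_ball (by linarith)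
  have heAt : ∀ x ∈ ball x₀ r, ContDiffAt ℝ 2 e x := fun x hx =>
    he.contDiffAt (isOpen_ball.mem_nhds (hball x hx).2)
  have hgC2 : ∀ x ∈ ball x₀ r, ContDiffAt ℝ 2 (fun x => f x + e x) x := fun x hx =>
    (hball x hx).1.1.add (heAt x hx)
  have hg1 : ∀ x ∈ ball x₀ r, fderiv ℝ (fun x => f x + e x) x = fderiv ℝ f x + fderiv ℝ e x :=
    fun x hx => fderiv_fun_add ((hball x hx).1.1.differentiableAt (by simp))
      ((heAt x hx).differentiableAt (by simp))
  have hg2 : ∀ x ∈ ball x₀ r, fderiv ℝ (fderiv ℝ (fun x => f x + e x)) x =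
      fderiv ℝ (fderiv ℝ f) x + fderiv ℝ (fderiv ℝ e) x := fun x hx => by
    have : fderiv ℝ (fun x => f x + e x) =ᶠ[𝓝 x] fun x => fderiv ℝ f x + fderiv ℝ e x := by
      filter_upwards [isOpen_ball.mem_nhds hx] with y hy using hg1 y hy
    rw [this.fderiv_eq]
    exact fderiv_fun_add
      (((hball x hx).1.1.fderiv_right (m := 1) (by norm_num)).differentiableAt (by simp))
      (((heAt x hx).fderiv_right (m := 1) (by norm_num)).differentiableAt (by simp))
  have hclose : ∀ x ∈ ball x₀ r, ‖fderiv ℝ (fderiv ℝ (fun x => f x + e x)) x - L‖ ≤ c :=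
    fun x hx => by
    rw [hg2 x hx, add_sub_right_comm]
    refine (norm_add_le (fderiv ℝ (fderiv ℝ f) x - L) (fderiv ℝ (fderiv ℝ e) x)).trans ?_
    have h1 := (hball x hx).1.2.le
    have h2 := (he2 x (hball x hx).2).trans (min_le_left _ _)
    linarith
  have happ : ApproximatesLinearOn (fderiv ℝ (fun x => f x + e x))
      (L : E n →L[ℝ] (E n →L[ℝ] ℝ)) (closedBall x₀ (r / 2)) ⟨c, hcpos.le⟩ := by
    intro x hx y hy
    exact (convex_closedBall x₀ (r / 2)).norm_image_sub_le_of_norm_fderiv_le'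
      (fun z hz => ((hgC2 z (hsub hz)).fderiv_right (m := 1) (by norm_num)).differentiableAt
        (by simp)) (fun z hz => hclose z (hsub hz)) hy hx
  -- Quantitative inverse function theorem: the perturbed gradient maps the ball of radius r / 2
  -- onto a set containing the ball of radius (N⁻¹ - c) * (r / 2) = c * (r / 2) about its value at
  -- x₀.
  have hsurj := happ.surjOn_closedBall_of_nonlinearRightInverse L.toNonlinearRightInverse
    (ε := r / 2) (b := x₀) (by positivity) Subset.rfl
  have hx₀ : x₀ ∈ ball x₀ r := mem_ball_self hr
  have h0 : (0 : E n →L[ℝ] ℝ) ∈ closedBall (fderiv ℝ (fun x => f x + e x) x₀)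
      (((L.toNonlinearRightInverse.nnnorm : ℝ)⁻¹ - (⟨c, hcpos.le⟩ : NNReal)) * (r / 2)) := by
    rw [mem_closedBall, dist_zero_left, hg1 x₀ hx₀, hcrit, zero_add]
    refine ((he1 x₀ (hball x₀ hx₀).2).trans (min_le_right _ _)).trans (le_of_eq ?_)
    change c * (r / 2) = (N⁻¹ - c) * (r / 2)
    rw [hc]; ring
  obtain ⟨x, hx, hx0⟩ := hsurj h0
  refine ⟨x, (hball x (hsub hx)).2, hgC2 x (hsub hx), hx0, ?_⟩
  refine injective_of_norm_sub_lt L (c := c) ?_ (hclose x (hsub hx))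
  rw [← hN, hc]
  field_simp
  norm_num

/-- A bounded differentiable function has points where its gradient is as small as one wishes. -/
theorem exists_norm_fderiv_lt {n : ℕ} {f : E n → ℝ} (hf : Differentiable ℝ f) {K : ℝ}
    (hK : ∀ x, |f x| ≤ K) {ε : ℝ} (hε : 0 < ε) : ∃ x, ‖fderiv ℝ f x‖ < ε := by
  have hK0 : 0 ≤ K := (abs_nonneg _).trans (hK 0)
  -- The coercive function f + η‖x‖² has a minimum. There ‖f'(x)‖ = 2η‖x‖, and comparison with 0
  -- gives η‖x‖² ≤ 2K, so ‖f'(x)‖² ≤ 8ηK < ε².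
  set η : ℝ := ε ^ 2 / (16 * (K + 1)) with hη
  have hη0 : 0 < η := by positivity
  have hlim : Tendsto (fun x => f x + η * ‖x‖ ^ 2) (cocompact (E n)) atTop := by
    have h1 : Tendsto (fun x : E n => -K + η * ‖x‖ ^ 2) (cocompact (E n)) atTop :=
      tendsto_atTop_add_const_left _ _
        (((tendsto_pow_atTop (by norm_num)).comp (tendsto_norm_cocompact_atTop)).const_mul_atTop hη0)
    exact tendsto_atTop_mono (fun x => by have := abs_le.1 (hK x); linarith) h1
  obtain ⟨x, hx⟩ := Continuous.exists_forall_le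
    (f := fun x : E n => f x + η * ‖x‖ ^ 2) (hf.continuous.add (by fun_prop)) hlim
  have hmin : IsLocalMin (fun x => f x + η * ‖x‖ ^ 2) x := Eventually.of_forall hx
  have hder : HasFDerivAt (fun x => f x + η * ‖x‖ ^ 2)
      (fderiv ℝ f x + η • (2 • innerSL ℝ x)) x :=
    (hf x).hasFDerivAt.add ((hasStrictFDerivAt_norm_sq x).hasFDerivAt.const_mul η)
  have h0 := hmin.hasFDerivAt_eq_zero hder
  refine ⟨x, ?_⟩
  have h1 : ‖fderiv ℝ f x‖ = η * (2 * ‖x‖) := by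
    rw [eq_neg_of_add_eq_zero_left h0, norm_neg, norm_smul, Real.norm_eq_abs, abs_of_pos hη0,
      ← Nat.cast_smul_eq_nsmul ℝ, norm_smul, innerSL_apply_norm]
    norm_num
  have h2 : η * ‖x‖ ^ 2 ≤ 2 * K := by
    have := hx 0
    simp only [norm_zero] at this
    have h3 := abs_le.1 (hK x)
    have h4 := abs_le.1 (hK 0)
    nlinarith
  rw [h1]
  refine lt_of_pow_lt_pow_left₀ 2 hε.le ?_
  have h3 : (η * (2 * ‖x‖)) ^ 2 = 4 * η * (η * ‖x‖ ^ 2) := by ring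
  have h5 : η * (16 * (K + 1)) = ε ^ 2 := by rw [hη]; field_simp
  rw [h3]
  have h6 : 4 * η * (η * ‖x‖ ^ 2) ≤ 4 * η * (2 * K) := mul_le_mul_of_nonneg_left h2 (by positivity)
  nlinarith

/-- Under the Riesz isomorphism A becomes an endomorphism, and a degenerate w makes -w one of its
eigenvalues. There are finitely many of these and infinitely many w in (0, w₀). -/
theorem exists_nondegenerate_add_inner {n : ℕ} (A : E n →L[ℝ] (E n →L[ℝ] ℝ)) {w₀ : ℝ}
    (hw₀ : 0 < w₀) :
    ∃ w, 0 < w ∧ w < w₀ ∧ ∀ v, (∀ u, A v u + w * inner ℝ v u = 0) → v = 0 := by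
  let T : Module.End ℝ (E n) :=
    ((InnerProductSpace.toDual ℝ (E n)).symm.toLinearEquiv.toLinearMap).comp A.toLinearMap
  have hfin : {μ | T.HasEigenvalue μ}.Finite := Module.End.finite_hasEigenvalue T
  have hinf : ((fun w => -w) '' Ioo 0 w₀).Infinite :=
    (Ioo_infinite hw₀).image neg_injective.injOn
  obtain ⟨_, ⟨w, hw, rfl⟩, hne⟩ := (hinf.sdiff hfin).nonempty
  refine ⟨w, hw.1, hw.2, fun v hv => ?_⟩
  by_contra hv0
  refine hne (Module.End.hasEigenvalue_of_hasEigenvector (x := v) ⟨?_, hv0⟩)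
  rw [Module.End.mem_eigenspace_iff]
  apply (InnerProductSpace.toDual ℝ (E n)).injective
  ext u
  have h := hv u
  simp only [LinearMap.coe_comp, LinearEquiv.coe_coe, LinearIsometryEquiv.coe_toLinearEquiv,
    ContinuousLinearMap.coe_coe, Function.comp_apply, LinearIsometryEquiv.apply_symm_apply, T,
    InnerProductSpace.toDual_apply_apply, inner_smul_left]
  simp only [map_neg, conj_trivial]
  linarith

end Critical

end GlobalMelnikov
end

noncomputable section

namespace GlobalMelnikov

open Filter Topology MeasureTheory Metric Set

/-! ### Exponential decay from differential inequalities -/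

section Decay

/-- The right-hand side is non-increasing in t and tends to L. Applied to H and to -H this gives the
two-sided estimate. -/
theorem le_add_exp_of_deriv_exp {H H' : ℝ → ℝ} {C μ L T₀ : ℝ} (hμ : 0 < μ)
    (hH : ∀ t, T₀ ≤ t → HasDerivAt H (H' t) t) (hb : ∀ t, T₀ ≤ t → |H' t| ≤ C * Real.exp (-μ * t))
    (hL : Tendsto H atTop (𝓝 L)) {t : ℝ} (ht : T₀ ≤ t) :
    L ≤ H t + C / μ * Real.exp (-μ * t) := by
  have hder : ∀ t, T₀ ≤ t → HasDerivAt (fun t => H t + C / μ * Real.exp (-μ * t))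
      (H' t + C / μ * (Real.exp (-μ * t) * (-μ * 1))) t := fun t ht =>
    (hH t ht).add ((((hasDerivAt_id t).const_mul (-μ)).exp).const_mul (C / μ))
  have hanti : AntitoneOn (fun t => H t + C / μ * Real.exp (-μ * t)) (Ici T₀) := by
    refine antitoneOn_of_deriv_nonpos (convex_Ici T₀)
      (fun t ht => (hder t ht).continuousAt.continuousWithinAt)
      (fun t ht => ?_) (fun t ht => ?_)
    · rw [interior_Ici] at ht
      exact (hder t ht.le).differentiableAt.differentiableWithinAt
    · rw [interior_Ici] at ht
      rw [(hder t ht.le).deriv]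
      have h1 := (abs_le.1 (hb t ht.le)).2
      have h2 : C / μ * (Real.exp (-μ * t) * (-μ * 1)) = -(C * Real.exp (-μ * t)) := by
        field_simp
      linarith
  have hlim : Tendsto (fun t => H t + C / μ * Real.exp (-μ * t)) atTop (𝓝 (L + C / μ * 0)) := by
    refine hL.add (Tendsto.const_mul _ (Real.tendsto_exp_atBot.comp ?_))
    exact tendsto_id.const_mul_atTop_of_neg (by linarith)
  rw [mul_zero, add_zero] at hlim
  refine le_of_tendsto hlim ?_
  filter_upwards [eventually_ge_atTop t] with u hu using hanti ht (ht.trans hu) hu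

/-- A function whose derivative decays exponentially converges exponentially fast. -/
theorem abs_sub_le_of_deriv_exp {H H' : ℝ → ℝ} {C μ L T₀ : ℝ} (hμ : 0 < μ)
    (hH : ∀ t, T₀ ≤ t → HasDerivAt H (H' t) t) (hb : ∀ t, T₀ ≤ t → |H' t| ≤ C * Real.exp (-μ * t))
    (hL : Tendsto H atTop (𝓝 L)) {t : ℝ} (ht : T₀ ≤ t) :
    |H t - L| ≤ C / μ * Real.exp (-μ * t) := by
  have h1 := le_add_exp_of_deriv_exp hμ hH hb hL ht
  have h2 := le_add_exp_of_deriv_exp (H := fun t => -H t) (H' := fun t => -H' t) hμ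
    (fun t ht => (hH t ht).neg) (fun t ht => by rw [abs_neg]; exact hb t ht) hL.neg ht
  rw [abs_le]
  constructor <;> linarith

/-- Exponential decay of the bounded solutions of `w'' ≥ lam² w`. -/
theorem le_exp_of_second_deriv_ge {w w₁ w₂ : ℝ → ℝ} {lam T₀ : ℝ} (hlam : 0 < lam)
    (h1 : ∀ t, T₀ ≤ t → HasDerivAt w (w₁ t) t) (h2 : ∀ t, T₀ ≤ t → HasDerivAt w₁ (w₂ t) t)
    (hw : ∀ t, T₀ ≤ t → lam ^ 2 * w t ≤ w₂ t) (hlim : Tendsto w atTop (𝓝 0))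
    (hlim₁ : Tendsto w₁ atTop (𝓝 0)) {t : ℝ} (ht : T₀ ≤ t) :
    w t ≤ Real.exp (lam * T₀) * w T₀ * Real.exp (-lam * t) := by
  -- Factor D² - lam² as (D - lam)(D + lam). The function e^(-lam t)(w' + lam w) has derivative
  -- e^(-lam t)(w'' - lam² w) ≥ 0 and tends to 0, so w' + lam w ≤ 0.
  have hder : ∀ t, T₀ ≤ t → HasDerivAt (fun t => Real.exp (-lam * t) * (w₁ t + lam * w t))
      (Real.exp (-lam * t) * (-lam * 1) * (w₁ t + lam * w t) +
        Real.exp (-lam * t) * (w₂ t + lam * w₁ t)) t := fun t ht =>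
    (((hasDerivAt_id t).const_mul (-lam)).exp).mul ((h2 t ht).add ((h1 t ht).const_mul lam))
  have hmono : MonotoneOn (fun t => Real.exp (-lam * t) * (w₁ t + lam * w t)) (Ici T₀) := by
    refine monotoneOn_of_deriv_nonneg (convex_Ici T₀)
      (fun t ht => (hder t ht).continuousAt.continuousWithinAt)
      (fun t ht => ?_) (fun t ht => ?_)
    · rw [interior_Ici] at ht
      exact (hder t ht.le).differentiableAt.differentiableWithinAt
    · rw [interior_Ici] at ht
      rw [(hder t ht.le).deriv]
      have h3 : Real.exp (-lam * t) * (-lam * 1) * (w₁ t + lam * w t) +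
        Real.exp (-lam * t) * (w₂ t + lam * w₁ t) =
          Real.exp (-lam * t) * (w₂ t - lam ^ 2 * w t) := by ring
      rw [h3]
      exact mul_nonneg (Real.exp_pos _).le (sub_nonneg.2 (hw t ht.le))
  have hexp : Tendsto (fun t => Real.exp (-lam * t)) atTop (𝓝 0) :=
    Real.tendsto_exp_atBot.comp (tendsto_id.const_mul_atTop_of_neg (by linarith))
  have hlimg : Tendsto (fun t => Real.exp (-lam * t) * (w₁ t + lam * w t)) atTop
      (𝓝 (0 * (0 + lam * 0))) := hexp.mul (hlim₁.add (hlim.const_mul lam))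
  rw [zero_mul] at hlimg
  have hneg : ∀ t, T₀ ≤ t → w₁ t + lam * w t ≤ 0 := fun t ht => by
    have h : Real.exp (-lam * t) * (w₁ t + lam * w t) ≤ 0 := by
      refine ge_of_tendsto hlimg ?_
      filter_upwards [eventually_ge_atTop t] with u hu using hmono ht (ht.trans hu) hu
    by_contra! hcon
    exact absurd h (not_le.2 (mul_pos (Real.exp_pos _) hcon))
  -- The inequality w' + lam w ≤ 0 says that e^(lam t) w is non-increasing.
  have hder' : ∀ t, T₀ ≤ t → HasDerivAt (fun t => Real.exp (lam * t) * w t)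
      (Real.exp (lam * t) * (lam * 1) * w t + Real.exp (lam * t) * w₁ t) t := fun t ht =>
    (((hasDerivAt_id t).const_mul lam).exp).mul (h1 t ht)
  have hanti : AntitoneOn (fun t => Real.exp (lam * t) * w t) (Ici T₀) := by
    refine antitoneOn_of_deriv_nonpos (convex_Ici T₀)
      (fun t ht => (hder' t ht).continuousAt.continuousWithinAt)
      (fun t ht => ?_) (fun t ht => ?_)
    · rw [interior_Ici] at ht
      exact (hder' t ht.le).differentiableAt.differentiableWithinAt
    · rw [interior_Ici] at ht
      rw [(hder' t ht.le).deriv]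
      have h3 : Real.exp (lam * t) * (lam * 1) * w t + Real.exp (lam * t) * w₁ t =
          Real.exp (lam * t) * (w₁ t + lam * w t) := by ring
      rw [h3]
      exact mul_nonpos_of_nonneg_of_nonpos (Real.exp_pos _).le (hneg t ht.le)
  have h := hanti (mem_Ici.2 le_rfl) ht ht
  have h4 : w t = Real.exp (lam * t) * w t * Real.exp (-lam * t) := by
    rw [mul_right_comm, ← Real.exp_add]; simp
  rw [h4]
  exact mul_le_mul_of_nonneg_right h (Real.exp_pos _).le

end Decay

/-! ### Calculus of functions with globally bounded derivatives -/

section BoundedDerivs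

variable {X Y Z : Type*} [NormedAddCommGroup X] [NormedSpace ℝ X] [NormedAddCommGroup Y]
  [NormedSpace ℝ Y] [NormedAddCommGroup Z] [NormedSpace ℝ Z]

/-- `f` is of class `C^m` with bounded derivatives of order at most `m` on the whole space. -/
def HasBoundedDerivs (m : ℕ∞) (f : X → Y) : Prop :=
  ContDiff ℝ (m : WithTop ℕ∞) f ∧
    ∀ j : ℕ, (j : ℕ∞) ≤ m → ∃ C : ℝ, ∀ x, ‖iteratedFDeriv ℝ j f x‖ ≤ C

theorem HasBoundedDerivs.exists_bound {m : ℕ} {f : X → Y} (hf : HasBoundedDerivs m f) :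
    ∃ C : ℝ, 1 ≤ C ∧ ∀ j ≤ m, ∀ x, ‖iteratedFDeriv ℝ j f x‖ ≤ C := by
  have h : ∀ j : ℕ, ∃ C : ℝ, 0 ≤ C ∧ (j ≤ m → ∀ x, ‖iteratedFDeriv ℝ j f x‖ ≤ C) := fun j => by
    by_cases hj : j ≤ m
    · obtain ⟨C, hC⟩ := hf.2 j (by exact_mod_cast hj)
      exact ⟨|C|, abs_nonneg C, fun _ x => (hC x).trans (le_abs_self C)⟩
    · exact ⟨0, le_rfl, fun h => absurd h hj⟩
  choose C hC0 hC using h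
  refine ⟨1 + ∑ j ∈ Finset.range (m + 1), C j,
    le_add_of_nonneg_right (Finset.sum_nonneg fun j _ => hC0 j), fun j hj x => ?_⟩
  refine (hC j hj x).trans ?_
  have := Finset.single_le_sum (f := C) (fun j _ => hC0 j)
    (Finset.mem_range.2 (Nat.lt_succ_of_le hj))
  linarith

theorem HasBoundedDerivs.of_le {m m' : ℕ∞} {f : X → Y} (hf : HasBoundedDerivs m f) (h : m' ≤ m) :
    HasBoundedDerivs m' f :=
  ⟨hf.1.of_le (by exact_mod_cast h), fun j hj => hf.2 j (hj.trans h)⟩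

theorem HasBoundedDerivs.comp {m : ℕ∞} {g : Y → Z} {f : X → Y} (hg : HasBoundedDerivs m g)
    (hf : HasBoundedDerivs m f) : HasBoundedDerivs m (fun x => g (f x)) := by
  refine ⟨hg.1.comp hf.1, fun j hj => ?_⟩
  obtain ⟨C, -, hC⟩ := (hg.of_le hj).exists_bound
  obtain ⟨D, hD1, hD⟩ := (hf.of_le hj).exists_bound
  refine ⟨j.factorial * C * D ^ j, fun x => ?_⟩
  refine norm_iteratedFDeriv_comp_le (hg.of_le hj).1 (hf.of_le hj).1 le_rfl x
    (fun i hi => hC i hi _) fun i h1 hi => (hD i hi x).trans (le_self_pow₀ hD1 (by omega))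

theorem HasBoundedDerivs.comp_clm {m : ℕ∞} {g : Y → Z} (hg : HasBoundedDerivs m g)
    (L : X →L[ℝ] Y) : HasBoundedDerivs m (fun x => g (L x)) := by
  refine ⟨hg.1.comp L.contDiff, fun j hj => ?_⟩
  obtain ⟨C, -, hC⟩ := (hg.of_le hj).exists_bound
  refine ⟨j.factorial * C * ‖L‖ ^ j, fun x => ?_⟩
  refine norm_iteratedFDeriv_comp_le (hg.of_le hj).1 L.contDiff le_rfl x
    (fun i hi => hC i hi _) fun i h1 hi => ?_
  simpa using norm_iteratedFDeriv_affine_le L 0 le_rfl i h1 x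

theorem HasBoundedDerivs.clm_comp {m : ℕ∞} {f : X → Y} (hf : HasBoundedDerivs m f)
    (L : Y →L[ℝ] Z) : HasBoundedDerivs m (fun x => L (f x)) := by
  refine ⟨L.contDiff.comp hf.1, fun j hj => ?_⟩
  obtain ⟨C, -, hC⟩ := (hf.of_le hj).exists_bound
  refine ⟨‖L‖ * C, fun x => ?_⟩
  have := L.norm_iteratedFDeriv_comp_left (f := f) (x := x) (n := j)
    (hf.of_le hj).1.contDiffAt le_rfl
  exact this.trans (mul_le_mul_of_nonneg_left (hC j le_rfl x) (norm_nonneg _))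

theorem HasBoundedDerivs.add {m : ℕ∞} {f g : X → Y} (hf : HasBoundedDerivs m f)
    (hg : HasBoundedDerivs m g) : HasBoundedDerivs m (fun x => f x + g x) := by
  refine ⟨hf.1.add hg.1, fun j hj => ?_⟩
  obtain ⟨C, hC⟩ := hf.2 j hj
  obtain ⟨D, hD⟩ := hg.2 j hj
  refine ⟨C + D, fun x => ?_⟩
  have h := iteratedFDeriv_add_apply (x := x) (hf.of_le hj).1.contDiffAt
    (hg.of_le hj).1.contDiffAt
  change ‖iteratedFDeriv ℝ j (f + g) x‖ ≤ _
  rw [h]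
  exact (norm_add_le _ _).trans (add_le_add (hC x) (hD x))

theorem hasBoundedDerivs_const {m : ℕ∞} (c : Y) : HasBoundedDerivs m (fun _ : X => c) := by
  refine ⟨contDiff_const, fun j _ => ⟨‖c‖, fun x => ?_⟩⟩
  rcases j with _ | j
  · simp
  · rw [iteratedFDeriv_const_of_ne (by omega)]; simp

theorem hasBoundedDerivs_sum {ι : Type*} {m : ℕ∞} {f : ι → X → Y} (S : Finset ι)
    (hf : ∀ i ∈ S, HasBoundedDerivs m (f i)) : HasBoundedDerivs m (fun x => ∑ i ∈ S, f i x) := by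
  classical
  induction S using Finset.induction_on with
  | empty => simpa using hasBoundedDerivs_const (0 : Y)
  | insert a S ha ih =>
    simp only [Finset.sum_insert ha]
    exact (hf a (Finset.mem_insert_self _ _)).add
      (ih fun i hi => hf i (Finset.mem_insert_of_mem hi))

theorem HasBoundedDerivs.mul {m : ℕ∞} {f g : X → ℝ} (hf : HasBoundedDerivs m f)
    (hg : HasBoundedDerivs m g) : HasBoundedDerivs m (fun x => f x * g x) := by
  refine ⟨hf.1.mul hg.1, fun j hj => ?_⟩
  obtain ⟨C, hC1, hC⟩ := (hf.of_le hj).exists_bound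
  obtain ⟨D, hD1, hD⟩ := (hg.of_le hj).exists_bound
  refine ⟨∑ i ∈ Finset.range (j + 1), (j.choose i : ℝ) * C * D, fun x => ?_⟩
  refine (norm_iteratedFDeriv_mul_le (hf.of_le hj).1 (hg.of_le hj).1 x le_rfl).trans
    (Finset.sum_le_sum fun i hi => ?_)
  have hi' : i ≤ j := Nat.lt_succ_iff.1 (Finset.mem_range.1 hi)
  have h1 := hC i hi' x
  have h2 := hD (j - i) (Nat.sub_le _ _) x
  gcongr

/-- The induction step for bootstrapping the regularity of solutions of the pendulum equation. -/
theorem HasBoundedDerivs.of_deriv {m : ℕ} {f : ℝ → ℝ} (hd : Differentiable ℝ f) {C : ℝ}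
    (hC : ∀ x, |f x| ≤ C) (hf : HasBoundedDerivs m (deriv f)) :
    HasBoundedDerivs (m + 1 : ℕ) f := by
  constructor
  · have := (contDiff_succ_iff_deriv (n := (m : WithTop ℕ∞)) (f := f)).2
      ⟨hd, by simp, by exact_mod_cast hf.1⟩
    exact_mod_cast this
  · intro j hj
    rcases j with _ | j
    · exact ⟨C, fun x => by simpa using hC x⟩
    · obtain ⟨D, hD⟩ := hf.2 j (by
        have : j + 1 ≤ m + 1 := by exact_mod_cast hj
        exact_mod_cast (by omega : j ≤ m))
      refine ⟨D, fun x => ?_⟩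
      have h := hD x
      rw [norm_iteratedFDeriv_eq_norm_iteratedDeriv] at h ⊢
      rwa [iteratedDeriv_succ']

theorem exists_bound_of_periodic {Y : Type*} [NormedAddCommGroup Y] {f : ℝ → Y}
    (hf : Continuous f) (hp : Function.Periodic f 1) :
    ∃ C, ∀ x, ‖f x‖ ≤ C := by
  obtain ⟨C, hC⟩ := isCompact_Icc.exists_bound_of_continuousOn (s := Icc (0 : ℝ) 1) hf.continuousOn
  refine ⟨C, fun x => ?_⟩
  obtain ⟨y, hy, hxy⟩ := hp.exists_mem_Ico₀ one_pos x
  rw [hxy]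
  exact hC y (Ico_subset_Icc_self hy)

theorem hasBoundedDerivs_of_periodic {m : ℕ∞} {f : ℝ → Y} (hf : ContDiff ℝ m f)
    (hp : Function.Periodic f 1) : HasBoundedDerivs m f := by
  refine ⟨hf, fun j hj => ?_⟩
  refine exists_bound_of_periodic (hf.continuous_iteratedFDeriv (by exact_mod_cast hj)) fun x => ?_
  rw [← iteratedFDeriv_comp_add_right]
  congr 1
  ext1 x
  exact hp x

theorem hasBoundedDerivs_of_hasCompactSupport {m : ℕ∞} {f : X → Y} (hf : ContDiff ℝ m f)
    (hs : HasCompactSupport f) : HasBoundedDerivs m f :=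
  ⟨hf, fun j hj => (hs.iteratedFDeriv j).exists_bound_of_continuous
    (hf.continuous_iteratedFDeriv (by exact_mod_cast hj))⟩

end BoundedDerivs

end GlobalMelnikov
end

noncomputable section

namespace GlobalMelnikov

open Filter Topology MeasureTheory Metric Set

/-! ### One pendulum: decay, regularity and injectivity of the homoclinic orbit -/

section Homoclinic

variable {s : ℝ} {V p q : ℝ → ℝ}

theorem deriv_periodic {f : ℝ → ℝ} (hf : Function.Periodic f 1) :
    Function.Periodic (deriv f) 1 := fun x => by
  rw [← deriv_comp_add_const]
  congr 1
  ext1 y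
  exact hf y

theorem apply_intCast_of_periodic {f : ℝ → ℝ} (hf : Function.Periodic f 1) (a : ℤ) :
    f a = f 0 := by
  simpa using hf.int_mul_eq a

/-- The standing assumptions on the potential and the homoclinic orbit of one pendulum. -/
structure IsPendulumLoop (s : ℝ) (V p q : ℝ → ℝ) : Prop where
  sign : s = 1 ∨ s = -1
  contDiff : ContDiff ℝ 3 V
  periodic : Function.Periodic V 1
  deriv_zero : deriv V 0 = 0
  deriv_deriv_neg : deriv (deriv V) 0 < 0
  homoclinic : IsHomoclinic s V p q

/-- The reversibility (p, q, t) ↦ (-p, q, -t) reduces behaviour at -∞ to behaviour at +∞. -/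
theorem IsHomoclinic.reverse (h : IsHomoclinic s V p q) :
    IsHomoclinic s V (fun t => -p (-t)) (fun t => q (-t)) where
  hasDerivAt_p t := by
    have := (((h.hasDerivAt_p (-t)).comp t (hasDerivAt_neg t)).neg)
    convert! this using 1
    ring
  hasDerivAt_q t := by
    have := ((h.hasDerivAt_q (-t)).comp t (hasDerivAt_neg t))
    convert! this using 1
    ring
  p_atBot := by simpa using (h.p_atTop.comp tendsto_neg_atBot_atTop).neg
  p_atTop := by simpa using (h.p_atBot.comp tendsto_neg_atTop_atBot).neg
  q_atBot := h.q_atTop.imp fun _ hb => hb.comp tendsto_neg_atBot_atTop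
  q_atTop := h.q_atBot.imp fun _ hb => hb.comp tendsto_neg_atTop_atBot
  nontrivial := by
    obtain ⟨t, ht⟩ := h.nontrivial
    exact ⟨-t, by simpa using ht⟩

namespace IsPendulumLoop

theorem reverse (h : IsPendulumLoop s V p q) :
    IsPendulumLoop s V (fun t => -p (-t)) (fun t => q (-t)) :=
  { h with homoclinic := h.homoclinic.reverse }

theorem sign_sq (h : IsPendulumLoop s V p q) : s * s = 1 := by
  rcases h.sign with rfl | rfl <;> norm_num

theorem abs_sign (h : IsPendulumLoop s V p q) : |s| = 1 := by
  rcases h.sign with rfl | rfl <;> norm_num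

theorem contDiff_deriv (h : IsPendulumLoop s V p q) : ContDiff ℝ 2 (deriv V) :=
  ((contDiff_succ_iff_deriv (n := 2)).1 h.contDiff).2.2

theorem contDiff_deriv_deriv (h : IsPendulumLoop s V p q) : ContDiff ℝ 1 (deriv (deriv V)) :=
  ((contDiff_succ_iff_deriv (n := 1)).1 h.contDiff_deriv).2.2

theorem continuous_p (h : IsPendulumLoop s V p q) : Continuous p :=
  continuous_iff_continuousAt.2 fun t => (h.homoclinic.hasDerivAt_p t).continuousAt

theorem continuous_q (h : IsPendulumLoop s V p q) : Continuous q :=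
  continuous_iff_continuousAt.2 fun t => (h.homoclinic.hasDerivAt_q t).continuousAt

theorem hasDerivAt_force (h : IsPendulumLoop s V p q) (t : ℝ) :
    HasDerivAt (fun t => -(s * deriv V (q t))) (-(deriv (deriv V) (q t) * p t)) t := by
  have h1 : HasDerivAt (deriv V) (deriv (deriv V) (q t)) (q t) :=
    (h.contDiff_deriv.differentiable (by norm_num) _).hasDerivAt
  have h2 := ((h1.comp t (h.homoclinic.hasDerivAt_q t)).const_mul s).neg
  convert! h2 using 1
  linear_combination (-(deriv (deriv V) (q t) * p t)) * (-h.sign_sq)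

/-- Since p'' = -V''(q) p and V''(q) is eventually negative, w = p² satisfies w'' ≥ lam² w and so
decays exponentially. The force has derivative -V''(q) p and limit 0, so it inherits the rate. -/
theorem exists_decay_atTop (h : IsPendulumLoop s V p q) :
    ∃ C μ T : ℝ, 0 ≤ C ∧ 0 < μ ∧ ∀ t, T ≤ t →
      |p t| ≤ C * Real.exp (-μ * t) ∧ |s * deriv V (q t)| ≤ C * Real.exp (-μ * t) := by
  obtain ⟨b, hb⟩ := h.homoclinic.q_atTop
  have hV' : Tendsto (fun t => -(s * deriv V (q t))) atTop (𝓝 0) := by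
    have := ((((h.contDiff_deriv.continuous.tendsto _).comp hb)).const_mul s).neg
    rwa [apply_intCast_of_periodic (deriv_periodic h.periodic), h.deriv_zero, mul_zero,
      neg_zero] at this
  have hV'' : Tendsto (fun t => deriv (deriv V) (q t)) atTop (𝓝 (deriv (deriv V) 0)) := by
    have := ((h.contDiff_deriv_deriv.continuous.tendsto _).comp hb)
    rwa [apply_intCast_of_periodic (deriv_periodic (deriv_periodic h.periodic))] at this
  -- Half of |V''(0)|, so that V''(q t) < -κ for all large t.
  set κ : ℝ := -deriv (deriv V) 0 / 2 with hκ
  have hκ0 : 0 < κ := by have := h.deriv_deriv_neg; rw [hκ]; linarith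
  obtain ⟨T, hT⟩ := eventually_atTop.1 (hV''.eventually
    (gt_mem_nhds (show deriv (deriv V) 0 < -κ by rw [hκ]; linarith [h.deriv_deriv_neg])))
  -- From (p²)'' = 2 p'² - 2 V''(q) p² ≥ 2κ p². The square root taken afterwards halves the rate for
  -- |p|.
  set lam : ℝ := Real.sqrt (2 * κ) with hlam
  have hlam0 : 0 < lam := Real.sqrt_pos.2 (by linarith)
  have hlam2 : lam ^ 2 = 2 * κ := Real.sq_sqrt (by linarith)
  have hp := h.homoclinic.p_atTop
  have hdecay := fun t ht => le_exp_of_second_deriv_ge (w := fun t => p t ^ 2)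
    (w₁ := fun t => 2 * (p t * -(s * deriv V (q t))))
    (w₂ := fun t => 2 * (-(s * deriv V (q t)) * -(s * deriv V (q t)) +
      p t * -(deriv (deriv V) (q t) * p t))) (lam := lam) (T₀ := T) hlam0
    (fun t _ => by
      have := (h.homoclinic.hasDerivAt_p t).pow 2
      convert! this using 1
      push_cast
      ring)
    (fun t _ => ((h.homoclinic.hasDerivAt_p t).mul (h.hasDerivAt_force t)).const_mul 2)
    (fun t ht => by
      rw [hlam2]
      nlinarith [hT t ht, sq_nonneg (p t), sq_nonneg (s * deriv V (q t))])
    (by simpa using hp.pow 2) (by simpa using (hp.mul hV').const_mul 2) (t := t) ht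
  set K : ℝ := Real.sqrt (Real.exp (lam * T) * p T ^ 2) with hK
  have hpb : ∀ t, T ≤ t → |p t| ≤ K * Real.exp (-(lam / 2) * t) := fun t ht => by
    refine abs_le_of_sq_le_sq ?_ (by positivity)
    rw [mul_pow, hK, Real.sq_sqrt (by positivity), ← Real.exp_nat_mul]
    convert! hdecay t ht using 3
    push_cast
    ring
  obtain ⟨B, hB⟩ := exists_bound_of_periodic h.contDiff_deriv_deriv.continuous
    (deriv_periodic (deriv_periodic h.periodic))
  have hB0 : 0 ≤ B := (norm_nonneg _).trans (hB 0)
  have hfb : ∀ t, T ≤ t → |-(s * deriv V (q t)) - 0| ≤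
      B * K / (lam / 2) * Real.exp (-(lam / 2) * t) := fun t ht => by
    refine abs_sub_le_of_deriv_exp (T₀ := T) (half_pos hlam0) (fun t _ => h.hasDerivAt_force t)
      (fun t ht => ?_) hV' ht
    rw [abs_neg, abs_mul, mul_assoc]
    exact mul_le_mul (hB _) (hpb t ht) (abs_nonneg _) hB0
  refine ⟨max K (B * K / (lam / 2)), lam / 2, T, le_max_of_le_left (Real.sqrt_nonneg _),
    half_pos hlam0, fun t ht => ⟨?_, ?_⟩⟩
  · exact (hpb t ht).trans (mul_le_mul_of_nonneg_right (le_max_left _ _) (Real.exp_pos _).le)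
  · have := hfb t ht
    rw [sub_zero, abs_neg] at this
    exact this.trans (mul_le_mul_of_nonneg_right (le_max_right _ _) (Real.exp_pos _).le)

/-- The velocity of a homoclinic orbit decays exponentially in both time directions. -/
theorem exists_decay (h : IsPendulumLoop s V p q) :
    ∃ C μ : ℝ, 0 ≤ C ∧ 0 < μ ∧ ∀ t,
      |p t| ≤ C * Real.exp (-μ * |t|) ∧ |s * deriv V (q t)| ≤ C * Real.exp (-μ * |t|) := by
  obtain ⟨C₁, μ₁, T₁, hC₁, hμ₁, h₁⟩ := h.exists_decay_atTop
  obtain ⟨C₂, μ₂, T₂, hC₂, hμ₂, h₂⟩ := h.reverse.exists_decay_atTop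
  have hc1 := h.continuous_p
  have hc2 := h.continuous_q
  have hc3 := h.contDiff_deriv.continuous
  set T := max (max T₁ T₂) 0 with hT
  obtain ⟨B, hB⟩ := isCompact_Icc.exists_bound_of_continuousOn (s := Icc (-T) T)
    (f := fun t => |p t| + |s * deriv V (q t)|) (by fun_prop)
  set μ := min μ₁ μ₂ with hμ
  have hμ0 : 0 < μ := lt_min hμ₁ hμ₂
  have hT0 : 0 ≤ T := le_max_right _ _
  have hB0 : 0 ≤ B := (norm_nonneg _).trans (hB 0 ⟨by linarith, hT0⟩)
  have hmono : ∀ {C' μ' t : ℝ}, 0 ≤ C' → μ ≤ μ' → 0 ≤ t → C' ≤ C₁ + C₂ →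
      C' * Real.exp (-μ' * t) ≤ (C₁ + C₂ + B * Real.exp (μ * T)) * Real.exp (-μ * t) := by
    intro C' μ' t hC' hμ' ht hle
    have h1 : Real.exp (-μ' * t) ≤ Real.exp (-μ * t) := Real.exp_le_exp.2 (by nlinarith)
    have h2 : 0 ≤ B * Real.exp (μ * T) := by positivity
    exact mul_le_mul (by linarith) h1 (Real.exp_pos _).le (by linarith)
  -- The term B e^(μT) covers the compact range |t| ≤ T, where e^(μT) e^(-μ|t|) ≥ 1.
  refine ⟨C₁ + C₂ + B * Real.exp (μ * T), μ, by positivity, hμ0, fun t => ?_⟩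
  rcases le_total T t with ht | ht
  · have hT₁ : T₁ ≤ t := ((le_max_left _ _).trans (le_max_left _ _)).trans ht
    have ht0 : 0 ≤ t := hT0.trans ht
    have := hmono hC₁ (min_le_left _ _) ht0 (by linarith)
    rw [abs_of_nonneg ht0]
    exact ⟨(h₁ t hT₁).1.trans this, (h₁ t hT₁).2.trans this⟩
  · rcases le_total t (-T) with ht' | ht'
    · have hT₂ : T₂ ≤ -t := ((le_max_right _ _).trans (le_max_left _ _)).trans (by linarith)
      have ht0 : t ≤ 0 := by linarith
      have := hmono hC₂ (min_le_right _ _) (neg_nonneg.2 ht0) (by linarith)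
      rw [abs_of_nonpos ht0]
      have h3 := h₂ (-t) hT₂
      simp only [neg_neg, abs_neg] at h3
      exact ⟨h3.1.trans this, h3.2.trans this⟩
    · have h3 := hB t ⟨ht', ht⟩
      rw [Real.norm_eq_abs, abs_of_nonneg (by positivity)] at h3
      have h4 : B ≤ (C₁ + C₂ + B * Real.exp (μ * T)) * Real.exp (-μ * |t|) := by
        have h5 : 1 ≤ Real.exp (μ * T) * Real.exp (-μ * |t|) := by
          rw [← Real.exp_add]
          exact Real.one_le_exp (by
            have : |t| ≤ T := abs_le.2 ⟨ht', ht⟩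
            nlinarith)
        have h6 : 0 ≤ (C₁ + C₂) * Real.exp (-μ * |t|) := by positivity
        nlinarith
      constructor
      · linarith [abs_nonneg (s * deriv V (q t))]
      · linarith [abs_nonneg (p t)]

theorem exists_bound_of_tendsto {f : ℝ → ℝ} (hf : Continuous f) {a b : ℝ}
    (ha : Tendsto f atBot (𝓝 a)) (hb : Tendsto f atTop (𝓝 b)) : ∃ C, ∀ t, |f t| ≤ C := by
  obtain ⟨T₁, h₁⟩ := eventually_atBot.1 (ha.abs.eventually (gt_mem_nhds (lt_add_one |a|)))
  obtain ⟨T₂, h₂⟩ := eventually_atTop.1 (hb.abs.eventually (gt_mem_nhds (lt_add_one |b|)))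
  obtain ⟨B, hB⟩ := isCompact_Icc.exists_bound_of_continuousOn (s := Icc T₁ T₂) hf.continuousOn
  refine ⟨max B (max (|a| + 1) (|b| + 1)), fun t => ?_⟩
  rcases le_total t T₁ with h1 | h1
  · exact (h₁ t h1).le.trans ((le_max_left _ _).trans (le_max_right _ _))
  · rcases le_total T₂ t with h2 | h2
    · exact (h₂ t h2).le.trans ((le_max_right _ _).trans (le_max_right _ _))
    · exact (hB t ⟨h1, h2⟩).trans (le_max_left _ _)

/-- Bootstrap through p' = -s V'(q), q' = s p. The periodic function V' has bounded derivatives up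
to order two, which allows three for p and q. -/
theorem hasBoundedDerivs (h : IsPendulumLoop s V p q) :
    HasBoundedDerivs 3 p ∧ HasBoundedDerivs 3 q := by
  have hdp : deriv p = fun t => -(s * deriv V (q t)) :=
    funext fun t => (h.homoclinic.hasDerivAt_p t).deriv
  have hdq : deriv q = fun t => s * p t := funext fun t => (h.homoclinic.hasDerivAt_q t).deriv
  have hp : Differentiable ℝ p := fun t => (h.homoclinic.hasDerivAt_p t).differentiableAt
  have hq : Differentiable ℝ q := fun t => (h.homoclinic.hasDerivAt_q t).differentiableAt
  obtain ⟨B₁, hB₁⟩ := exists_bound_of_tendsto h.continuous_p h.homoclinic.p_atBot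
    h.homoclinic.p_atTop
  obtain ⟨a, ha⟩ := h.homoclinic.q_atBot
  obtain ⟨b, hb⟩ := h.homoclinic.q_atTop
  obtain ⟨B₂, hB₂⟩ := exists_bound_of_tendsto h.continuous_q ha hb
  have hV : HasBoundedDerivs 2 (deriv V) :=
    hasBoundedDerivs_of_periodic h.contDiff_deriv (deriv_periodic h.periodic)
  have key : ∀ m : ℕ, m ≤ 3 → HasBoundedDerivs m p ∧ HasBoundedDerivs m q := by
    intro m
    induction m with
    | zero =>
      intro _
      refine ⟨⟨?_, fun j hj => ⟨B₁, fun x => ?_⟩⟩, ⟨?_, fun j hj => ⟨B₂, fun x => ?_⟩⟩⟩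
      · exact contDiff_zero.2 h.continuous_p
      · obtain rfl : j = 0 := by simpa using hj
        simpa using hB₁ x
      · exact contDiff_zero.2 h.continuous_q
      · obtain rfl : j = 0 := by simpa using hj
        simpa using hB₂ x
    | succ m ih =>
      intro hm
      obtain ⟨ihp, ihq⟩ := ih (by omega)
      constructor
      · refine HasBoundedDerivs.of_deriv hp hB₁ ?_
        rw [hdp]
        have h1 := (hV.of_le (m' := m) (by exact_mod_cast (by omega : m ≤ 2))).comp ihq
        simpa using h1.clm_comp ((-s) • ContinuousLinearMap.id ℝ ℝ)
      · refine HasBoundedDerivs.of_deriv hq hB₂ ?_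
        rw [hdq]
        simpa using ihp.clm_comp (s • ContinuousLinearMap.id ℝ ℝ)
  exact_mod_cast key 3 le_rfl

/-- A homoclinic orbit visits each point of the cylinder at most once. -/
theorem injective (h : IsPendulumLoop s V p q) {t₁ t₂ : ℝ} (hp : p t₁ = p t₂) {m : ℤ}
    (hq : q t₁ = q t₂ + m) : t₁ = t₂ := by
  by_contra hne
  obtain ⟨B, hB1, hB⟩ := (hasBoundedDerivs_of_periodic (m := 1)
    (h.contDiff_deriv.of_le (by norm_num)) (deriv_periodic h.periodic)).exists_bound
  have hLip : LipschitzWith (Real.toNNReal B) (deriv V) :=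
    lipschitzWith_of_nnnorm_deriv_le (h.contDiff_deriv.differentiable (by norm_num)) fun x => by
      rw [← NNReal.coe_le_coe, Real.coe_toNNReal _ (by linarith), coe_nnnorm]
      have := hB 1 le_rfl x
      rwa [norm_iteratedFDeriv_eq_norm_iteratedDeriv, iteratedDeriv_one] at this
  let v : ℝ → ℝ × ℝ → ℝ × ℝ := fun _ z => (-(s * deriv V z.2), s * z.1)
  have hv : ∃ K, ∀ t, LipschitzOnWith K (v t) univ := by
    have h1 : LipschitzWith _ fun z : ℝ × ℝ => -(s * deriv V z.2) :=
      ((lipschitzWith_smul s).comp (hLip.comp LipschitzWith.prod_snd)).neg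
    have h2 : LipschitzWith _ fun z : ℝ × ℝ => s * z.1 :=
      (lipschitzWith_smul s).comp LipschitzWith.prod_fst
    exact ⟨_, fun _ => (h1.prodMk h2).lipschitzOnWith⟩
  obtain ⟨K, hK⟩ := hv
  set P := t₂ - t₁ with hP
  -- By uniqueness for the globally Lipschitz vector field, a return to the same point of the
  -- cylinder makes the orbit periodic up to the integer shift m in q.
  have hper : (fun t => (p t, q t)) = fun t => (p (t + P), q (t + P) + m) := by
    refine ODE_solution_unique_univ (v := v) (s := fun _ => univ) (K := K) (t₀ := t₁) hK
      (fun t => ⟨(h.homoclinic.hasDerivAt_p t).prodMk (h.homoclinic.hasDerivAt_q t), mem_univ _⟩)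
      (fun t => ⟨?_, mem_univ _⟩) ?_
    · have h1 := (h.homoclinic.hasDerivAt_p (t + P)).comp_add_const t P
      have h2 := ((h.homoclinic.hasDerivAt_q (t + P)).comp_add_const t P).add_const (m : ℝ)
      have h3 : deriv V (q (t + P) + m) = deriv V (q (t + P)) := by
        simpa using (deriv_periodic h.periodic).int_mul m (q (t + P))
      have := h1.prodMk h2
      simp only [v, h3]
      exact this
    · simp [hP, hp, hq]
  have hpp : Function.Periodic p P := fun t => (Prod.ext_iff.1 (congrFun hper t)).1.symm
  have hP0 : P ≠ 0 := fun h0 => hne (by linarith)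
  -- A periodic function with a limit is constant, so p vanishes; then q is constant as well and
  -- equals its integer limit, which contradicts non-triviality.
  have hp0 : ∀ t, p t = 0 := fun t => by
    have hseq : ∀ k : ℕ, p (t + k * P) = p t := fun k => hpp.nat_mul k t
    have hlim : Tendsto (fun k : ℕ => p (t + k * P)) atTop (𝓝 0) := by
      rcases lt_or_gt_of_ne hP0 with hneg | hpos
      · exact h.homoclinic.p_atBot.comp (tendsto_atBot_add_const_left _ _
          (tendsto_natCast_atTop_atTop.atTop_mul_const_of_neg hneg))
      · exact h.homoclinic.p_atTop.comp (tendsto_atTop_add_const_left _ _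
          (tendsto_natCast_atTop_atTop.atTop_mul_const hpos))
    simp only [hseq] at hlim
    exact tendsto_nhds_unique tendsto_const_nhds hlim
  have hq0 : ∀ t t', q t = q t' := is_const_of_deriv_eq_zero
    (fun t => (h.homoclinic.hasDerivAt_q t).differentiableAt)
    fun t => by rw [(h.homoclinic.hasDerivAt_q t).deriv, hp0, mul_zero]
  obtain ⟨t, ht⟩ := h.homoclinic.nontrivial
  obtain ⟨b, hb⟩ := h.homoclinic.q_atTop
  refine ht ⟨hp0 t, b, ?_⟩
  have : q = fun _ => q t := funext fun t' => hq0 t' t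
  rw [this] at hb
  exact tendsto_nhds_unique tendsto_const_nhds hb

end IsPendulumLoop

end Homoclinic

end GlobalMelnikov
end

noncomputable section

namespace GlobalMelnikov

open Filter Topology MeasureTheory Metric Set

/-! ### The Melnikov integrand as a function of the parameters -/

section Loop

variable {n d : ℕ}

/-- The variables `(τ, I, φ, t)` of the Melnikov potential. -/
abbrev LoopSpace (n d : ℕ) : Type := E n × E d × E d × ℝ

/-- The inclusion `(τ, I, φ, t) ↦ (0, 0, I, φ, t, 0)`. -/
def basePoint (n d : ℕ) : LoopSpace n d →L[ℝ] Phase n d :=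
  (0 : LoopSpace n d →L[ℝ] E n).prod ((0 : LoopSpace n d →L[ℝ] E n).prod
    (((ContinuousLinearMap.fst ℝ _ _).comp (ContinuousLinearMap.snd ℝ _ _)).prod
    (((ContinuousLinearMap.fst ℝ _ _).comp
      ((ContinuousLinearMap.snd ℝ _ _).comp (ContinuousLinearMap.snd ℝ _ _))).prod
    (((ContinuousLinearMap.snd ℝ _ _).comp
      ((ContinuousLinearMap.snd ℝ _ _).comp (ContinuousLinearMap.snd ℝ _ _))).prod
    (0 : LoopSpace n d →L[ℝ] ℝ)))))

theorem basePoint_apply (y : LoopSpace n d) :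
    basePoint n d y = (0, 0, y.2.1, y.2.2.1, y.2.2.2, 0) := rfl

/-- The unit vector of the variable `p i`. -/
def pVec (n d : ℕ) (i : Fin n) : Phase n d := (EuclideanSpace.single i 1, 0, 0, 0, 0, 0)

/-- The unit vector of the variable `q i`. -/
def qVec (n d : ℕ) (i : Fin n) : Phase n d := (0, EuclideanSpace.single i 1, 0, 0, 0, 0)

theorem norm_pVec (i : Fin n) : ‖pVec n d i‖ = 1 := by simp [pVec, Prod.norm_def]

theorem norm_qVec (i : Fin n) : ‖qVec n d i‖ = 1 := by simp [qVec, Prod.norm_def]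

/-- The point over `(τ, I, φ, t)` whose pendula with indices in `S` are on the loops, and the others
at the equilibrium. -/
def partialLoopPoint (p₀ q₀ : Fin n → ℝ → ℝ) (S : Finset (Fin n)) (y : LoopSpace n d) :
    Phase n d :=
  basePoint n d y + ∑ i ∈ S, (p₀ i (y.1 i) • pVec n d i + q₀ i (y.1 i) • qVec n d i)

/-- The point of the product of the loops over `(τ, I, φ, t)`. -/
def loopPoint (p₀ q₀ : Fin n → ℝ → ℝ) (y : LoopSpace n d) : Phase n d :=
  partialLoopPoint p₀ q₀ Finset.univ y

theorem sum_smul_single (S : Finset (Fin n)) (x : Fin n → ℝ) :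
    ∑ i ∈ S, x i • (EuclideanSpace.single i 1 : E n) =
      WithLp.toLp 2 fun i => if i ∈ S then x i else 0 := by
  ext j
  simp [Pi.single_apply]

theorem partialLoopPoint_eq (p₀ q₀ : Fin n → ℝ → ℝ) (S : Finset (Fin n)) (y : LoopSpace n d) :
    partialLoopPoint p₀ q₀ S y =
      (WithLp.toLp 2 fun i => if i ∈ S then p₀ i (y.1 i) else 0,
        WithLp.toLp 2 fun i => if i ∈ S then q₀ i (y.1 i) else 0, y.2.1, y.2.2.1, y.2.2.2, 0) := by
  have h1 := sum_smul_single S fun i => p₀ i (y.1 i)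
  have h2 := sum_smul_single S fun i => q₀ i (y.1 i)
  rw [← h1, ← h2, partialLoopPoint, basePoint_apply]
  ext : 1
  · simp [Prod.fst_sum, pVec, qVec]
  ext : 1
  · simp [Prod.fst_sum, Prod.snd_sum, pVec, qVec]
  · simp [Prod.snd_sum, pVec, qVec]

theorem loopPoint_eq (p₀ q₀ : Fin n → ℝ → ℝ) (y : LoopSpace n d) :
    loopPoint p₀ q₀ y =
      (shifted p₀ y.1 0, shifted q₀ y.1 0, y.2.1, y.2.2.1, y.2.2.2, 0) := by
  simp [loopPoint, partialLoopPoint_eq, shifted]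

/-- The parameters `(τ, I, φ, t)` with `I` in `O₂`. -/
def loopDomain (n : ℕ) {d : ℕ} (O₂ : Set (E d)) : Set (LoopSpace n d) := {y | y.2.1 ∈ O₂}

theorem isOpen_loopDomain {O₂ : Set (E d)} (hO₂ : IsOpen O₂) : IsOpen (loopDomain n O₂) :=
  hO₂.preimage (by fun_prop)

theorem isOpen_domain {O₁ : Set (E n × E n)} {O₂ : Set (E d)} (hO₁ : IsOpen O₁) (hO₂ : IsOpen O₂)
    (ε₁ : ℝ) : IsOpen (domain O₁ O₂ ε₁) :=
  (hO₁.preimage (f := fun x : Phase n d => (x.1, x.2.1)) (by fun_prop)).inter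
    ((hO₂.preimage (f := fun x : Phase n d => x.2.2.1) (by fun_prop)).inter
    (isOpen_lt (f := fun x : Phase n d => |x.2.2.2.2.2|) (by fun_prop) continuous_const))

/-- The separatrices include the equilibria, so all mixed configurations lie in the domain. This
permits moving the pendula one at a time. -/
theorem partialLoopPoint_mem {p₀ q₀ : Fin n → ℝ → ℝ} {O₁ : Set (E n × E n)} {O₂ : Set (E d)}
    {ε₁ : ℝ} (hO₁ : IsSeparatrixNhd p₀ q₀ O₁) (hε₁ : 0 < ε₁) (S : Finset (Fin n))
    {y : LoopSpace n d} (hy : y ∈ loopDomain n O₂) :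
    partialLoopPoint p₀ q₀ S y ∈ domain O₁ O₂ ε₁ := by
  rw [partialLoopPoint_eq]
  refine ⟨hO₁.2.2 _ _ fun i => ?_, hy, by simpa using hε₁⟩
  by_cases hi : i ∈ S
  · exact Or.inr ⟨y.1 i, by simp [hi], by simp [hi]⟩
  · exact Or.inl ⟨by simp [hi], by simp [hi]⟩

theorem loopPoint_mem {p₀ q₀ : Fin n → ℝ → ℝ} {O₁ : Set (E n × E n)} {O₂ : Set (E d)}
    {ε₁ : ℝ} (hO₁ : IsSeparatrixNhd p₀ q₀ O₁) (hε₁ : 0 < ε₁)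
    {y : LoopSpace n d} (hy : y ∈ loopDomain n O₂) : loopPoint p₀ q₀ y ∈ domain O₁ O₂ ε₁ :=
  partialLoopPoint_mem hO₁ hε₁ _ hy

theorem basePoint_mem {p₀ q₀ : Fin n → ℝ → ℝ} {O₁ : Set (E n × E n)} {O₂ : Set (E d)}
    {ε₁ : ℝ} (hO₁ : IsSeparatrixNhd p₀ q₀ O₁) (hε₁ : 0 < ε₁)
    {y : LoopSpace n d} (hy : y ∈ loopDomain n O₂) : basePoint n d y ∈ domain O₁ O₂ ε₁ := by
  simpa [partialLoopPoint] using partialLoopPoint_mem hO₁ hε₁ ∅ hy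

/-- All derivatives of `h` of order at most `3` are bounded by `A` on `Ω`. -/
def IsC3Bound (A : ℝ) (Ω : Set (Phase n d)) (h : Phase n d → ℝ) : Prop :=
  ∀ j ≤ 3, ∀ x ∈ Ω, ‖iteratedFDeriv ℝ j h x‖ ≤ A

theorem IsPerturbation.exists_isC3Bound {Ω : Set (Phase n d)} {h : Phase n d → ℝ}
    (hh : IsPerturbation 3 Ω h) : ∃ A, 0 ≤ A ∧ IsC3Bound A Ω h := by
  have h1 : ∀ j : ℕ, ∃ C : ℝ, 0 ≤ C ∧ (j ≤ 3 → ∀ x ∈ Ω, ‖iteratedFDeriv ℝ j h x‖ ≤ C) := fun j => by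
    by_cases hj : j ≤ 3
    · obtain ⟨C, hC⟩ := hh.1.2 j (by exact_mod_cast hj)
      exact ⟨|C|, abs_nonneg C, fun _ x hx => (hC x hx).trans (le_abs_self C)⟩
    · exact ⟨0, le_rfl, fun h => absurd h hj⟩
  choose C hC0 hC using h1
  refine ⟨∑ j ∈ Finset.range 4, C j, Finset.sum_nonneg fun j _ => hC0 j, fun j hj x hx => ?_⟩
  exact (hC j hj x hx).trans (Finset.single_le_sum (f := C) (fun j _ => hC0 j)
    (Finset.mem_range.2 (by omega)))

/-- The integrand of the Melnikov potential at `σ = 0`. -/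
def loopDiff (p₀ q₀ : Fin n → ℝ → ℝ) (h : Phase n d → ℝ) (y : LoopSpace n d) : ℝ :=
  h (loopPoint p₀ q₀ y) - h (basePoint n d y)

variable {s : Fin n → ℝ} {V p₀ q₀ : Fin n → ℝ → ℝ} {O₁ : Set (E n × E n)} {O₂ : Set (E d)} {ε₁ : ℝ}

/-- The loop point is a linear map plus a function with bounded derivatives. Both bounds are brought
to the form D ^ j, with a common D, for the composition estimate. -/
theorem exists_bound_loopPoint (hl : ∀ i, IsPendulumLoop (s i) (V i) (p₀ i) (q₀ i)) :
    ContDiff ℝ 3 (loopPoint (d := d) p₀ q₀) ∧ ∃ D : ℝ, 1 ≤ D ∧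
      (∀ j, 1 ≤ j → j ≤ 3 → ∀ y, ‖iteratedFDeriv ℝ j (loopPoint (d := d) p₀ q₀) y‖ ≤ D ^ j) ∧
      ∀ j, 1 ≤ j → ∀ y, ‖iteratedFDeriv ℝ j (fun y => basePoint n d y) y‖ ≤ D ^ j := by
  have hB : HasBoundedDerivs 3 fun y : LoopSpace n d =>
      ∑ i, (p₀ i (y.1 i) • pVec n d i + q₀ i (y.1 i) • qVec n d i) := by
    refine hasBoundedDerivs_sum _ fun i _ => ?_
    let L : LoopSpace n d →L[ℝ] ℝ :=
      (EuclideanSpace.proj i : E n →L[ℝ] ℝ).comp (ContinuousLinearMap.fst ℝ _ _)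
    have h1 := ((hl i).hasBoundedDerivs.1.comp_clm L).clm_comp
      (ContinuousLinearMap.toSpanSingleton ℝ (pVec n d i))
    have h2 := ((hl i).hasBoundedDerivs.2.comp_clm L).clm_comp
      (ContinuousLinearMap.toSpanSingleton ℝ (qVec n d i))
    exact h1.add h2
  obtain ⟨C, hC1, hC⟩ := HasBoundedDerivs.exists_bound (m := 3) hB
  have hbase : ∀ j, 1 ≤ j → ∀ y, ‖iteratedFDeriv ℝ j (fun y => basePoint n d y) y‖ ≤
      ‖basePoint n d‖ ^ j := fun j hj y => by
    simpa using norm_iteratedFDeriv_affine_le (basePoint n d) 0 le_rfl j hj y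
  have hD0 : ‖basePoint n d‖ ≤ ‖basePoint n d‖ + C := by linarith
  refine ⟨(basePoint n d).contDiff.add hB.1, ‖basePoint n d‖ + C,
    by linarith [norm_nonneg (basePoint n d)], fun j hj hj3 y => ?_, fun j hj y =>
    (hbase j hj y).trans (pow_le_pow_left₀ (norm_nonneg _) hD0 j)⟩
  have h3 : (j : WithTop ℕ∞) ≤ 3 := by exact_mod_cast hj3
  have hadd := iteratedFDeriv_add_apply (x := y) (f := fun y => basePoint n d y)
    ((basePoint n d).contDiff (n := j)).contDiffAt (hB.1.of_le h3).contDiffAt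
  change ‖iteratedFDeriv ℝ j ((fun y => basePoint n d y) + _) y‖ ≤ _
  rw [hadd]
  refine (norm_add_le _ _).trans ((add_le_add (hbase j hj y) (hC j hj3 y)).trans ?_)
  have h4 : C ≤ C ^ j := le_self_pow₀ hC1 (by omega)
  have h5 := pow_add_pow_le (norm_nonneg (basePoint n d)) (by linarith : 0 ≤ C)
    (by omega : j ≠ 0)
  linarith

theorem contDiffOn_loopDiff (hl : ∀ i, IsPendulumLoop (s i) (V i) (p₀ i) (q₀ i))
    (hO₁ : IsSeparatrixNhd p₀ q₀ O₁) (hε₁ : 0 < ε₁)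
    {h : Phase n d → ℝ} (hh : IsPerturbation 3 (domain O₁ O₂ ε₁) h) :
    ContDiffOn ℝ 3 (loopDiff p₀ q₀ h) (loopDomain n O₂) := by
  have h1 : ContDiffOn ℝ 3 h (domain O₁ O₂ ε₁) := hh.1.1
  exact (h1.comp (exists_bound_loopPoint hl).1.contDiffOn fun y hy => loopPoint_mem hO₁ hε₁ hy).sub
    (h1.comp (basePoint n d).contDiff.contDiffOn fun y hy => basePoint_mem hO₁ hε₁ hy)

/-- The constant does not depend on h: linearity of the bound in A is what later turns C³-smallness
of h into C²-smallness of the potential. -/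
theorem exists_bound_loopDiff (hl : ∀ i, IsPendulumLoop (s i) (V i) (p₀ i) (q₀ i))
    (hO₁ : IsSeparatrixNhd p₀ q₀ O₁) (hO₂ : IsOpen O₂) (hε₁ : 0 < ε₁) :
    ∃ D : ℝ, 0 ≤ D ∧ ∀ (h : Phase n d → ℝ) (A : ℝ), IsPerturbation 3 (domain O₁ O₂ ε₁) h →
      IsC3Bound A (domain O₁ O₂ ε₁) h → ∀ j ≤ 3, ∀ y ∈ loopDomain n O₂,
        ‖iteratedFDeriv ℝ j (loopDiff p₀ q₀ h) y‖ ≤ D * A := by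
  obtain ⟨hΨ, D, hD1, hD, hD'⟩ := exists_bound_loopPoint (d := d) hl
  refine ⟨12 * D ^ 3, by positivity, fun h A hh hA j hj y hy => ?_⟩
  have h1 : ContDiffOn ℝ 3 h (domain O₁ O₂ ε₁) := hh.1.1
  have hj3 : (j : WithTop ℕ∞) ≤ 3 := by exact_mod_cast hj
  have hW := isOpen_loopDomain (n := n) hO₂
  have hΩ := isOpen_domain hO₁.1 hO₂ ε₁
  have hA0 : 0 ≤ A := (norm_nonneg _).trans (hA 0 (by norm_num) _ (basePoint_mem hO₁ hε₁ hy))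
  have hb1 := norm_iteratedFDeriv_comp_le_of_isOpen hW hΩ (h1.of_le hj3)
    (hΨ.of_le hj3).contDiffOn (fun y hy => loopPoint_mem hO₁ hε₁ hy) hy (C := A) (D := D)
    (fun i hi => hA i (by omega) _ (loopPoint_mem hO₁ hε₁ hy))
    (fun i hi hij => hD i hi (by omega) y)
  have hb2 := norm_iteratedFDeriv_comp_le_of_isOpen hW hΩ (h1.of_le hj3)
    (f := fun y => basePoint n d y)
    (basePoint n d).contDiff.contDiffOn (fun y hy => basePoint_mem hO₁ hε₁ hy) hy (C := A) (D := D)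
    (fun i hi => hA i (by omega) _ (basePoint_mem hO₁ hε₁ hy))
    (fun i hi hij => hD' i hi y)
  have hc1 : ContDiffAt ℝ j (fun y => h (loopPoint p₀ q₀ y)) y :=
    ((h1.comp hΨ.contDiffOn fun y hy => loopPoint_mem hO₁ hε₁ hy).contDiffAt
      (hW.mem_nhds hy)).of_le hj3
  have hc2 : ContDiffAt ℝ j (fun y => h (basePoint n d y)) y :=
    ((h1.comp (basePoint n d).contDiff.contDiffOn fun y hy => basePoint_mem hO₁ hε₁ hy).contDiffAt
      (hW.mem_nhds hy)).of_le hj3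
  have hsub := iteratedFDeriv_sub_apply (x := y) hc1 hc2
  change ‖iteratedFDeriv ℝ j ((fun y => h (loopPoint p₀ q₀ y)) - fun y => h (basePoint n d y)) y‖ ≤ _
  rw [hsub]
  refine (norm_sub_le _ _).trans ((add_le_add hb1 hb2).trans ?_)
  have hf : (j.factorial : ℝ) ≤ 6 := by exact_mod_cast Nat.factorial_le hj
  have hp : D ^ j ≤ D ^ 3 := pow_le_pow_right₀ hD1 hj
  have : (j.factorial : ℝ) * A * D ^ j ≤ 6 * A * D ^ 3 := by gcongr
  linarith

end Loop

end GlobalMelnikov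
end

noncomputable section

namespace GlobalMelnikov

open Filter Topology MeasureTheory Metric Set

/-! ### Exponential decay of the integrand -/

section LoopDecay

variable {n d : ℕ} {s : Fin n → ℝ} {V p₀ q₀ : Fin n → ℝ → ℝ} {O₁ : Set (E n × E n)}
  {O₂ : Set (E d)} {ε₁ : ℝ}

theorem exists_uniform_decay (hl : ∀ i, IsPendulumLoop (s i) (V i) (p₀ i) (q₀ i)) :
    ∃ C μ : ℝ, 0 ≤ C ∧ 0 < μ ∧ ∀ i t,
      |p₀ i t| ≤ C * Real.exp (-μ * |t|) ∧
        |s i * deriv (V i) (q₀ i t)| ≤ C * Real.exp (-μ * |t|) := by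
  choose C μ hC hμ h using fun i => (hl i).exists_decay
  obtain ⟨ν, hν, hle⟩ : ∃ ν : ℝ, 0 < ν ∧ ∀ i, ν ≤ μ i := by
    rcases isEmpty_or_nonempty (Fin n) with hn | hn
    · exact ⟨1, one_pos, fun i => isEmptyElim i⟩
    · exact ⟨Finset.univ.inf' Finset.univ_nonempty μ, by simpa using hμ,
        fun i => Finset.inf'_le _ (Finset.mem_univ i)⟩
  refine ⟨∑ i, C i, ν, Finset.sum_nonneg fun i _ => hC i, hν, fun i t => ?_⟩
  have h1 : C i * Real.exp (-μ i * |t|) ≤ (∑ i, C i) * Real.exp (-ν * |t|) := by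
    have h2 : C i ≤ ∑ i, C i := Finset.single_le_sum (fun i _ => hC i) (Finset.mem_univ i)
    have h3 : Real.exp (-μ i * |t|) ≤ Real.exp (-ν * |t|) :=
      Real.exp_le_exp.2 (by nlinarith [hle i, abs_nonneg t])
    exact mul_le_mul h2 h3 (Real.exp_pos _).le ((hC i).trans h2)
  exact ⟨(h i t).1.trans h1, (h i t).2.trans h1⟩

/-- The effect of moving one pendulum from the equilibrium to its loop decays exponentially. -/
theorem abs_sub_partialLoopPoint_le (hl : ∀ i, IsPendulumLoop (s i) (V i) (p₀ i) (q₀ i))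
    (hO₁ : IsSeparatrixNhd p₀ q₀ O₁) (hO₂ : IsOpen O₂) (hε₁ : 0 < ε₁) {C μ : ℝ} (hμ : 0 < μ)
    (hdecay : ∀ i t, |p₀ i t| ≤ C * Real.exp (-μ * |t|) ∧
        |s i * deriv (V i) (q₀ i t)| ≤ C * Real.exp (-μ * |t|))
    {h : Phase n d → ℝ} {A : ℝ} (hh : IsPerturbation 3 (domain O₁ O₂ ε₁) h)
    (hA : IsC3Bound A (domain O₁ O₂ ε₁) h) {S : Finset (Fin n)} {j : Fin n} (hj : j ∉ S)
    {y : LoopSpace n d} (hy : y ∈ loopDomain n O₂) :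
    |h (partialLoopPoint p₀ q₀ (insert j S) y) - h (partialLoopPoint p₀ q₀ S y)| ≤
      A * (2 * C / μ) * Real.exp (-μ * |y.1 j|) := by
  have hΩ := isOpen_domain hO₁.1 hO₂ ε₁
  have hC3 : ContDiffOn ℝ 3 h (domain O₁ O₂ ε₁) := hh.1.1
  have hA0 : 0 ≤ A := (norm_nonneg _).trans (hA 0 (by norm_num) _ (basePoint_mem hO₁ hε₁ hy))
  -- Only the j-th pendulum moves, along its whole loop; the others stay where S puts them.
  set γ : ℝ → Phase n d := fun t =>
    partialLoopPoint p₀ q₀ S y + (p₀ j t • pVec n d j + q₀ j t • qVec n d j) with hγ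
  have hγmem : ∀ t, γ t ∈ domain O₁ O₂ ε₁ := fun t => by
    set y' : LoopSpace n d := (WithLp.toLp 2 (Function.update y.1 j t), y.2) with hy'
    have h1 : γ t = partialLoopPoint p₀ q₀ (insert j S) y' := by
      simp only [hγ, partialLoopPoint, Finset.sum_insert hj]
      have h2 : ∀ i ∈ S, y'.1 i = y.1 i := fun i hi => by
        have : i ≠ j := fun h => hj (h ▸ hi)
        simp [hy', this]
      have h3 : y'.1 j = t := by simp [hy']
      rw [h3, Finset.sum_congr rfl fun i hi => by rw [← h2 i hi]]
      have h4 : basePoint n d y' = basePoint n d y := rfl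
      rw [h4]
      abel
    rw [h1]
    exact partialLoopPoint_mem hO₁ hε₁ _ hy
  have hγj : γ (y.1 j) = partialLoopPoint p₀ q₀ (insert j S) y := by
    simp only [hγ, partialLoopPoint, Finset.sum_insert hj]
    abel
  -- The lifted loop ends at (0, b) with b an integer, and periodicity of h in q_j identifies this
  -- endpoint with the equilibrium (0, 0).
  have hlim : ∀ {l : Filter ℝ} {b : ℤ}, Tendsto (p₀ j) l (𝓝 0) → Tendsto (q₀ j) l (𝓝 (b : ℝ)) →
      Tendsto (fun t => h (γ t)) l (𝓝 (h (partialLoopPoint p₀ q₀ S y))) := by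
    intro l b hp hq
    have hmem := partialLoopPoint_mem hO₁ hε₁ S hy
    have heq : partialLoopPoint p₀ q₀ S y + ((0 : ℝ) • pVec n d j + (b : ℝ) • qVec n d j) =
        ((partialLoopPoint p₀ q₀ S y).1,
          (partialLoopPoint p₀ q₀ S y).2.1 + intVec (Pi.single j b),
          (partialLoopPoint p₀ q₀ S y).2.2.1, (partialLoopPoint p₀ q₀ S y).2.2.2.1 + intVec 0,
          (partialLoopPoint p₀ q₀ S y).2.2.2.2.1 + (0 : ℤ),
          (partialLoopPoint p₀ q₀ S y).2.2.2.2.2) := by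
      have h1 : (b : ℝ) • (EuclideanSpace.single j 1 : E n) = intVec (Pi.single j b) := by
        ext i
        by_cases hij : i = j
        · subst hij; simp [intVec]
        · simp [intVec, hij]
      have h2 : (intVec 0 : E d) = 0 := by ext i; simp [intVec]
      rw [← h1, h2]
      simp [pVec, qVec, Prod.ext_iff]
    have hmem' : partialLoopPoint p₀ q₀ S y + ((0 : ℝ) • pVec n d j + (b : ℝ) • qVec n d j) ∈
        domain O₁ O₂ ε₁ := by
      rw [heq]
      exact ⟨hO₁.2.1 _ _ _ hmem.1, hmem.2⟩
    have hval : h (partialLoopPoint p₀ q₀ S y + ((0 : ℝ) • pVec n d j + (b : ℝ) • qVec n d j)) =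
        h (partialLoopPoint p₀ q₀ S y) := by
      rw [heq]
      exact hh.2 _ _ _ _ _ _ _ _ _ hmem
    rw [← hval]
    have hcont : ContinuousAt h
        (partialLoopPoint p₀ q₀ S y + ((0 : ℝ) • pVec n d j + (b : ℝ) • qVec n d j)) :=
      hC3.continuousOn.continuousAt (hΩ.mem_nhds hmem')
    exact hcont.tendsto.comp
      (tendsto_const_nhds.add ((hp.smul_const _).add (hq.smul_const _)))
  have hder : ∀ t, HasDerivAt (fun t => h (γ t)) (fderiv ℝ h (γ t)
      (-(s j * deriv (V j) (q₀ j t)) • pVec n d j + (s j * p₀ j t) • qVec n d j)) t := fun t => by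
    have h1 : HasDerivAt γ
        (-(s j * deriv (V j) (q₀ j t)) • pVec n d j + (s j * p₀ j t) • qVec n d j) t :=
      ((((hl j).homoclinic.hasDerivAt_p t).smul_const _).add
        (((hl j).homoclinic.hasDerivAt_q t).smul_const _)).const_add _
    exact ((hC3.contDiffAt (hΩ.mem_nhds (hγmem t))).differentiableAt
      (by norm_num)).hasFDerivAt.comp_hasDerivAt t h1
  have hbd : ∀ t, |fderiv ℝ h (γ t)
      (-(s j * deriv (V j) (q₀ j t)) • pVec n d j + (s j * p₀ j t) • qVec n d j)| ≤
        2 * C * A * Real.exp (-μ * |t|) := fun t => by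
    have h1 : ‖fderiv ℝ h (γ t)‖ ≤ A := by
      have := hA 1 (by norm_num) _ (hγmem t)
      rwa [← norm_iteratedFDeriv_fderiv, norm_iteratedFDeriv_zero] at this
    have h2 : ‖-(s j * deriv (V j) (q₀ j t)) • pVec n d j + (s j * p₀ j t) • qVec n d j‖ ≤
        2 * C * Real.exp (-μ * |t|) := by
      refine (norm_add_le _ _).trans ?_
      rw [norm_smul, norm_smul, norm_pVec, norm_qVec, mul_one, mul_one, norm_neg,
        Real.norm_eq_abs, Real.norm_eq_abs, abs_mul (s j) (p₀ j t), (hl j).abs_sign, one_mul]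
      linarith [(hdecay j t).1, (hdecay j t).2]
    refine ((fderiv ℝ h (γ t)).le_of_opNorm_le_of_le h1 h2).trans (le_of_eq ?_)
    ring
  rw [← hγj]
  rcases le_total 0 (y.1 j) with h0 | h0
  · obtain ⟨b, hb⟩ := (hl j).homoclinic.q_atTop
    have h1 := abs_sub_le_of_deriv_exp hμ (T₀ := 0) (C := 2 * C * A) (fun t _ => hder t)
      (fun t ht => by simpa [abs_of_nonneg ht] using hbd t)
      (hlim (hl j).homoclinic.p_atTop hb) h0
    rw [abs_of_nonneg h0]
    refine h1.trans (le_of_eq (by ring))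
  -- For negative times the same estimate is applied to γ run backwards.
  · obtain ⟨b, hb⟩ := (hl j).homoclinic.q_atBot
    have h1 := abs_sub_le_of_deriv_exp (H := fun t => h (γ (-t))) hμ (T₀ := 0) (C := 2 * C * A)
      (fun t _ => (hder (-t)).comp t (hasDerivAt_neg t))
      (fun t ht => by
        rw [mul_neg_one, abs_neg]
        simpa only [abs_neg, abs_of_nonneg ht] using hbd (-t))
      ((hlim (hl j).homoclinic.p_atBot hb).comp tendsto_neg_atTop_atBot) (neg_nonneg.2 h0)
    rw [neg_neg] at h1
    rw [abs_of_nonpos h0]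
    refine h1.trans (le_of_eq (by ring))

/-- The integrand of the Melnikov potential decays exponentially as all pendula approach the
equilibrium. -/
theorem exists_decay_loopDiff (hl : ∀ i, IsPendulumLoop (s i) (V i) (p₀ i) (q₀ i))
    (hO₁ : IsSeparatrixNhd p₀ q₀ O₁) (hO₂ : IsOpen O₂) (hε₁ : 0 < ε₁) :
    ∃ C μ : ℝ, 0 ≤ C ∧ 0 < μ ∧ ∀ (h : Phase n d → ℝ) (A : ℝ),
      IsPerturbation 3 (domain O₁ O₂ ε₁) h → IsC3Bound A (domain O₁ O₂ ε₁) h →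
      ∀ y ∈ loopDomain n O₂, |loopDiff p₀ q₀ h y| ≤ A * ∑ i, C * Real.exp (-μ * |y.1 i|) := by
  obtain ⟨C, μ, hC, hμ, hdecay⟩ := exists_uniform_decay hl
  refine ⟨2 * C / μ, μ, by positivity, hμ, fun h A hh hA y hy => ?_⟩
  -- Telescoping: the pendula are lifted from the equilibrium to their loops one by one, each at the
  -- cost of its own exponential.
  have key : ∀ S : Finset (Fin n),
      |h (partialLoopPoint p₀ q₀ S y) - h (basePoint n d y)| ≤
        A * ∑ i ∈ S, 2 * C / μ * Real.exp (-μ * |y.1 i|) := by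
    intro S
    induction S using Finset.induction_on with
    | empty => simp [partialLoopPoint]
    | insert j S hj ih =>
      rw [Finset.sum_insert hj]
      have h1 := abs_sub_partialLoopPoint_le hl hO₁ hO₂ hε₁ hμ hdecay hh hA hj hy
      have h2 := abs_sub_le (h (partialLoopPoint p₀ q₀ (insert j S) y))
        (h (partialLoopPoint p₀ q₀ S y)) (h (basePoint n d y))
      linarith
  exact key Finset.univ

end LoopDecay

/-! ### Integrability of exponential weights -/

section ExpIntegrable

theorem integrable_exp_neg_mul_abs {μ : ℝ} (hμ : 0 < μ) :
    Integrable fun t : ℝ => Real.exp (-μ * |t|) := by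
  have h1 : IntegrableOn (fun t : ℝ => Real.exp (-μ * |t|)) (Ioi 0) := by
    refine (integrableOn_exp_mul_Ioi (neg_neg_of_pos hμ) 0).congr_fun (fun t ht => ?_)
      measurableSet_Ioi
    simp only [abs_of_pos (mem_Ioi.1 ht)]
  have h2 : IntegrableOn (fun t : ℝ => Real.exp (-μ * |t|)) (Iic 0) := by
    refine (integrableOn_exp_mul_Iic hμ 0).congr_fun (fun t ht => ?_) measurableSet_Iic
    simp only [abs_of_nonpos (mem_Iic.1 ht), neg_mul_neg]
  rw [← integrableOn_univ, ← Iic_union_Ioi (a := (0 : ℝ))]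
  exact h2.union h1

/-- Each factor 1 + |t| is at most a constant times e^(μ|t|/6), so the three of them use up half of
the exponential. -/
theorem integrable_poly_mul_exp_neg_mul_abs {μ : ℝ} (hμ : 0 < μ) :
    Integrable fun t : ℝ => (1 + |t|) ^ 3 * Real.exp (-μ * |t|) := by
  refine ((integrable_exp_neg_mul_abs (half_pos hμ)).const_mul ((1 + 6 / μ) ^ 3)).mono'
    (Continuous.aestronglyMeasurable (by fun_prop)) (Eventually.of_forall fun t => ?_)
  rw [Real.norm_eq_abs, abs_of_nonneg (by positivity)]
  have h1 : 1 + |t| ≤ (1 + 6 / μ) * Real.exp (μ / 6 * |t|) := by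
    have h2 : 1 ≤ Real.exp (μ / 6 * |t|) := Real.one_le_exp (by positivity)
    have h3 : μ / 6 * |t| + 1 ≤ Real.exp (μ / 6 * |t|) := Real.add_one_le_exp _
    have h4 : |t| = 6 / μ * (μ / 6 * |t|) := by field_simp
    have h5 : 6 / μ * (μ / 6 * |t|) ≤ 6 / μ * Real.exp (μ / 6 * |t|) :=
      mul_le_mul_of_nonneg_left (by linarith) (by positivity)
    linarith
  have h6 := pow_le_pow_left₀ (by positivity) h1 3
  rw [mul_pow, ← Real.exp_nat_mul] at h6
  calc (1 + |t|) ^ 3 * Real.exp (-μ * |t|)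
      ≤ (1 + 6 / μ) ^ 3 * Real.exp ((3 : ℕ) * (μ / 6 * |t|)) * Real.exp (-μ * |t|) :=
        mul_le_mul_of_nonneg_right h6 (Real.exp_pos _).le
    _ = (1 + 6 / μ) ^ 3 * Real.exp (-(μ / 2) * |t|) := by
        rw [mul_assoc, ← Real.exp_add]; congr 2; push_cast; ring

end ExpIntegrable

end GlobalMelnikov
end

noncomputable section

namespace GlobalMelnikov

open Filter Topology MeasureTheory Metric Set

/-! ### Interpolation of derivatives -/

section Interpolation

theorem norm_iteratedFDeriv_two {X Y : Type*} [NormedAddCommGroup X] [NormedSpace ℝ X]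
    [NormedAddCommGroup Y] [NormedSpace ℝ Y] (f : X → Y) (x : X) :
    ‖iteratedFDeriv ℝ 2 f x‖ = ‖fderiv ℝ (fderiv ℝ f) x‖ := by
  rw [← norm_iteratedFDeriv_fderiv, ← norm_iteratedFDeriv_fderiv, norm_iteratedFDeriv_zero]

/-- Interpolation of the first two derivatives between a small function and its bounded higher
derivatives. -/
theorem norm_iteratedFDeriv_le_interpolation {X : Type*} [NormedAddCommGroup X] [NormedSpace ℝ X]
    {f : X → ℝ} {x₀ : X} {ρ a K θ : ℝ} (hρ : 0 < ρ) (hθ : 0 < θ) (hθ1 : θ ≤ 1)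
    (ha : 0 ≤ a) (hK : 0 ≤ K)
    (hf : ∀ x ∈ ball x₀ (3 * ρ), ContDiffAt ℝ 3 f x)
    (h0 : ∀ x ∈ ball x₀ (3 * ρ), ‖f x‖ ≤ a * θ ^ 4)
    (h23 : ∀ j ≤ 3, ∀ x ∈ ball x₀ (3 * ρ), ‖iteratedFDeriv ℝ j f x‖ ≤ K) :
    ∀ j ≤ 2, ∀ x ∈ ball x₀ ρ, ‖iteratedFDeriv ℝ j f x‖ ≤
      (a + (2 * a / ρ + K * ρ) + (2 * (2 * a / ρ + K * ρ) / ρ + K * ρ)) * θ := by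
  have hθ2 : θ ^ 2 ≤ θ := by nlinarith
  have hθ4 : θ ^ 4 ≤ θ := by
    calc θ ^ 4 = θ ^ 2 * θ ^ 2 := by ring
      _ ≤ 1 * θ := mul_le_mul (by nlinarith) hθ2 (by positivity) zero_le_one
      _ = θ := one_mul θ
  have hsub : ∀ {x : X} {s r : ℝ}, x ∈ ball x₀ r → s ≤ ρ → r + ρ ≤ 3 * ρ →
      closedBall x s ⊆ ball x₀ (3 * ρ) := fun {x s r} hx hs hr y hy => by
    rw [mem_ball] at *
    rw [mem_closedBall] at hy
    linarith [dist_triangle y x x₀]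
  have hd1 : ∀ x ∈ ball x₀ (3 * ρ), DifferentiableAt ℝ f x := fun x hx =>
    (hf x hx).differentiableAt (by norm_num)
  have hC2 : ∀ x ∈ ball x₀ (3 * ρ), ContDiffAt ℝ 2 (fderiv ℝ f) x := fun x hx =>
    (hf x hx).fderiv_right (by norm_num)
  have hC1 : ∀ x ∈ ball x₀ (3 * ρ), ContDiffAt ℝ 1 (fderiv ℝ (fderiv ℝ f)) x := fun x hx =>
    (hC2 x hx).fderiv_right (by norm_num)
  have hn1 : ∀ x, ‖iteratedFDeriv ℝ 1 f x‖ = ‖fderiv ℝ f x‖ := fun x => by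
    rw [← norm_iteratedFDeriv_fderiv, norm_iteratedFDeriv_zero]
  have hn2 := norm_iteratedFDeriv_two f
  have hn3 : ∀ x, ‖iteratedFDeriv ℝ 2 (fderiv ℝ f) x‖ = ‖iteratedFDeriv ℝ 3 f x‖ := fun x =>
    norm_iteratedFDeriv_fderiv
  have hstep1 : ∀ x ∈ ball x₀ (2 * ρ), ‖fderiv ℝ f x‖ ≤ (2 * a / ρ + K * ρ) * θ ^ 2 := by
    intro x hx
    -- With |f| ≤ aθ⁴, the step ρθ² balances the two terms of the interpolation inequality: both are
    -- of order θ².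
    have hcb := hsub hx (s := ρ * θ ^ 2) (by nlinarith) (by linarith)
    have h := norm_fderiv_le_interpolation (s := ρ * θ ^ 2) (by positivity)
      (fun y hy => hd1 y (hcb hy)) (fun y hy => (hC2 y (hcb hy)).differentiableAt (by norm_num))
      (fun y hy => h0 y (hcb hy)) (fun y hy => (hn2 y) ▸ h23 2 (by norm_num) y (hcb hy))
    refine h.trans (le_of_eq ?_)
    field_simp
  have hstep2 : ∀ x ∈ ball x₀ ρ, ‖fderiv ℝ (fderiv ℝ f) x‖ ≤
      (2 * (2 * a / ρ + K * ρ) / ρ + K * ρ) * θ := by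
    intro x hx
    -- The same for f', now of size θ²: the step ρθ leaves order θ. Each differentiation also
    -- shrinks the ball by ρ.
    have hcb := hsub hx (s := ρ * θ) (by nlinarith) (by linarith)
    have hcb2 : closedBall x (ρ * θ) ⊆ ball x₀ (2 * ρ) := fun y hy => by
      rw [mem_ball] at *
      rw [mem_closedBall] at hy
      nlinarith [dist_triangle y x x₀]
    have h := norm_fderiv_le_interpolation (s := ρ * θ) (by positivity)
      (fun y hy => (hC2 y (hcb hy)).differentiableAt (by norm_num))
      (fun y hy => (hC1 y (hcb hy)).differentiableAt (by norm_num))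
      (fun y hy => hstep1 y (hcb2 hy)) (fun y hy =>
        (norm_iteratedFDeriv_two (fderiv ℝ f) y) ▸ (hn3 y).trans_le (h23 3 le_rfl y (hcb hy)))
    refine h.trans (le_of_eq ?_)
    field_simp
  have hb1 : 0 ≤ 2 * a / ρ + K * ρ := by positivity
  have hb2 : 0 ≤ 2 * (2 * a / ρ + K * ρ) / ρ + K * ρ := by positivity
  intro j hj x hx
  have hx2 : x ∈ ball x₀ (2 * ρ) := ball_subset_ball (by linarith) hx
  have hx3 : x ∈ ball x₀ (3 * ρ) := ball_subset_ball (by linarith) hx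
  interval_cases j
  · rw [norm_iteratedFDeriv_zero]
    refine (h0 x hx3).trans ?_
    nlinarith [mul_le_mul_of_nonneg_left hθ4 ha, mul_nonneg hb1 hθ.le, mul_nonneg hb2 hθ.le]
  · rw [hn1]
    refine (hstep1 x hx2).trans ?_
    nlinarith [mul_le_mul_of_nonneg_left hθ2 hb1, mul_nonneg ha hθ.le, mul_nonneg hb2 hθ.le]
  · rw [hn2]
    refine (hstep2 x hx).trans ?_
    nlinarith [mul_nonneg ha hθ.le, mul_nonneg hb1 hθ.le]

end Interpolation

/-! ### C² bounds for the Melnikov potential -/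

section ExtendedMelnikov

variable {n d : ℕ}

/-- The variables `(τ, I, φ, t, w)` of the Melnikov potential with the frequency `w` as an
additional independent variable. -/
abbrev MelnikovSpace (n d : ℕ) : Type := E n × E d × E d × ℝ × E d

/-- The unperturbed motion `(τ + σ (1, …, 1), I, φ + σ w, t + σ)`. -/
def flowMap (σ : ℝ) (x : MelnikovSpace n d) : LoopSpace n d :=
  (x.1 + σ • oneVec n, x.2.1, x.2.2.1 + σ • x.2.2.2.2, x.2.2.2.1 + σ)

theorem shifted_eq (x : Fin n → ℝ → ℝ) (τ : E n) (σ : ℝ) :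
    shifted x τ σ = shifted x (τ + σ • oneVec n) 0 := by
  simp [shifted, oneVec]

/-- The Melnikov potential with the frequency as an independent variable. -/
def extMelnikov (p₀ q₀ : Fin n → ℝ → ℝ) (h : Phase n d → ℝ) (x : MelnikovSpace n d) : ℝ :=
  ∫ σ : ℝ, -loopDiff p₀ q₀ h (flowMap σ x)

/-- With the frequency as a free variable the flow is affine for each σ, so the derivative bounds do
not involve h₀; its regularity enters only through the final substitution. -/
theorem melnikovPotential_eq (h₀ : E d → ℝ) (p₀ q₀ : Fin n → ℝ → ℝ) (h : Phase n d → ℝ)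
    (τ : E n) (I φ : E d) (t : ℝ) :
    melnikovPotential h₀ p₀ q₀ h τ I φ t = extMelnikov p₀ q₀ h (τ, I, φ, t, freq h₀ I) := by
  rw [melnikovPotential, extMelnikov, integral_neg]
  simp only [loopDiff, loopPoint_eq, basePoint_apply, flowMap, ← shifted_eq]

/-- The linear part grows like 1 + |σ| through the term σw, so an i-th derivative along the flow
costs (1 + |σ|) ^ i. -/
theorem exists_flowMap_eq (n d : ℕ) : ∃ D : ℝ, 1 ≤ D ∧ ∀ σ : ℝ,
    ∃ (L : MelnikovSpace n d →L[ℝ] LoopSpace n d) (c : LoopSpace n d),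
      ‖L‖ ≤ D * (1 + |σ|) ∧ flowMap σ = fun x => L x + c := by
  let A : MelnikovSpace n d →L[ℝ] LoopSpace n d :=
    (ContinuousLinearMap.fst ℝ _ _).prod
      (((ContinuousLinearMap.fst ℝ _ _).comp (ContinuousLinearMap.snd ℝ _ _)).prod
      (((ContinuousLinearMap.fst ℝ _ _).comp
        ((ContinuousLinearMap.snd ℝ _ _).comp (ContinuousLinearMap.snd ℝ _ _))).prod
      ((ContinuousLinearMap.fst ℝ _ _).comp ((ContinuousLinearMap.snd ℝ _ _).comp
        ((ContinuousLinearMap.snd ℝ _ _).comp (ContinuousLinearMap.snd ℝ _ _))))))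
  let B : MelnikovSpace n d →L[ℝ] LoopSpace n d :=
    (0 : MelnikovSpace n d →L[ℝ] E n).prod
      ((0 : MelnikovSpace n d →L[ℝ] E d).prod
      (((ContinuousLinearMap.snd ℝ _ _).comp ((ContinuousLinearMap.snd ℝ _ _).comp
        ((ContinuousLinearMap.snd ℝ _ _).comp (ContinuousLinearMap.snd ℝ _ _)))).prod
      (0 : MelnikovSpace n d →L[ℝ] ℝ)))
  refine ⟨1 + ‖A‖ + ‖B‖, by linarith [norm_nonneg A, norm_nonneg B], fun σ =>
    ⟨A + σ • B, (σ • oneVec n, 0, 0, σ), ?_, ?_⟩⟩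
  · refine (norm_add_le _ _).trans ?_
    rw [norm_smul, Real.norm_eq_abs]
    nlinarith [norm_nonneg A, norm_nonneg B, abs_nonneg σ, mul_nonneg (norm_nonneg A) (abs_nonneg σ)]
  · ext1 x
    simp [flowMap, A, B]

variable {s : Fin n → ℝ} {V p₀ q₀ : Fin n → ℝ → ℝ} {O₁ : Set (E n × E n)} {O₂ : Set (E d)} {ε₁ : ℝ}

theorem contDiffAt_uncurry_loopDiff (hl : ∀ i, IsPendulumLoop (s i) (V i) (p₀ i) (q₀ i))
    (hO₁ : IsSeparatrixNhd p₀ q₀ O₁) (hO₂ : IsOpen O₂) (hε₁ : 0 < ε₁)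
    {h : Phase n d → ℝ} (hh : IsPerturbation 3 (domain O₁ O₂ ε₁) h) {x : MelnikovSpace n d}
    (hx : x.2.1 ∈ O₂) (σ : ℝ) :
    ContDiffAt ℝ 3 (Function.uncurry fun σ x => -loopDiff p₀ q₀ h (flowMap σ x)) (σ, x) := by
  have h1 : ContDiffAt ℝ 3 (loopDiff p₀ q₀ h) (flowMap σ x) :=
    (contDiffOn_loopDiff hl hO₁ hε₁ hh).contDiffAt ((isOpen_loopDomain hO₂).mem_nhds hx)
  have h2 : ContDiff ℝ 3 fun z : ℝ × MelnikovSpace n d => flowMap z.1 z.2 := by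
    unfold flowMap
    fun_prop
  exact (h1.comp (f := fun z : ℝ × MelnikovSpace n d => flowMap z.1 z.2) (σ, x) h2.contDiffAt).neg

/-- Translation invariance removes τ from the integral of e^(-μ|τ_i + σ|), so C serves for all
parameters. In particular the potential is bounded in τ. -/
theorem integrable_loopDiff (hl : ∀ i, IsPendulumLoop (s i) (V i) (p₀ i) (q₀ i))
    (hO₁ : IsSeparatrixNhd p₀ q₀ O₁) (hO₂ : IsOpen O₂) (hε₁ : 0 < ε₁) :
    ∃ C : ℝ, ∀ (h : Phase n d → ℝ) (A : ℝ),
      IsPerturbation 3 (domain O₁ O₂ ε₁) h → IsC3Bound A (domain O₁ O₂ ε₁) h →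
      ∀ x : MelnikovSpace n d, x.2.1 ∈ O₂ →
        Integrable (fun σ => -loopDiff p₀ q₀ h (flowMap σ x)) ∧ |extMelnikov p₀ q₀ h x| ≤ C * A := by
  obtain ⟨C, μ, hC, hμ, hdecay⟩ := exists_decay_loopDiff hl hO₁ hO₂ hε₁
  refine ⟨∑ _i : Fin n, C * ∫ σ : ℝ, Real.exp (-μ * |σ|), fun h A hh hA x hx => ?_⟩
  have hint : ∀ i, Integrable fun σ : ℝ => C * Real.exp (-μ * |x.1 i + σ|) := fun i =>
    ((integrable_exp_neg_mul_abs hμ).comp_add_left (x.1 i)).const_mul C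
  have hbound : Integrable fun σ : ℝ => A * ∑ i, C * Real.exp (-μ * |x.1 i + σ|) :=
    (integrable_finsetSum _ fun i _ => hint i).const_mul A
  have hle : ∀ σ, ‖-loopDiff p₀ q₀ h (flowMap σ x)‖ ≤ A * ∑ i, C * Real.exp (-μ * |x.1 i + σ|) :=
    fun σ => by
      have h1 := hdecay h A hh hA (flowMap σ x) hx
      rw [norm_neg]
      simpa [flowMap, oneVec] using h1
  have hmeas : AEStronglyMeasurable (fun σ => -loopDiff p₀ q₀ h (flowMap σ x)) := by
    refine Continuous.aestronglyMeasurable (continuous_iff_continuousAt.2 fun σ => ?_)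
    exact ContinuousAt.comp (f := fun σ => (σ, x))
      (contDiffAt_uncurry_loopDiff hl hO₁ hO₂ hε₁ hh hx σ).continuousAt (by fun_prop)
  refine ⟨hbound.mono' hmeas (Eventually.of_forall hle), ?_⟩
  refine (norm_integral_le_of_norm_le hbound (Eventually.of_forall hle)).trans (le_of_eq ?_)
  rw [integral_const_mul, integral_finsetSum _ fun i _ => hint i, mul_comm]
  congr 1
  refine Finset.sum_congr rfl fun i _ => ?_
  rw [integral_const_mul, integral_add_left_eq_self (fun σ => Real.exp (-μ * |σ|))]

/-- Local `C²` regularity of the Melnikov potential, with bounds that are linear in the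
perturbation. -/
theorem exists_bound_extMelnikov (hl : ∀ i, IsPendulumLoop (s i) (V i) (p₀ i) (q₀ i))
    (hO₁ : IsSeparatrixNhd p₀ q₀ O₁) (hO₂ : IsOpen O₂) (hε₁ : 0 < ε₁) {x₀ : MelnikovSpace n d}
    (hx₀ : x₀.2.1 ∈ O₂) :
    ∃ ρ K : ℝ, 0 < ρ ∧ 0 ≤ K ∧ (∀ x ∈ ball x₀ ρ, x.2.1 ∈ O₂) ∧
      ∀ (h : Phase n d → ℝ) (A : ℝ), IsPerturbation 3 (domain O₁ O₂ ε₁) h →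
        IsC3Bound A (domain O₁ O₂ ε₁) h → ContDiffOn ℝ 2 (extMelnikov p₀ q₀ h) (ball x₀ ρ) ∧
        ∀ j ≤ 2, ∀ x ∈ ball x₀ ρ, ‖iteratedFDeriv ℝ j (extMelnikov p₀ q₀ h) x‖ ≤ K * A := by
  have hopen : IsOpen {x : MelnikovSpace n d | x.2.1 ∈ O₂} := hO₂.preimage (by fun_prop)
  obtain ⟨r, hr, hball⟩ := Metric.isOpen_iff.1 hopen x₀ hx₀
  set ρ := r / 3 with hρ
  have hρ0 : 0 < ρ := by positivity
  have h3ρ : 3 * ρ = r := by rw [hρ]; ring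
  obtain ⟨C, μ, hC, hμ, hdecay⟩ := exists_decay_loopDiff hl hO₁ hO₂ hε₁
  obtain ⟨D, hD0, hD⟩ := exists_bound_loopDiff hl hO₁ hO₂ hε₁
  obtain ⟨Λ, hΛ1, hΛ⟩ := exists_flowMap_eq n d
  -- R bounds every |τ_i| on the ball, so e^(-μ|τ_i + σ|) ≤ e^(μR) e^(-μ|σ|); this gives the
  -- constant a. In b, the factor 6 is 3! from the composition estimate.
  set R := ‖x₀‖ + r with hR
  set a := ∑ _i : Fin n, C * Real.exp (μ * R) with ha
  have ha0 : 0 ≤ a := Finset.sum_nonneg fun i _ => by positivity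
  set b := 6 * D * Λ ^ 3 with hb
  have hb0 : 0 ≤ b := by positivity
  set M := a + (2 * a / ρ + b * ρ) + (2 * (2 * a / ρ + b * ρ) / ρ + b * ρ) with hM
  have hM0 : 0 ≤ M := by positivity
  have hint := integrable_poly_mul_exp_neg_mul_abs (show 0 < μ / 4 by positivity)
  refine ⟨ρ, M * ∫ σ : ℝ, (1 + |σ|) ^ 3 * Real.exp (-(μ / 4) * |σ|), hρ0,
    mul_nonneg hM0 (integral_nonneg fun σ => by positivity),
    fun x hx => hball (ball_subset_ball (by linarith) hx), fun h A hh hA => ?_⟩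
  have hA0 : 0 ≤ A := (norm_nonneg _).trans (hA 0 (by norm_num) _
    (basePoint_mem (y := (0, x₀.2.1, 0, 0)) hO₁ hε₁ hx₀))
  have hcd := fun (σ : ℝ) (x : MelnikovSpace n d) (hx : x.2.1 ∈ O₂) =>
    contDiffAt_uncurry_loopDiff hl hO₁ hO₂ hε₁ hh hx σ
  have hcd' : ∀ (σ : ℝ) (x : MelnikovSpace n d), x.2.1 ∈ O₂ →
      ContDiffAt ℝ 3 (fun x => -loopDiff p₀ q₀ h (flowMap σ x)) x := fun σ x hx =>
    (hcd σ x hx).comp (f := fun x => (σ, x)) x (by fun_prop)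
  have hbd : ∀ j ≤ 2, ∀ σ, ∀ x ∈ ball x₀ ρ,
      ‖iteratedFDeriv ℝ j (fun x => -loopDiff p₀ q₀ h (flowMap σ x)) x‖ ≤
        A * (M * ((1 + |σ|) ^ 3 * Real.exp (-(μ / 4) * |σ|))) := by
    intro j hj σ x hx
    have hθ1 : Real.exp (-(μ / 4) * |σ|) ≤ 1 := Real.exp_le_one_iff.2 (by
      have := abs_nonneg σ; nlinarith)
    have hp1 : 1 ≤ (1 + |σ|) ^ 3 := one_le_pow₀ (by linarith [abs_nonneg σ])
    -- Here θ = e^(-μ|σ|/4), so θ⁴ is the decay of the integrand itself. The factor (1 + |σ|)³ is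
    -- needed only in K; putting it in a too lets it factor out of the result.
    have h := norm_iteratedFDeriv_le_interpolation (f := fun x => -loopDiff p₀ q₀ h (flowMap σ x))
      (a := A * (a * (1 + |σ|) ^ 3)) (K := A * (b * (1 + |σ|) ^ 3))
      (x₀ := x₀) hρ0 (Real.exp_pos (-(μ / 4) * |σ|)) hθ1 (by positivity) (by positivity)
      (fun y hy => hcd' σ y (hball (h3ρ ▸ hy))) (fun y hy => ?_) (fun i hi y hy => ?_) j hj x hx
    · refine h.trans (le_of_eq ?_)
      rw [hM]
      field_simp
    · have hyO : y.2.1 ∈ O₂ := hball (h3ρ ▸ hy)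
      have h1 := hdecay h A hh hA (flowMap σ y) hyO
      rw [norm_neg, ← Real.exp_nat_mul]
      refine h1.trans ?_
      rw [mul_assoc A]
      refine mul_le_mul_of_nonneg_left ?_ hA0
      have h2 : ∀ i, C * Real.exp (-μ * |(flowMap σ y).1 i|) ≤
          C * Real.exp (μ * R) * Real.exp ((4 : ℕ) * (-(μ / 4) * |σ|)) := fun i => by
        rw [mul_assoc, ← Real.exp_add]
        refine mul_le_mul_of_nonneg_left (Real.exp_le_exp.2 ?_) hC
        have h3 : |σ| ≤ |(flowMap σ y).1 i| + R := by
          have h4 : |y.1 i| ≤ R := by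
            have h5 : |y.1 i| ≤ ‖y.1‖ := PiLp.norm_apply_le y.1 i
            have h6 : ‖y.1‖ ≤ ‖y‖ := norm_fst_le y
            have h7 : ‖y - x₀‖ < r := by rw [← mem_ball_iff_norm, ← h3ρ]; exact hy
            have h8 := norm_sub_norm_le y x₀
            linarith
          have h5 : σ = (flowMap σ y).1 i - y.1 i := by simp [flowMap, oneVec]
          calc |σ| = |(flowMap σ y).1 i - y.1 i| := by rw [← h5]
            _ ≤ |(flowMap σ y).1 i| + |y.1 i| := abs_sub _ _
            _ ≤ _ := by linarith
        push_cast
        nlinarith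
      calc ∑ i, C * Real.exp (-μ * |(flowMap σ y).1 i|)
          ≤ ∑ _i : Fin n, C * Real.exp (μ * R) * Real.exp ((4 : ℕ) * (-(μ / 4) * |σ|)) :=
            Finset.sum_le_sum fun i _ => h2 i
        _ = a * Real.exp ((4 : ℕ) * (-(μ / 4) * |σ|)) := by rw [ha, Finset.sum_mul]
        _ ≤ a * (1 + |σ|) ^ 3 * Real.exp ((4 : ℕ) * (-(μ / 4) * |σ|)) :=
            mul_le_mul_of_nonneg_right (le_mul_of_one_le_right ha0 hp1) (Real.exp_pos _).le
    · have hyO : y.2.1 ∈ O₂ := hball (h3ρ ▸ hy)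
      obtain ⟨L, c, hL, hflow⟩ := hΛ σ
      have hi3 : (i : WithTop ℕ∞) ≤ 3 := by exact_mod_cast hi
      have h1 : ‖iteratedFDeriv ℝ i (fun x => loopDiff p₀ q₀ h (flowMap σ x)) y‖ ≤
          i.factorial * (D * A) * (Λ * (1 + |σ|)) ^ i := by
        rw [hflow]
        refine norm_iteratedFDeriv_comp_le_of_isOpen (s := {x : MelnikovSpace n d | x.2.1 ∈ O₂})
          (f := fun x => L x + c) hopen
          (isOpen_loopDomain hO₂) ((contDiffOn_loopDiff hl hO₁ hε₁ hh).of_le hi3)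
          (L.contDiff.add contDiff_const).contDiffOn (fun z hz => ?_) hyO (fun k hk => ?_)
          (fun k hk1 hk => norm_iteratedFDeriv_affine_le L c hL k hk1 y)
        · have : L z + c = flowMap σ z := by rw [hflow]
          change L z + c ∈ _
          rw [this]; exact hz
        · have : L y + c = flowMap σ y := by rw [hflow]
          rw [this]
          exact hD h A hh hA k (by omega) _ hyO
      change ‖iteratedFDeriv ℝ i (-(fun x => loopDiff p₀ q₀ h (flowMap σ x))) y‖ ≤ _
      rw [iteratedFDeriv_neg_apply, norm_neg]
      refine h1.trans ?_
      have hf : (i.factorial : ℝ) ≤ 6 := by exact_mod_cast Nat.factorial_le hi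
      have h4 : 1 ≤ Λ * (1 + |σ|) := one_le_mul_of_one_le_of_one_le hΛ1 (by linarith [abs_nonneg σ])
      have h5 : (Λ * (1 + |σ|)) ^ i ≤ (Λ * (1 + |σ|)) ^ 3 := pow_le_pow_right₀ h4 hi
      calc (i.factorial : ℝ) * (D * A) * (Λ * (1 + |σ|)) ^ i
          ≤ 6 * (D * A) * (Λ * (1 + |σ|)) ^ 3 := by gcongr
        _ = A * (b * (1 + |σ|) ^ 3) := by rw [hb]; ring
  have hmain := contDiffOn_integral 2 (F := fun σ x => -loopDiff p₀ q₀ h (flowMap σ x))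
    isOpen_ball (fun σ x hx => (hcd σ x (hball (ball_subset_ball (by linarith) hx))).of_le
      (by norm_num)) ((hint.const_mul M).const_mul A) hbd
  refine ⟨hmain.1, fun j hj x hx => (hmain.2 j hj x hx).trans (le_of_eq ?_)⟩
  rw [integral_const_mul, integral_const_mul]
  ring

end ExtendedMelnikov

end GlobalMelnikov
end

noncomputable section

namespace GlobalMelnikov

open Filter Topology MeasureTheory Metric Set

/-! ### Envelope formula and translation of critical points -/

section Envelope

/-- The envelope formula: along a family of critical points only the explicit dependence on the
parameter contributes to the derivative. -/
theorem hasFDerivAt_of_critical {X Y : Type*} [NormedAddCommGroup X] [NormedSpace ℝ X]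
    [NormedAddCommGroup Y] [NormedSpace ℝ Y] {f : X → Y → ℝ} {g : X → Y} {x : X}
    (hf : DifferentiableAt ℝ (Function.uncurry f) (x, g x)) (hg : DifferentiableAt ℝ g x)
    (hcrit : fderiv ℝ (f x) (g x) = 0) :
    HasFDerivAt (fun x => f x (g x)) (fderiv ℝ (fun x' => f x' (g x)) x) x := by
  set D := fderiv ℝ (Function.uncurry f) (x, g x) with hD
  have h0 : HasFDerivAt (Function.uncurry f) D (x, g x) := hf.hasFDerivAt
  have h1 : HasFDerivAt (fun x => f x (g x))
      (D.comp ((ContinuousLinearMap.id ℝ X).prod (fderiv ℝ g x))) x :=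
    h0.comp (f := fun x => (x, g x)) x ((hasFDerivAt_id x).prodMk hg.hasFDerivAt)
  have h2 : HasFDerivAt (fun x' => f x' (g x))
      (D.comp ((ContinuousLinearMap.id ℝ X).prod 0)) x :=
    h0.comp (f := fun x' => (x', g x)) x ((hasFDerivAt_id x).prodMk (hasFDerivAt_const (g x) x))
  have h3 : HasFDerivAt (f x) (D.comp ((0 : Y →L[ℝ] X).prod (ContinuousLinearMap.id ℝ Y))) (g x) :=
    h0.comp (f := fun y => (x, y)) (g x) ((hasFDerivAt_const x (g x)).prodMk (hasFDerivAt_id _))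
  rw [h3.fderiv] at hcrit
  rw [h2.fderiv]
  convert! h1 using 1
  ext v
  have h4 : D (0, fderiv ℝ g x v) = 0 := by
    simpa using congrArg (fun l : Y →L[ℝ] ℝ => l (fderiv ℝ g x v)) hcrit
  have h5 : D (v, fderiv ℝ g x v) = D (v, 0) + D (0, fderiv ℝ g x v) := by
    rw [← map_add]; simp
  simp [h5, h4]

end Envelope

theorem isNondegCritPt_comp_sub {F : Type*} [NormedAddCommGroup F] [NormedSpace ℝ F] (f : F → ℝ)
    (a x : F) : IsNondegCritPt (fun x => f (x - a)) x ↔ IsNondegCritPt f (x - a) := by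
  have h1 : fderiv ℝ (fun x => f (x - a)) = fun x => fderiv ℝ f (x - a) := by
    ext1 y; exact fderiv_comp_sub a
  have h2 : fderiv ℝ (fun x => fderiv ℝ f (x - a)) x = fderiv ℝ (fderiv ℝ f) (x - a) :=
    fderiv_comp_sub a
  have h3 : ContDiffAt ℝ 2 (fun x => f (x - a)) x ↔ ContDiffAt ℝ 2 f (x - a) := by
    constructor
    · intro h
      have := ContDiffAt.comp (f := fun y => y + a) (x - a) (by simpa using h) (by fun_prop)
      simpa [Function.comp_def] using this
    · intro h
      exact h.comp (f := fun x => x - a) x (by fun_prop)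
  unfold IsNondegCritPt
  rw [h1, h2, h3]

/-! ### Regularity, symmetries and critical families of the Melnikov potential -/

section Melnikov

variable {n d : ℕ} {s : Fin n → ℝ} {V p₀ q₀ : Fin n → ℝ → ℝ} {O₁ : Set (E n × E n)}
  {O₂ : Set (E d)} {ε₁ : ℝ} {h₀ : E d → ℝ} {h : Phase n d → ℝ}

theorem contDiffAt_freq (hO₂ : IsOpen O₂) (hh₀ : ContDiffOn ℝ 3 h₀ O₂) {I : E d} (hI : I ∈ O₂) :
    ContDiffAt ℝ 2 (freq h₀) I :=
  ((InnerProductSpace.toDual ℝ (E d)).symm.contDiff.contDiffAt).comp I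
    ((hh₀.contDiffAt (hO₂.mem_nhds hI)).fderiv_right (by norm_num))

theorem contDiffAt_extMelnikov (hl : ∀ i, IsPendulumLoop (s i) (V i) (p₀ i) (q₀ i))
    (hO₁ : IsSeparatrixNhd p₀ q₀ O₁) (hO₂ : IsOpen O₂) (hε₁ : 0 < ε₁)
    (hh : IsPerturbation 3 (domain O₁ O₂ ε₁) h) {x : MelnikovSpace n d}
    (hx : x.2.1 ∈ O₂) : ContDiffAt ℝ 2 (extMelnikov p₀ q₀ h) x := by
  obtain ⟨A, -, hA⟩ := hh.exists_isC3Bound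
  obtain ⟨ρ, K, hρ, -, -, hK⟩ := exists_bound_extMelnikov hl hO₁ hO₂ hε₁ hx
  exact (hK h A hh hA).1.contDiffAt (ball_mem_nhds x hρ)

theorem contDiffAt_melnikovPotential (hl : ∀ i, IsPendulumLoop (s i) (V i) (p₀ i) (q₀ i))
    (hO₁ : IsSeparatrixNhd p₀ q₀ O₁) (hO₂ : IsOpen O₂) (hε₁ : 0 < ε₁)
    (hh₀ : ContDiffOn ℝ 3 h₀ O₂) (hh : IsPerturbation 3 (domain O₁ O₂ ε₁) h) {z : LoopSpace n d}
    (hz : z.2.1 ∈ O₂) :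
    ContDiffAt ℝ 2 (fun z : LoopSpace n d =>
      melnikovPotential h₀ p₀ q₀ h z.1 z.2.1 z.2.2.1 z.2.2.2) z := by
  simp only [melnikovPotential_eq]
  have h1 : ContDiffAt ℝ 2 (fun z : LoopSpace n d => freq h₀ z.2.1) z :=
    (contDiffAt_freq hO₂ hh₀ hz).comp (f := fun z : LoopSpace n d => z.2.1) z (by fun_prop)
  exact (contDiffAt_extMelnikov hl hO₁ hO₂ hε₁ hh hz).comp
    (f := fun z : LoopSpace n d => ((z.1, z.2.1, z.2.2.1, z.2.2.2, freq h₀ z.2.1) :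
      MelnikovSpace n d)) z
    (contDiffAt_fst.prodMk (ContDiffAt.prodMk (by fun_prop) (ContDiffAt.prodMk (by fun_prop)
      (ContDiffAt.prodMk (by fun_prop) h1))))

/-- The substitution σ ↦ σ + t in the integral. This identity is why a reduced potential depending
only on φ - tω(I) exists. -/
theorem melnikovPotential_sub (τ : E n) (I φ : E d) (t : ℝ) :
    melnikovPotential h₀ p₀ q₀ h τ I φ t =
      melnikovPotential h₀ p₀ q₀ h (τ - t • oneVec n) I (φ - t • freq h₀ I) 0 := by
  rw [melnikovPotential_eq, melnikovPotential_eq, extMelnikov, extMelnikov]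
  rw [← integral_add_right_eq_self (fun σ => -loopDiff p₀ q₀ h
    (flowMap σ (τ - t • oneVec n, I, φ - t • freq h₀ I, (0 : ℝ), freq h₀ I))) t]
  congr 1
  ext1 σ
  congr 2
  simp only [flowMap, Prod.mk.injEq, true_and]
  refine ⟨by module, by module, by ring⟩

theorem melnikovPotential_add_intVec (hO₁ : IsSeparatrixNhd p₀ q₀ O₁) (hε₁ : 0 < ε₁)
    (hh : IsPerturbation 3 (domain O₁ O₂ ε₁) h) (τ : E n) {I : E d} (hI : I ∈ O₂) (φ : E d) (t : ℝ)
    (b : Fin d → ℤ) :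
    melnikovPotential h₀ p₀ q₀ h τ I (φ + intVec b) t =
      melnikovPotential h₀ p₀ q₀ h τ I φ t := by
  rw [melnikovPotential_eq, melnikovPotential_eq, extMelnikov, extMelnikov]
  congr 1
  ext1 σ
  have h0 : (intVec 0 : E n) = 0 := by ext i; simp [intVec]
  set y : LoopSpace n d := flowMap σ (τ, I, φ, t, freq h₀ I) with hy
  have hyO : y ∈ loopDomain n O₂ := hI
  have hy' : flowMap σ (τ, I, φ + intVec b, t, freq h₀ I) =
      (y.1, y.2.1, y.2.2.1 + intVec b, y.2.2.2) := by
    simp only [flowMap, hy, Prod.mk.injEq, true_and, and_true]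
    abel
  have hmem := loopPoint_mem hO₁ hε₁ hyO
  have hmem' := basePoint_mem hO₁ hε₁ hyO
  rw [loopPoint_eq] at hmem
  rw [basePoint_apply] at hmem'
  have h1 := hh.2 0 b 0 _ _ _ _ _ _ hmem
  have h2 := hh.2 0 b 0 _ _ _ _ _ _ hmem'
  simp only [h0, add_zero, Int.cast_zero] at h1 h2
  rw [hy', loopDiff, loopDiff, loopPoint_eq, loopPoint_eq, basePoint_apply, basePoint_apply, h1, h2]

/-- Reduction of an angle vector to the lattice translate nearest to `θ`. -/
def reduceAngle {d : ℕ} (θ φ : E d) : E d := φ - intVec fun i => round (φ i - θ i)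

theorem reduceAngle_add_intVec (θ φ : E d) (b : Fin d → ℤ) :
    reduceAngle θ (φ + intVec b) = reduceAngle θ φ := by
  ext i
  have h1 : φ i + (b i : ℝ) - θ i = φ i - θ i + b i := by ring
  simp [reduceAngle, intVec, h1]

/-- All coordinates of φ - b - θ are below 1/2 in absolute value, so rounding φ - θ recovers b. The
reduction is thus a smooth translation locally. -/
theorem reduceAngle_eq {θ φ : E d} {b : Fin d → ℤ} (hb : φ - intVec b ∈ ball θ (1 / 2)) :
    reduceAngle θ φ = φ - intVec b := by
  have h1 : ∀ i, round (φ i - θ i) = b i := fun i => by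
    have h2 : |(φ - intVec b - θ) i| < 1 / 2 :=
      (PiLp.norm_apply_le (φ - intVec b - θ) i).trans_lt (mem_ball_iff_norm.1 hb)
    simp only [PiLp.sub_apply, intVec] at h2
    rw [round_eq, Int.floor_eq_iff]
    rw [abs_lt] at h2
    constructor <;> linarith [h2.1, h2.2]
  simp only [reduceAngle, h1]

/-- A non-degenerate critical point at one value of the parameters extends to a critical family with
a well-defined reduced potential. -/
theorem exists_criticalFamily (hl : ∀ i, IsPendulumLoop (s i) (V i) (p₀ i) (q₀ i))
    (hO₁ : IsSeparatrixNhd p₀ q₀ O₁) (hO₂ : IsOpen O₂) (hε₁ : 0 < ε₁)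
    (hh₀ : ContDiffOn ℝ 3 h₀ O₂) (hh : IsPerturbation 3 (domain O₁ O₂ ε₁) h)
    {I₁ φ₁ : E d} {t₁ : ℝ} {τ₁ : E n} (hI₁ : I₁ ∈ O₂)
    (hcrit : IsNondegCritPt (fun τ => melnikovPotential h₀ p₀ q₀ h τ I₁ φ₁ t₁) τ₁) :
    ∃ (r : ℝ) (O : Set (E d × ℝ)) (τs : E d → E d → ℝ → E n) (R : E d → E d → ℝ),
      0 < r ∧ ball I₁ r ⊆ O₂ ∧ IsCriticalFamily h₀ p₀ q₀ h (ball I₁ r) O τs ∧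
      IsReducedPotential h₀ p₀ q₀ h (ball I₁ r) O τs R ∧
      (fderiv ℝ (fun φ => melnikovPotential h₀ p₀ q₀ h τ₁ I₁ φ t₁) φ₁ ≠ 0 →
        ∀ I ∈ ball I₁ r, ∀ (φ : E d) (t : ℝ), (φ, t) ∈ O →
          DifferentiableAt ℝ (R I) (φ - t • freq h₀ I) ∧
          fderiv ℝ (R I) (φ - t • freq h₀ I) ≠ 0) := by
  -- The potential at t = 0, as a function of (I, θ) and τ. The shift identity carries the given
  -- critical point to the point σ₁ over x₁.
  set m : (E d × E d) → E n → ℝ := fun x τ => melnikovPotential h₀ p₀ q₀ h τ x.1 x.2 0 with hm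
  set x₁ : E d × E d := (I₁, φ₁ - t₁ • freq h₀ I₁) with hx₁
  set σ₁ : E n := τ₁ - t₁ • oneVec n with hσ₁
  have hMm : ∀ τ I φ t, melnikovPotential h₀ p₀ q₀ h τ I φ t =
      m (I, φ - t • freq h₀ I) (τ - t • oneVec n) := fun τ I φ t => melnikovPotential_sub τ I φ t
  have hm2 : ∀ (x : E d × E d) (τ : E n), x.1 ∈ O₂ →
      ContDiffAt ℝ 2 (Function.uncurry m) (x, τ) := fun x τ hx =>
    (contDiffAt_melnikovPotential hl hO₁ hO₂ hε₁ hh₀ hh (z := (τ, x.1, x.2, 0)) hx).comp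
      (f := fun z : (E d × E d) × E n => ((z.2, z.1.1, z.1.2, 0) : LoopSpace n d)) (x, τ)
      (by fun_prop)
  have hcrit' : IsNondegCritPt (m x₁) σ₁ := by
    rw [hσ₁, ← isNondegCritPt_comp_sub]
    simpa only [hMm] using hcrit
  set F : (E d × E d) × E n → (E n →L[ℝ] ℝ) := fun z => fderiv ℝ (m z.1) z.2 with hF
  have hF1 : ∀ z : (E d × E d) × E n, z.1.1 ∈ O₂ → ContDiffAt ℝ 1 F z := fun z hz => by
    refine ContDiffAt.fderiv (f := fun (z : (E d × E d) × E n) τ => m z.1 τ) (g := fun z => z.2)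
      (n := 2) ?_ contDiffAt_snd (by norm_num)
    exact (hm2 z.1 z.2 hz).comp (f := fun y : ((E d × E d) × E n) × E n => (y.1.1, y.2)) (z, z.2)
      (by fun_prop)
  have hG : ContinuousAt (fun z : (E d × E d) × E n => fderiv ℝ (fderiv ℝ (m z.1)) z.2)
      (x₁, σ₁) := by
    have h1 : ContDiffAt ℝ 0 (fun z : (E d × E d) × E n =>
        fderiv ℝ (fun τ => F (z.1, τ)) z.2) (x₁, σ₁) := by
      refine ContDiffAt.fderiv (f := fun (z : (E d × E d) × E n) τ => F (z.1, τ))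
        (g := fun z => z.2) (n := 1) ?_ contDiffAt_snd (by norm_num)
      exact (hF1 (x₁, σ₁) hI₁).comp (f := fun y : ((E d × E d) × E n) × E n => (y.1.1, y.2))
        ((x₁, σ₁), σ₁) (by fun_prop)
    exact h1.continuousAt
  have hT : ContinuousAt (fun z : (E d × E d) × E n =>
      fderiv ℝ (fun θ => m (z.1.1, θ) z.2) z.1.2) (x₁, σ₁) := by
    have h1 : ContDiffAt ℝ 0 (fun z : (E d × E d) × E n =>
        fderiv ℝ (fun θ => m (z.1.1, θ) z.2) z.1.2) (x₁, σ₁) := by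
      refine ContDiffAt.fderiv (f := fun (z : (E d × E d) × E n) θ => m (z.1.1, θ) z.2)
        (g := fun z => z.1.2) (n := 1) ?_ (by fun_prop) (by norm_num)
      exact ((hm2 x₁ σ₁ hI₁).of_le (by norm_num)).comp
        (f := fun y : ((E d × E d) × E n) × E d => ((y.1.1.1, y.2), y.1.2))
        ((x₁, σ₁), x₁.2) (by fun_prop)
    exact h1.continuousAt
  obtain ⟨e, he⟩ := exists_equiv_of_injective hcrit'.2.2
  -- The τ-derivative of the gradient F is the Hessian at the critical point, so non-degeneracy is
  -- the hypothesis of the implicit function theorem for F = 0.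
  have hinv : (fderiv ℝ F (x₁, σ₁) ∘L .inr ℝ (E d × E d) (E n)).IsInvertible := by
    refine ⟨e, ?_⟩
    rw [he]
    have h1 : HasFDerivAt (fun τ => F (x₁, τ))
        ((fderiv ℝ F (x₁, σ₁)).comp (ContinuousLinearMap.inr ℝ (E d × E d) (E n))) σ₁ :=
      (((hF1 (x₁, σ₁) hI₁).differentiableAt (by norm_num)).hasFDerivAt).comp σ₁
        (hasFDerivAt_prodMk_right x₁ σ₁)
    exact h1.fderiv
  set ψ := (hF1 (x₁, σ₁) hI₁).implicitFunction one_ne_zero hinv with hψ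
  have hψ₁ : ψ x₁ = σ₁ := (hF1 (x₁, σ₁) hI₁).implicitFunction_apply_self one_ne_zero hinv
  have hψcont : ContDiffAt ℝ 1 ψ x₁ :=
    (hF1 (x₁, σ₁) hI₁).contDiffAt_implicitFunction one_ne_zero hinv
  have hgraph : Tendsto (fun x => (x, ψ x)) (𝓝 x₁) (𝓝 (x₁, σ₁)) := by
    have := (continuousAt_id.prodMk hψcont.continuousAt).tendsto
    simpa [hψ₁] using this
  set N := ‖(e.symm : (E n →L[ℝ] ℝ) →L[ℝ] E n)‖ with hN
  have hN0 : 0 ≤ N := norm_nonneg (e.symm : (E n →L[ℝ] ℝ) →L[ℝ] E n)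
  -- All requirements on the family are open at x₁. The angle condition is kept conditional, so that
  -- one construction serves both H3 and H4.
  have hev : ∀ᶠ x in 𝓝 x₁, x.1 ∈ O₂ ∧ ContDiffAt ℝ 1 ψ x ∧ F (x, ψ x) = 0 ∧
      Function.Injective (fderiv ℝ (fderiv ℝ (m x)) (ψ x)) ∧
      (fderiv ℝ (fun θ => m (x₁.1, θ) σ₁) x₁.2 ≠ 0 →
        fderiv ℝ (fun θ => m (x.1, θ) (ψ x)) x.2 ≠ 0) := by
    refine ((continuous_fst.tendsto x₁).eventually (hO₂.mem_nhds hI₁)).and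
      ((hψcont.eventually (by simp)).and (Eventually.and ?_ (Eventually.and ?_ ?_)))
    · filter_upwards [(hF1 (x₁, σ₁) hI₁).eventually_apply_implicitFunction one_ne_zero hinv]
        with x hx
      rw [hx]
      exact hcrit'.2.1
    · have hc : 0 < 1 / (2 * (N + 1)) := by positivity
      have h1 := hgraph.eventually (hG.eventually (Metric.ball_mem_nhds
        (fderiv ℝ (fderiv ℝ (m x₁)) σ₁) hc))
      filter_upwards [h1] with x hx
      refine injective_of_norm_sub_lt e (c := 1 / (2 * (N + 1))) ?_ ?_
      · rw [← hN, mul_one_div, div_lt_one (by positivity)]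
        linarith
      · rw [he]
        exact (dist_eq_norm (fderiv ℝ (fderiv ℝ (m x)) (ψ x))
          (fderiv ℝ (fderiv ℝ (m x₁)) σ₁)).symm.trans_le (le_of_lt hx)
    · by_cases h0 : fderiv ℝ (fun θ => m (x₁.1, θ) σ₁) x₁.2 = 0
      · exact Eventually.of_forall fun x hx => absurd h0 hx
      · filter_upwards [hgraph.eventually (hT.eventually_ne h0)] with x hx _ using hx
  obtain ⟨r₀, hr₀, hr⟩ := Metric.eventually_nhds_iff_ball.1 hev
  have hω : ∀ᶠ I in 𝓝 I₁, ‖freq h₀ I‖ < ‖freq h₀ I₁‖ + 1 :=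
    (contDiffAt_freq hO₂ hh₀ hI₁).continuousAt.norm.eventually (gt_mem_nhds (lt_add_one _))
  obtain ⟨r', hr', hωr⟩ := Metric.eventually_nhds_iff_ball.1 hω
  set B := ‖freq h₀ I₁‖ + 1 with hB
  have hB0 : 0 < B := by positivity
  -- The ball of radius 2 r₂ must fit both in the range r₀ of good parameters and in the radius 1/2
  -- where `reduceAngle` is a translation. Half of it is reserved for φ and half for tω(I), which
  -- fixes r₃.
  set r₂ := min (r₀ / 2) (1 / 4) with hr₂
  have hr₂0 : 0 < r₂ := by positivity
  set r₃ := r₂ / B with hr₃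
  have hr₃0 : 0 < r₃ := by positivity
  have hgood : ∀ {I θ : E d}, I ∈ ball I₁ (min r₀ r') → θ ∈ ball x₁.2 (2 * r₂) →
      (I, θ) ∈ ball x₁ r₀ := fun {I θ} hI hθ => by
    rw [← ball_prod_same]
    exact ⟨ball_subset_ball (min_le_left _ _) hI,
      ball_subset_ball (by have := min_le_left (r₀ / 2) (1 / 4); rw [hr₂]; linarith) hθ⟩
  have hshift : ∀ {I φ : E d} {t : ℝ} {b : Fin d → ℤ}, I ∈ ball I₁ (min r₀ r') →
      φ - intVec b ∈ ball x₁.2 r₂ → |t| < r₃ →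
      φ - intVec b - t • freq h₀ I ∈ ball x₁.2 (2 * r₂) := fun {I φ t b} hI hφ ht => by
    rw [mem_ball_iff_norm] at *
    have h1 : ‖t • freq h₀ I‖ ≤ r₂ := by
      rw [norm_smul, Real.norm_eq_abs]
      have h2 : ‖freq h₀ I‖ ≤ B := (hωr I (mem_ball_iff_norm.2
        (hI.trans_le (min_le_right _ _)))).le
      calc |t| * ‖freq h₀ I‖ ≤ r₃ * B := mul_le_mul ht.le h2 (norm_nonneg _) hr₃0.le
        _ = r₂ := by rw [hr₃]; field_simp
    calc ‖φ - intVec b - t • freq h₀ I - x₁.2‖ = ‖(φ - intVec b - x₁.2) - t • freq h₀ I‖ := by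
          congr 1; abel
      _ ≤ ‖φ - intVec b - x₁.2‖ + ‖t • freq h₀ I‖ := norm_sub_le _ _
      _ < 2 * r₂ := by linarith
  have h2r₂ : 2 * r₂ ≤ 1 / 2 := by have := min_le_right (r₀ / 2) (1 / 4); rw [hr₂]; linarith
  have hred : ∀ {φ : E d} {b : Fin d → ℤ}, φ - intVec b ∈ ball x₁.2 (2 * r₂) →
      reduceAngle x₁.2 φ = φ - intVec b := fun hφ => reduceAngle_eq (ball_subset_ball h2r₂ hφ)
  -- The union of all lattice translates makes O periodic. By the shift identity the times may be
  -- taken near 0, whatever t₁ is.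
  set O : Set (E d × ℝ) := {z | ∃ b : Fin d → ℤ, z.1 - intVec b ∈ ball x₁.2 r₂ ∧ |z.2| < r₃} with hO
  have hOopen : IsOpen O := by
    have : O = ⋃ b : Fin d → ℤ, {z | z.1 - intVec b ∈ ball x₁.2 r₂ ∧ |z.2| < r₃} := by
      ext z; simp [hO]
    rw [this]
    refine isOpen_iUnion fun b => IsOpen.inter ?_ ?_
    · exact isOpen_ball.preimage (f := fun z : E d × ℝ => z.1 - intVec b) (by fun_prop)
    · exact isOpen_lt (f := fun z : E d × ℝ => |z.2|) (by fun_prop) continuous_const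
  set τs : E d → E d → ℝ → E n := fun I φ t =>
    ψ (I, reduceAngle x₁.2 φ - t • freq h₀ I) + t • oneVec n with hτs
  set R : E d → E d → ℝ := fun I θ =>
    m (I, reduceAngle x₁.2 θ) (ψ (I, reduceAngle x₁.2 θ)) with hR
  have hsub2 : ball x₁.2 r₂ ⊆ ball x₁.2 (2 * r₂) := ball_subset_ball (by linarith)
  have hMred : ∀ {I φ : E d} {t : ℝ} {b : Fin d → ℤ} (τ : E n), I ∈ O₂ →
      melnikovPotential h₀ p₀ q₀ h τ I φ t =
        m (I, φ - intVec b - t • freq h₀ I) (τ - t • oneVec n) := fun {I φ t b} τ hI => by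
    have h1 : φ - t • freq h₀ I = φ - intVec b - t • freq h₀ I + intVec b := by abel
    rw [hMm, h1]
    exact melnikovPotential_add_intVec hO₁ hε₁ hh _ hI _ _ _
  have hfd : fderiv ℝ (fun φ => melnikovPotential h₀ p₀ q₀ h τ₁ I₁ φ t₁) φ₁ =
      fderiv ℝ (fun θ => m (x₁.1, θ) σ₁) x₁.2 := by
    simp only [hMm]
    exact fderiv_comp_sub (f := fun θ => m (I₁, θ) σ₁) (t₁ • freq h₀ I₁)
  refine ⟨min r₀ r', O, τs, R, lt_min hr₀ hr', fun I hI => ?_, ⟨hOopen, ?_, ?_, ?_, ?_, ?_⟩, ?_, ?_⟩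
  · exact (hr _ (hgood hI (mem_ball_self (by positivity)))).1
  · exact ⟨(x₁.2, 0), 0, by
      have h0 : (intVec 0 : E d) = 0 := by ext i; simp [intVec]
      simpa [h0] using hr₂0, by simpa using hr₃0⟩
  · rintro b φ t ⟨b', hb', ht⟩
    refine ⟨b' + b, ?_, ht⟩
    have h1 : φ + intVec b - intVec (b' + b) = φ - intVec b' := by
      ext i; simp [intVec]
    rwa [h1]
  · intro I _ b φ t _
    simp only [hτs, reduceAngle_add_intVec]
  · rintro ⟨I, φ, t⟩ ⟨hI, b, hb, ht⟩
    refine ContDiffAt.contDiffWithinAt ?_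
    have hx := hr _ (hgood hI (hshift hI hb ht))
    have h1 : ContDiffAt ℝ 1 (fun x : E d × E d × ℝ =>
        ψ (x.1, x.2.1 - intVec b - x.2.2 • freq h₀ x.1) + x.2.2 • oneVec n) (I, φ, t) := by
      have h2 : ContDiffAt ℝ 1 (fun x : E d × E d × ℝ => freq h₀ x.1) (I, φ, t) :=
        ((contDiffAt_freq hO₂ hh₀ hx.1).of_le (by norm_num)).comp
          (f := fun x : E d × E d × ℝ => x.1) (I, φ, t) (by fun_prop)
      have h3 : ContDiffAt ℝ 1 (fun x : E d × E d × ℝ =>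
          (x.1, x.2.1 - intVec b - x.2.2 • freq h₀ x.1)) (I, φ, t) := by fun_prop
      exact (hx.2.1.comp (f := fun x : E d × E d × ℝ =>
          (x.1, x.2.1 - intVec b - x.2.2 • freq h₀ x.1)) (I, φ, t) h3).add (by fun_prop)
    refine h1.congr_of_eventuallyEq ?_
    have hopen : IsOpen {x : E d × E d × ℝ | x.2.1 - intVec b ∈ ball x₁.2 r₂} :=
      isOpen_ball.preimage (by fun_prop)
    filter_upwards [hopen.mem_nhds hb] with x hx
    simp only [hτs, hred (hsub2 hx)]
  · rintro I hI φ t ⟨b, hb, ht⟩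
    have hx := hr _ (hgood hI (hshift hI hb ht))
    simp only [hMred (b := b) _ hx.1]
    rw [isNondegCritPt_comp_sub]
    simp only [hτs, hred (hsub2 hb), add_sub_cancel_right]
    exact ⟨(hm2 _ _ hx.1).comp (f := fun τ => ((I, φ - intVec b - t • freq h₀ I), τ)) _
      (by fun_prop), hx.2.2.1, hx.2.2.2.1⟩
  · rintro I hI φ t ⟨b, hb, ht⟩
    have hθ := hshift hI hb ht
    have hx := hr _ (hgood hI hθ)
    have h1 : φ - t • freq h₀ I - intVec b = φ - intVec b - t • freq h₀ I := by abel
    rw [hMred (b := b) _ hx.1]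
    simp only [hR, hτs, hred (hsub2 hb), add_sub_cancel_right]
    rw [hred (b := b) (by rw [h1]; exact hθ), h1]
  · rintro hne I hI φ t ⟨b, hb, ht⟩
    have hθ := hshift hI hb ht
    have hx := hr _ (hgood hI hθ)
    have h1 : φ - t • freq h₀ I - intVec b = φ - intVec b - t • freq h₀ I := by abel
    rw [hfd] at hne
    -- Envelope formula: the derivative of R in θ is the explicit one, which the choice of r₀ keeps
    -- non-zero.
    have hder : HasFDerivAt (fun θ => m (I, θ) (ψ (I, θ)))
        (fderiv ℝ (fun θ => m (I, θ) (ψ (I, φ - intVec b - t • freq h₀ I)))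
          (φ - intVec b - t • freq h₀ I)) (φ - intVec b - t • freq h₀ I) := by
      refine hasFDerivAt_of_critical (f := fun θ τ => m (I, θ) τ) (g := fun θ => ψ (I, θ))
        ?_ ?_ hx.2.2.1
      · have := ((hm2 (I, φ - intVec b - t • freq h₀ I)
          (ψ (I, φ - intVec b - t • freq h₀ I)) hx.1).differentiableAt (by norm_num))
        exact this.comp (f := fun z : E d × E n => ((I, z.1), z.2)) (_, _) (by fun_prop)
      · exact (hx.2.1.differentiableAt (by norm_num)).comp (f := fun θ => (I, θ)) _ (by fun_prop)
    rw [← h1] at hder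
    have hder2 : HasFDerivAt (fun θ => m (I, θ - intVec b) (ψ (I, θ - intVec b)))
        (fderiv ℝ (fun θ => m (I, θ) (ψ (I, φ - t • freq h₀ I - intVec b)))
          (φ - t • freq h₀ I - intVec b)) (φ - t • freq h₀ I) := by
      simpa [Function.comp_def] using hder.comp (φ - t • freq h₀ I) (hasFDerivAt_sub_const (intVec b))
    have heq : R I =ᶠ[𝓝 (φ - t • freq h₀ I)]
        fun θ => m (I, θ - intVec b) (ψ (I, θ - intVec b)) := by
      have hopen : IsOpen {θ : E d | θ - intVec b ∈ ball x₁.2 (2 * r₂)} :=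
        isOpen_ball.preimage (by fun_prop)
      filter_upwards [hopen.mem_nhds (show φ - t • freq h₀ I - intVec b ∈ _ by
        rw [h1]; exact hθ)] with θ hθ
      simp only [hR, hred hθ]
    have hder3 := hder2.congr_of_eventuallyEq heq
    refine ⟨hder3.differentiableAt, ?_⟩
    rw [hder3.fderiv, h1]
    exact hx.2.2.2.2 hne

end Melnikov

end GlobalMelnikov
end

noncomputable section

namespace GlobalMelnikov

open Filter Topology MeasureTheory Metric Set

/-! ### Linear operations on perturbations -/

section Perturbations

variable {n d : ℕ} {Ω : Set (Phase n d)} {m : ℕ∞} {h g : Phase n d → ℝ}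

theorem IsPerturbation.of_le {m' : ℕ∞} (hh : IsPerturbation m Ω h) (hm : m' ≤ m) :
    IsPerturbation m' Ω h :=
  ⟨⟨hh.1.1.of_le (by exact_mod_cast hm), fun j hj => hh.1.2 j (hj.trans hm)⟩, hh.2⟩

theorem IsPerturbation.neg (hh : IsPerturbation m Ω h) : IsPerturbation m Ω (fun x => -h x) := by
  refine ⟨⟨hh.1.1.neg, fun j hj => ?_⟩, fun a b c p q I φ t ε hx =>
    congrArg Neg.neg (hh.2 a b c p q I φ t ε hx)⟩
  obtain ⟨C, hC⟩ := hh.1.2 j hj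
  refine ⟨C, fun x hx => ?_⟩
  change ‖iteratedFDeriv ℝ j (-h) x‖ ≤ C
  rw [iteratedFDeriv_neg_apply, norm_neg]
  exact hC x hx

theorem IsPerturbation.add (hΩ : IsOpen Ω) (hh : IsPerturbation m Ω h) (hg : IsPerturbation m Ω g) :
    IsPerturbation m Ω (fun x => h x + g x) := by
  refine ⟨⟨hh.1.1.add hg.1.1, fun j hj => ?_⟩, fun a b c p q I φ t ε hx =>
    congrArg₂ (· + ·) (hh.2 a b c p q I φ t ε hx) (hg.2 a b c p q I φ t ε hx)⟩
  obtain ⟨C, hC⟩ := hh.1.2 j hj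
  obtain ⟨D, hD⟩ := hg.1.2 j hj
  refine ⟨C + D, fun x hx => ?_⟩
  have hj' : (j : WithTop ℕ∞) ≤ m := by exact_mod_cast hj
  change ‖iteratedFDeriv ℝ j (h + g) x‖ ≤ _
  rw [iteratedFDeriv_add_apply ((hh.1.1.of_le hj').contDiffAt (hΩ.mem_nhds hx))
    ((hg.1.1.of_le hj').contDiffAt (hΩ.mem_nhds hx))]
  exact (norm_add_le _ _).trans (add_le_add (hC x hx) (hD x hx))

theorem IsPerturbation.sub (hΩ : IsOpen Ω) (hh : IsPerturbation m Ω h) (hg : IsPerturbation m Ω g) :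
    IsPerturbation m Ω (fun x => h x - g x) := by
  simpa only [sub_eq_add_neg] using hh.add hΩ hg.neg

end Perturbations

/-! ### Pointwise forms of H3 and H4, and openness -/

section Conditions

variable {n d : ℕ} {s : Fin n → ℝ} {V p₀ q₀ : Fin n → ℝ → ℝ} {O₁ : Set (E n × E n)}
  {O₂ : Set (E d)} {ε₁ : ℝ} {h₀ : E d → ℝ} {h g : Phase n d → ℝ}

theorem melnikovPotential_add (hl : ∀ i, IsPendulumLoop (s i) (V i) (p₀ i) (q₀ i))
    (hO₁ : IsSeparatrixNhd p₀ q₀ O₁) (hO₂ : IsOpen O₂) (hε₁ : 0 < ε₁)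
    (hh : IsPerturbation 3 (domain O₁ O₂ ε₁) h) (hg : IsPerturbation 3 (domain O₁ O₂ ε₁) g)
    (τ : E n) {I : E d} (hI : I ∈ O₂) (φ : E d) (t : ℝ) :
    melnikovPotential h₀ p₀ q₀ (fun x => h x + g x) τ I φ t =
      melnikovPotential h₀ p₀ q₀ h τ I φ t + melnikovPotential h₀ p₀ q₀ g τ I φ t := by
  obtain ⟨C, hC⟩ := integrable_loopDiff hl hO₁ hO₂ hε₁
  obtain ⟨A, -, hA⟩ := hh.exists_isC3Bound
  obtain ⟨B, -, hB⟩ := hg.exists_isC3Bound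
  have h1 := (hC h A hh hA (τ, I, φ, t, freq h₀ I) hI).1
  have h2 := (hC g B hg hB (τ, I, φ, t, freq h₀ I) hI).1
  simp only [melnikovPotential_eq, extMelnikov]
  rw [← integral_add h1 h2]
  congr 1
  ext1 σ
  simp only [loopDiff]
  ring

/-- The derivative of the Melnikov potential with respect to the angles. -/
def angleDeriv (h₀ : E d → ℝ) (p₀ q₀ : Fin n → ℝ → ℝ) (h : Phase n d → ℝ)
    (τ : E n) (I φ : E d) (t : ℝ) : E d →L[ℝ] ℝ :=
  fderiv ℝ (fun φ => melnikovPotential h₀ p₀ q₀ h τ I φ t) φ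

theorem contDiffAt_melnikovPotential_tau (hl : ∀ i, IsPendulumLoop (s i) (V i) (p₀ i) (q₀ i))
    (hO₁ : IsSeparatrixNhd p₀ q₀ O₁) (hO₂ : IsOpen O₂) (hε₁ : 0 < ε₁)
    (hh₀ : ContDiffOn ℝ 3 h₀ O₂) (hh : IsPerturbation 3 (domain O₁ O₂ ε₁) h) (τ : E n) {I : E d}
    (hI : I ∈ O₂) (φ : E d) (t : ℝ) :
    ContDiffAt ℝ 2 (fun τ => melnikovPotential h₀ p₀ q₀ h τ I φ t) τ :=
  (contDiffAt_melnikovPotential hl hO₁ hO₂ hε₁ hh₀ hh (z := (τ, I, φ, t)) hI).comp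
    (f := fun τ : E n => ((τ, I, φ, t) : LoopSpace n d)) τ (by fun_prop)

theorem contDiffAt_melnikovPotential_tau_phi (hl : ∀ i, IsPendulumLoop (s i) (V i) (p₀ i) (q₀ i))
    (hO₁ : IsSeparatrixNhd p₀ q₀ O₁) (hO₂ : IsOpen O₂) (hε₁ : 0 < ε₁)
    (hh₀ : ContDiffOn ℝ 3 h₀ O₂) (hh : IsPerturbation 3 (domain O₁ O₂ ε₁) h) (z : E d × E n)
    {I : E d} (hI : I ∈ O₂) (t : ℝ) :
    ContDiffAt ℝ 2 (Function.uncurry fun (φ : E d) (τ : E n) =>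
      melnikovPotential h₀ p₀ q₀ h τ I φ t) z :=
  (contDiffAt_melnikovPotential hl hO₁ hO₂ hε₁ hh₀ hh (z := (z.2, I, z.1, t)) hI).comp
    (f := fun z : E d × E n => ((z.2, I, z.1, t) : LoopSpace n d)) z (by fun_prop)

theorem H3_iff (hl : ∀ i, IsPendulumLoop (s i) (V i) (p₀ i) (q₀ i))
    (hO₁ : IsSeparatrixNhd p₀ q₀ O₁) (hO₂ : IsOpen O₂) (hε₁ : 0 < ε₁)
    (hh₀ : ContDiffOn ℝ 3 h₀ O₂) (hh : IsPerturbation 3 (domain O₁ O₂ ε₁) h) :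
    H3 h₀ p₀ q₀ O₂ h ↔ ∃ I ∈ O₂, ∃ (φ : E d) (t : ℝ) (τ : E n),
      IsNondegCritPt (fun τ => melnikovPotential h₀ p₀ q₀ h τ I φ t) τ := by
  constructor
  · rintro ⟨c, r, O, τs, hr, hsub, hfam⟩
    obtain ⟨⟨φ, t⟩, hz⟩ := hfam.nonempty
    exact ⟨c, hsub (mem_ball_self hr), φ, t, _, hfam.critical c (mem_ball_self hr) φ t hz⟩
  · rintro ⟨I, hI, φ, t, τ, hcrit⟩
    obtain ⟨r, O, τs, R, hr, hsub, hfam, -⟩ :=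
      exists_criticalFamily hl hO₁ hO₂ hε₁ hh₀ hh hI hcrit
    exact ⟨I, r, O, τs, hr, hsub, hfam⟩

/-- In one direction the given family is differentiated at the centre of the smaller ball, where the
envelope formula identifies ∂R/∂θ with ∂M/∂φ. In the other, `exists_criticalFamily` supplies
everything, with the same ball in both roles. -/
theorem H4_iff (hl : ∀ i, IsPendulumLoop (s i) (V i) (p₀ i) (q₀ i))
    (hO₁ : IsSeparatrixNhd p₀ q₀ O₁) (hO₂ : IsOpen O₂) (hε₁ : 0 < ε₁)
    (hh₀ : ContDiffOn ℝ 3 h₀ O₂) (hh : IsPerturbation 3 (domain O₁ O₂ ε₁) h) :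
    H4 h₀ p₀ q₀ O₂ h ↔ ∃ I ∈ O₂, ∃ (φ : E d) (t : ℝ) (τ : E n),
      IsNondegCritPt (fun τ => melnikovPotential h₀ p₀ q₀ h τ I φ t) τ ∧
      angleDeriv h₀ p₀ q₀ h τ I φ t ≠ 0 := by
  constructor
  · rintro ⟨c, r, O, τs, R, hr, hsub, hfam, hR, I, r', hr', hsub', hne⟩
    have hI := hsub' (mem_ball_self hr')
    obtain ⟨⟨φ, t⟩, hz⟩ := hfam.nonempty
    have hcrit := hfam.critical I hI φ t hz
    refine ⟨I, hsub hI, φ, t, _, hcrit, fun h0 => ?_⟩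
    obtain ⟨hdiff, hRne⟩ := hne I (mem_ball_self hr') φ t hz
    have hopen : IsOpen {φ' : E d | (φ', t) ∈ O} := hfam.isOpen.preimage (by fun_prop)
    have hτs : ContDiffAt ℝ 1 (fun x : E d × E d × ℝ => τs x.1 x.2.1 x.2.2) (I, φ, t) :=
      hfam.contDiffOn.contDiffAt ((isOpen_ball.prod hfam.isOpen).mem_nhds ⟨hI, hz⟩)
    have hg : DifferentiableAt ℝ (fun φ' => τs I φ' t) φ :=
      (hτs.differentiableAt (by norm_num)).comp (f := fun φ' => (I, φ', t)) φ (by fun_prop)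
    have h1 := hasFDerivAt_of_critical
      (f := fun (φ' : E d) τ => melnikovPotential h₀ p₀ q₀ h τ I φ' t) (g := fun φ' => τs I φ' t)
      (x := φ) ((contDiffAt_melnikovPotential_tau_phi hl hO₁ hO₂ hε₁ hh₀ hh _ (hsub hI)
        t).differentiableAt (by norm_num)) hg hcrit.2.1
    have h2 : HasFDerivAt (fun φ' => R I (φ' - t • freq h₀ I))
        (fderiv ℝ (R I) (φ - t • freq h₀ I)) φ := by
      simpa [Function.comp_def] using
        hdiff.hasFDerivAt.comp φ (hasFDerivAt_sub_const (t • freq h₀ I))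
    have heq : (fun φ' => R I (φ' - t • freq h₀ I)) =ᶠ[𝓝 φ]
        fun φ' => melnikovPotential h₀ p₀ q₀ h (τs I φ' t) I φ' t := by
      filter_upwards [hopen.mem_nhds hz] with φ' hφ' using hR I hI φ' t hφ'
    exact hRne ((h2.unique (h1.congr_of_eventuallyEq heq)).trans h0)
  · rintro ⟨I, hI, φ, t, τ, hcrit, hne⟩
    obtain ⟨r, O, τs, R, hr, hsub, hfam, hR, hd⟩ :=
      exists_criticalFamily hl hO₁ hO₂ hε₁ hh₀ hh hI hcrit
    exact ⟨I, r, O, τs, R, hr, hsub, hfam, hR, I, r, hr, Subset.rfl, hd hne⟩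

theorem norm_iteratedFDeriv_slice_le {X Y Z : Type*} [NormedAddCommGroup X] [NormedSpace ℝ X]
    [NormedAddCommGroup Y] [NormedSpace ℝ Y] [NormedAddCommGroup Z] [NormedSpace ℝ Z]
    {g : X × Y → Z} {j : ℕ} {x₀ : X} {y : Y} {ρ C : ℝ} (hg : ContDiffOn ℝ j g (ball (x₀, y) ρ))
    (hC : ∀ i ≤ j, ∀ z ∈ ball (x₀, y) ρ, ‖iteratedFDeriv ℝ i g z‖ ≤ C) {x : X}
    (hx : x ∈ ball x₀ ρ) : ‖iteratedFDeriv ℝ j (fun x => g (x, y)) x‖ ≤ j.factorial * C := by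
  have hmem : ∀ x ∈ ball x₀ ρ, (x, y) ∈ ball (x₀, y) ρ := fun x hx => by
    rwa [mem_ball, Prod.dist_eq, dist_self, max_eq_left dist_nonneg]
  have hL : (fun x : X => (x, y)) = fun x => ContinuousLinearMap.inl ℝ X Y x + (0, y) := by
    ext1 x
    simp
  have hD : ∀ i, 1 ≤ i → i ≤ j → ‖iteratedFDeriv ℝ i (fun x : X => (x, y)) x‖ ≤ (1 : ℝ) ^ i := by
    intro i hi _
    rw [hL]
    exact norm_iteratedFDeriv_affine_le _ _ (ContinuousLinearMap.norm_inl_le_one ℝ X Y) i hi x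
  have h := norm_iteratedFDeriv_comp_le_of_isOpen (C := C) (D := 1) (f := fun x : X => (x, y))
    isOpen_ball isOpen_ball hg (ContDiff.contDiffOn (contDiff_prodMk_left y)) hmem hx
    (fun i hi => hC i hi (x, y) (hmem x hx)) hD
  rwa [one_pow, mul_one] at h

/-- Non-degenerate critical points of the Melnikov potential persist under `C³`-small perturbations,
with nearly the same derivative with respect to the angles. -/
theorem exists_nondegCritPt_of_close (hn : 1 ≤ n)
    (hl : ∀ i, IsPendulumLoop (s i) (V i) (p₀ i) (q₀ i))
    (hO₁ : IsSeparatrixNhd p₀ q₀ O₁) (hO₂ : IsOpen O₂) (hε₁ : 0 < ε₁)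
    (hh₀ : ContDiffOn ℝ 3 h₀ O₂) (hh : IsPerturbation 3 (domain O₁ O₂ ε₁) h) {I φ : E d} {t : ℝ}
    {τ : E n} (hI : I ∈ O₂)
    (hcrit : IsNondegCritPt (fun τ => melnikovPotential h₀ p₀ q₀ h τ I φ t) τ) {r ν : ℝ}
    (hr : 0 < r) (hν : 0 < ν) :
    ∃ δ : ℝ, 0 < δ ∧ ∀ h', IsPerturbation 3 (domain O₁ O₂ ε₁) h' →
      IsC3Bound δ (domain O₁ O₂ ε₁) (fun x => h' x - h x) →
      ∃ τ' ∈ ball τ r, IsNondegCritPt (fun τ => melnikovPotential h₀ p₀ q₀ h' τ I φ t) τ' ∧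
        ‖angleDeriv h₀ p₀ q₀ h' τ' I φ t - angleDeriv h₀ p₀ q₀ h τ' I φ t‖ ≤ ν := by
  set x₀ : MelnikovSpace n d := (τ, I, φ, t, freq h₀ I) with hx₀
  obtain ⟨ρ, K, hρ, hK0, hball, hK⟩ := exists_bound_extMelnikov hl hO₁ hO₂ hε₁ (x₀ := x₀) hI
  obtain ⟨δ₁, hδ₁, hclose⟩ := hcrit.exists_of_close hn (ρ := min ρ r) (lt_min hρ hr)
  -- Makes 2 K δ ≤ min δ₁ ν. The factor 2 is the 2! of the slice estimate.
  set δ : ℝ := min δ₁ ν / (2 * K + 1) with hδ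
  have hmin : 0 < min δ₁ ν := lt_min hδ₁ hν
  have hδ0 : 0 < δ := by positivity
  have hKδ : 2 * (K * δ) ≤ min δ₁ ν := by
    have h1 : (2 * K + 1) * δ = min δ₁ ν := by rw [hδ]; field_simp
    nlinarith
  refine ⟨δ, hδ0, fun h' hh' hsmall => ?_⟩
  have hΩ := isOpen_domain hO₁.1 hO₂ ε₁
  have he := hh'.sub hΩ hh
  obtain ⟨hC2, hbd⟩ := hK _ δ he hsmall
  have hsum : ∀ (τ : E n) (φ : E d), melnikovPotential h₀ p₀ q₀ h' τ I φ t =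
      melnikovPotential h₀ p₀ q₀ h τ I φ t +
        melnikovPotential h₀ p₀ q₀ (fun x => h' x - h x) τ I φ t := fun τ φ => by
    rw [← melnikovPotential_add hl hO₁ hO₂ hε₁ hh he τ hI φ t]
    simp
  have hmem : ∀ τ' ∈ ball τ ρ, ((τ', I, φ, t, freq h₀ I) : MelnikovSpace n d) ∈ ball x₀ ρ :=
    fun τ' hτ' => by
      rw [mem_ball, hx₀, Prod.dist_eq, dist_self, max_eq_left dist_nonneg]
      exact hτ'
  have hbτ : ∀ j ≤ 2, ∀ τ' ∈ ball τ ρ, ‖iteratedFDeriv ℝ j (fun τ =>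
      melnikovPotential h₀ p₀ q₀ (fun x => h' x - h x) τ I φ t) τ'‖ ≤ min δ₁ ν := by
    intro j hj τ' hτ'
    have hj2 : (j : WithTop ℕ∞) ≤ 2 := by exact_mod_cast hj
    simp only [melnikovPotential_eq]
    refine (norm_iteratedFDeriv_slice_le (g := extMelnikov p₀ q₀ (fun x => h' x - h x))
      (y := (I, φ, t, freq h₀ I)) (hC2.of_le hj2) (fun i hi => hbd i (hi.trans hj)) hτ').trans ?_
    have hf : (j.factorial : ℝ) ≤ 2 := by exact_mod_cast Nat.factorial_le hj
    exact le_trans (mul_le_mul_of_nonneg_right hf (by positivity)) hKδ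
  have hbφ : ∀ τ' ∈ ball τ ρ, ‖fderiv ℝ (fun φ =>
      melnikovPotential h₀ p₀ q₀ (fun x => h' x - h x) τ' I φ t) φ‖ ≤ ν := by
    intro τ' hτ'
    let L : E d →L[ℝ] MelnikovSpace n d := (ContinuousLinearMap.inr ℝ (E n) (E d × E d × ℝ × E d)).comp
      ((ContinuousLinearMap.inr ℝ (E d) (E d × ℝ × E d)).comp
        (ContinuousLinearMap.inl ℝ (E d) (ℝ × E d)))
    have hL : ‖L‖ ≤ 1 := ContinuousLinearMap.opNorm_le_bound _ zero_le_one fun v => by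
      simp [L, Prod.norm_def]
    have hLφ : ∀ φ' : E d, ((τ', I, φ', t, freq h₀ I) : MelnikovSpace n d) =
      L φ' + (τ', I, 0, t, freq h₀ I) := fun φ' => by simp [L]
    have hm := hmem τ' hτ'
    rw [hLφ] at hm
    have hd : HasFDerivAt (fun φ' => extMelnikov p₀ q₀ (fun x => h' x - h x)
        (L φ' + (τ', I, 0, t, freq h₀ I))) ((fderiv ℝ (extMelnikov p₀ q₀ (fun x => h' x - h x))
          (L φ + (τ', I, 0, t, freq h₀ I))).comp L) φ :=
      (((hC2.contDiffAt (isOpen_ball.mem_nhds hm)).differentiableAt (by norm_num)).hasFDerivAt).comp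
        (f := fun φ' => L φ' + (τ', I, 0, t, freq h₀ I)) φ (L.hasFDerivAt.add_const _)
    have heq : (fun φ => melnikovPotential h₀ p₀ q₀ (fun x => h' x - h x) τ' I φ t) =
        fun φ => extMelnikov p₀ q₀ (fun x => h' x - h x) (L φ + (τ', I, 0, t, freq h₀ I)) :=
      funext fun φ => by rw [melnikovPotential_eq, ← hLφ]
    rw [heq, hd.fderiv]
    have h1 := hbd 1 (by norm_num) _ hm
    rw [← norm_iteratedFDeriv_fderiv, norm_iteratedFDeriv_zero] at h1
    refine (ContinuousLinearMap.opNorm_comp_le _ _).trans ((mul_le_mul h1 hL (norm_nonneg _)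
      (by positivity)).trans ?_)
    have := min_le_right δ₁ ν
    have : 0 ≤ K * δ := by positivity
    linarith
  have hsub1 : ball τ (min ρ r) ⊆ ball τ ρ := ball_subset_ball (min_le_left _ _)
  obtain ⟨τ', hτ', hcrit'⟩ := hclose
    (fun τ => melnikovPotential h₀ p₀ q₀ (fun x => h' x - h x) τ I φ t)
    (fun x _ => (contDiffAt_melnikovPotential_tau hl hO₁ hO₂ hε₁ hh₀ he x hI φ t).contDiffWithinAt)
    (fun x hx => by
      have := (hbτ 1 (by norm_num) x (hsub1 hx)).trans (min_le_left _ _)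
      rwa [← norm_iteratedFDeriv_fderiv, norm_iteratedFDeriv_zero] at this)
    (fun x hx => by
      have := (hbτ 2 le_rfl x (hsub1 hx)).trans (min_le_left _ _)
      rwa [norm_iteratedFDeriv_two] at this)
  refine ⟨τ', ball_subset_ball (min_le_right _ _) hτ', by simpa only [hsum] using hcrit', ?_⟩
  have hdiff : ∀ {g : Phase n d → ℝ}, IsPerturbation 3 (domain O₁ O₂ ε₁) g → DifferentiableAt ℝ
      (fun φ => melnikovPotential h₀ p₀ q₀ g τ' I φ t) φ := fun {g} hg =>
    ((contDiffAt_melnikovPotential_tau_phi hl hO₁ hO₂ hε₁ hh₀ hg (φ, τ') hI t).differentiableAt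
      (by norm_num)).comp (f := fun φ => (φ, τ')) φ (by fun_prop)
  simp only [angleDeriv, hsum]
  rw [fderiv_fun_add (hdiff hh) (hdiff he), add_sub_cancel_left]
  exact hbφ τ' (hsub1 hτ')

theorem isC3Bound_of_isCrSmall {Ω : Set (Phase n d)} {δ : ℝ} (hh : IsCrSmall 3 δ Ω h) :
    IsC3Bound δ Ω h :=
  fun j hj x hx => (hh j hj x hx).le

theorem isCrOpen_H3 (hn : 1 ≤ n) {m : ℕ∞} (hm : 3 ≤ m)
    (hl : ∀ i, IsPendulumLoop (s i) (V i) (p₀ i) (q₀ i))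
    (hO₁ : IsSeparatrixNhd p₀ q₀ O₁) (hO₂ : IsOpen O₂) (hε₁ : 0 < ε₁)
    (hh₀ : ContDiffOn ℝ 3 h₀ O₂) :
    IsCrOpen 3 m (domain O₁ O₂ ε₁) (H3 h₀ p₀ q₀ O₂) := by
  intro h hh hP
  obtain ⟨I, hI, φ, t, τ, hcrit⟩ := (H3_iff hl hO₁ hO₂ hε₁ hh₀ (hh.of_le hm)).1 hP
  obtain ⟨δ, hδ, hclose⟩ := exists_nondegCritPt_of_close hn hl hO₁ hO₂ hε₁ hh₀ (hh.of_le hm) hI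
    hcrit one_pos one_pos
  refine ⟨δ, hδ, fun h' hh' hsmall => ?_⟩
  obtain ⟨τ', -, hcrit', -⟩ := hclose h' (hh'.of_le hm) (isC3Bound_of_isCrSmall hsmall)
  exact (H3_iff hl hO₁ hO₂ hε₁ hh₀ (hh'.of_le hm)).2 ⟨I, hI, φ, t, τ', hcrit'⟩

/-- The critical point moves, so its displacement is first limited to a ball where the old angle
derivative exceeds η / 2; the perturbation then changes that derivative by at most η / 2. -/
theorem isCrOpen_H4 (hn : 1 ≤ n) {m : ℕ∞} (hm : 3 ≤ m)
    (hl : ∀ i, IsPendulumLoop (s i) (V i) (p₀ i) (q₀ i))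
    (hO₁ : IsSeparatrixNhd p₀ q₀ O₁) (hO₂ : IsOpen O₂) (hε₁ : 0 < ε₁)
    (hh₀ : ContDiffOn ℝ 3 h₀ O₂) :
    IsCrOpen 3 m (domain O₁ O₂ ε₁) (H4 h₀ p₀ q₀ O₂) := by
  intro h hh hP
  obtain ⟨I, hI, φ, t, τ, hcrit, hne⟩ := (H4_iff hl hO₁ hO₂ hε₁ hh₀ (hh.of_le hm)).1 hP
  have hcont : ContinuousAt (fun τ => angleDeriv h₀ p₀ q₀ h τ I φ t) τ := by
    have h1 : ContDiffAt ℝ 0 (fun τ => angleDeriv h₀ p₀ q₀ h τ I φ t) τ := by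
      refine ContDiffAt.fderiv (f := fun (τ : E n) φ => melnikovPotential h₀ p₀ q₀ h τ I φ t)
        (g := fun _ => φ) (n := 1) ?_ contDiffAt_const (by norm_num)
      exact ((contDiffAt_melnikovPotential_tau_phi hl hO₁ hO₂ hε₁ hh₀ (hh.of_le hm) (φ, τ) hI
        t).of_le (by norm_num)).comp (f := fun z : E n × E d => (z.2, z.1)) (τ, φ) (by fun_prop)
    exact h1.continuousAt
  set η := ‖angleDeriv h₀ p₀ q₀ h τ I φ t‖ with hη
  have hη0 : 0 < η := norm_pos_iff.2 hne
  obtain ⟨r, hr, hball⟩ := Metric.eventually_nhds_iff_ball.1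
    (hcont.norm.eventually (lt_mem_nhds (half_lt_self hη0)))
  obtain ⟨δ, hδ, hclose⟩ := exists_nondegCritPt_of_close hn hl hO₁ hO₂ hε₁ hh₀ (hh.of_le hm) hI
    hcrit hr (half_pos hη0)
  refine ⟨δ, hδ, fun h' hh' hsmall => ?_⟩
  obtain ⟨τ', hτ', hcrit', hang⟩ := hclose h' (hh'.of_le hm) (isC3Bound_of_isCrSmall hsmall)
  refine (H4_iff hl hO₁ hO₂ hε₁ hh₀ (hh'.of_le hm)).2 ⟨I, hI, φ, t, τ', hcrit', fun h0 => ?_⟩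
  rw [h0, zero_sub, norm_neg] at hang
  exact absurd hang (not_le.2 (hball τ' hτ'))

end Conditions

end GlobalMelnikov
end

noncomputable section

namespace GlobalMelnikov

open Filter Topology MeasureTheory Metric Set

/-! ### Bump functions isolating a short piece of the homoclinic orbit -/

section Bump

variable {s : ℝ} {V p q : ℝ → ℝ}

theorem exists_int_of_cos_eq_one {x : ℝ} (h : Real.cos (2 * Real.pi * x) = 1) : ∃ m : ℤ, x = m := by
  obtain ⟨m, hm⟩ := (Real.cos_eq_one_iff _).1 h
  refine ⟨m, ?_⟩
  have := Real.pi_pos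
  have h2 : 2 * Real.pi * (x - m) = 0 := by linarith
  rcases mul_eq_zero.1 h2 with h3 | h3 <;> linarith

/-- A homoclinic orbit does not come back close to a point outside a short time interval. -/
theorem IsPendulumLoop.exists_isolated (hl : IsPendulumLoop s V p q) {ℓ : ℝ} (hℓ : 0 < ℓ) :
    ∃ t₀ ε : ℝ, 0 < ε ∧ ε ≤ p t₀ ^ 2 + (1 - Real.cos (2 * Real.pi * q t₀)) ∧
      ∀ t, (p t - p t₀) ^ 2 + (1 - Real.cos (2 * Real.pi * (q t - q t₀))) < ε → |t - t₀| < ℓ := by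
  obtain ⟨t₀, ht₀⟩ := hl.homoclinic.nontrivial
  have hcp := hl.continuous_p
  have hcq := hl.continuous_q
  -- D measures the distance to the point at time t₀ on the cylinder, the cosine making it
  -- independent of the lift of q. D₀ is the same for the equilibrium, hence the limit of D at ±∞.
  set D : ℝ → ℝ := fun t => (p t - p t₀) ^ 2 + (1 - Real.cos (2 * Real.pi * (q t - q t₀))) with hD
  set D₀ : ℝ := p t₀ ^ 2 + (1 - Real.cos (2 * Real.pi * q t₀)) with hD₀
  have hDc : Continuous D := by fun_prop
  have hD₀pos : 0 < D₀ := by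
    have h1 := Real.cos_le_one (2 * Real.pi * q t₀)
    have h2 := sq_nonneg (p t₀)
    refine lt_of_le_of_ne (by linarith) fun h0 => ht₀ ⟨?_, ?_⟩
    · exact pow_eq_zero_iff two_ne_zero |>.1 (by linarith : p t₀ ^ 2 = 0)
    · exact exists_int_of_cos_eq_one (by linarith)
  have hDpos : ∀ t, t ≠ t₀ → 0 < D t := fun t ht => by
    have h1 := Real.cos_le_one (2 * Real.pi * (q t - q t₀))
    have h2 := sq_nonneg (p t - p t₀)
    refine lt_of_le_of_ne (by simp only [hD]; linarith) fun h0 => ht ?_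
    simp only [hD] at h0
    have h3 := pow_eq_zero_iff two_ne_zero |>.1 (by linarith : (p t - p t₀) ^ 2 = 0)
    obtain ⟨m, hm⟩ := exists_int_of_cos_eq_one
      (by linarith : Real.cos (2 * Real.pi * (q t - q t₀)) = 1)
    exact hl.injective (sub_eq_zero.1 h3) (m := m) (by linarith)
  have hlim : ∀ (F : Filter ℝ) (a : ℤ), Tendsto p F (𝓝 0) → Tendsto q F (𝓝 (a : ℝ)) →
      Tendsto D F (𝓝 D₀) := fun F a hp hq => by
    have h1 : Tendsto D F (𝓝 ((0 - p t₀) ^ 2 +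
        (1 - Real.cos (2 * Real.pi * ((a : ℝ) - q t₀))))) :=
      ((hp.sub_const _).pow 2).add
        (((Real.continuous_cos.tendsto _).comp ((hq.sub_const _).const_mul _)).const_sub 1)
    have h2 : Real.cos (2 * Real.pi * ((a : ℝ) - q t₀)) = Real.cos (2 * Real.pi * q t₀) := by
      rw [← Real.cos_int_mul_two_pi_sub _ a]
      congr 1
      ring
    rwa [h2, zero_sub, neg_sq] at h1
  obtain ⟨a, ha⟩ := hl.homoclinic.q_atBot
  obtain ⟨b, hb⟩ := hl.homoclinic.q_atTop
  obtain ⟨T₁, hT₁⟩ := eventually_atBot.1 ((hlim _ a hl.homoclinic.p_atBot ha).eventually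
    (lt_mem_nhds (half_lt_self hD₀pos)))
  obtain ⟨T₂, hT₂⟩ := eventually_atTop.1 ((hlim _ b hl.homoclinic.p_atTop hb).eventually
    (lt_mem_nhds (half_lt_self hD₀pos)))
  have hK : IsCompact (Icc T₁ T₂ ∩ {t | ℓ ≤ |t - t₀|}) :=
    isCompact_Icc.inter_right (isClosed_le continuous_const (by fun_prop))
  obtain ⟨c, hc, hcK⟩ : ∃ c, 0 < c ∧ ∀ t ∈ Icc T₁ T₂ ∩ {t | ℓ ≤ |t - t₀|}, c ≤ D t := by
    rcases (Icc T₁ T₂ ∩ {t | ℓ ≤ |t - t₀|}).eq_empty_or_nonempty with h | h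
    · exact ⟨1, one_pos, by simp [h]⟩
    · obtain ⟨t₁, ht₁, hmin⟩ := hK.exists_isMinOn h hDc.continuousOn
      refine ⟨D t₁, hDpos t₁ fun h0 => ?_, fun t ht => hmin ht⟩
      have := ht₁.2
      rw [h0, mem_ofPred_eq, sub_self, abs_zero] at this
      linarith
  -- The tails stay above D₀ / 2, and the compact remainder with |t - t₀| ≥ ℓ stays above c by
  -- injectivity of the orbit.
  refine ⟨t₀, min c (D₀ / 2), lt_min hc (half_pos hD₀pos),
    (min_le_right _ _).trans (half_lt_self hD₀pos).le, fun t ht => ?_⟩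
  by_contra! hcon
  have h1 := ht.trans_le (min_le_left _ _)
  have h2 := ht.trans_le (min_le_right _ _)
  rcases le_total t T₁ with h3 | h3
  · exact absurd h2 (not_lt.2 (hT₁ t h3).le)
  · rcases le_total T₂ t with h4 | h4
    · exact absurd h2 (not_lt.2 (hT₂ t h4).le)
    · exact absurd h1 (not_lt.2 (hcK t ⟨⟨h3, h4⟩, hcon⟩))

/-- A bump function of `(p, q) ∈ ℝ × 𝕋` whose restriction to a homoclinic orbit is compactly supported
and has a non-zero Fourier coefficient of frequency `κ`. -/
theorem IsPendulumLoop.exists_bump (hl : IsPendulumLoop s V p q) (κ : ℝ) :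
    ∃ α β : ℝ → ℝ, HasBoundedDerivs ⊤ α ∧ HasBoundedDerivs ⊤ β ∧ Function.Periodic β 1 ∧
      α 0 * β 0 = 0 ∧ HasCompactSupport (fun t => α (p t) * β (q t)) ∧
      0 < (∫ t, α (p t) * β (q t) * Real.cos (2 * Real.pi * (κ * t))) ^ 2 +
        (∫ t, α (p t) * β (q t) * Real.sin (2 * Real.pi * (κ * t))) ^ 2 := by
  have hκ : 0 < |κ| + 1 := by positivity
  -- This ℓ keeps the phase 2πκ(t - t₀) within π/4, so the cosine is non-negative on the support of
  -- the bump.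
  obtain ⟨t₀, ε, hε, hε₀, hiso⟩ := hl.exists_isolated (ℓ := 1 / (8 * (|κ| + 1))) (by positivity)
  have hcp := hl.continuous_p
  have hcq := hl.continuous_q
  set α : ℝ → ℝ := fun x => Real.smoothTransition (ε / 2 - (x - p t₀) ^ 2) with hα
  set β : ℝ → ℝ := fun y =>
    Real.smoothTransition (ε / 2 - (1 - Real.cos (2 * Real.pi * (y - q t₀)))) with hβ
  have hαs : ContDiff ℝ ((⊤ : ℕ∞) : WithTop ℕ∞) α :=
    Real.smoothTransition.contDiff.comp (by fun_prop)
  have hβs : ContDiff ℝ ((⊤ : ℕ∞) : WithTop ℕ∞) β :=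
    Real.smoothTransition.contDiff.comp (by fun_prop)
  have hα0 : ∀ x, ε / 2 ≤ (x - p t₀) ^ 2 → α x = 0 := fun x hx =>
    Real.smoothTransition.zero_of_nonpos (by linarith)
  have hβ0 : ∀ y, ε / 2 ≤ 1 - Real.cos (2 * Real.pi * (y - q t₀)) → β y = 0 := fun x hx =>
    Real.smoothTransition.zero_of_nonpos (by linarith)
  have hβp : Function.Periodic β 1 := fun y => by
    simp only [hβ]
    rw [show 2 * Real.pi * (y + 1 - q t₀) = 2 * Real.pi * (y - q t₀) + 2 * Real.pi by ring,
      Real.cos_add_two_pi]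
  have hαcs : HasCompactSupport α := by
    refine HasCompactSupport.intro (isCompact_closedBall (p t₀) (ε + 1)) fun x hx => hα0 x ?_
    rw [mem_closedBall, Real.dist_eq, not_le] at hx
    rw [← sq_abs]
    nlinarith
  have hαcont := hαs.continuous
  have hβcont := hβs.continuous
  set A : ℝ → ℝ := fun t => α (p t) * β (q t) with hA
  have hAc : Continuous A := by fun_prop
  have hA0 : ∀ t, 1 / (8 * (|κ| + 1)) ≤ |t - t₀| → A t = 0 := fun t ht => by
    by_contra h0
    refine absurd (hiso t ?_) (not_lt.2 ht)
    have h1 : (p t - p t₀) ^ 2 < ε / 2 := by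
      by_contra! h
      exact h0 (by simp only [hA, hα0 _ h, zero_mul])
    have h2 : 1 - Real.cos (2 * Real.pi * (q t - q t₀)) < ε / 2 := by
      by_contra! h
      exact h0 (by simp only [hA, hβ0 _ h, mul_zero])
    linarith
  have hAcs : HasCompactSupport A := by
    refine HasCompactSupport.intro (isCompact_closedBall t₀ (1 / (8 * (|κ| + 1)))) fun t ht =>
      hA0 t ?_
    rw [mem_closedBall, Real.dist_eq, not_le] at ht
    exact ht.le
  refine ⟨α, β, hasBoundedDerivs_of_hasCompactSupport hαs hαcs, hasBoundedDerivs_of_periodic hβs hβp,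
    hβp, ?_, hAcs, ?_⟩
  -- The bump vanishes at the equilibrium because ε is at most the distance D₀ to it. The subtracted
  -- term of the Melnikov integrand thus disappears.
  · by_contra h0
    have h1 : (0 - p t₀) ^ 2 < ε / 2 := by
      by_contra! h
      exact h0 (by rw [hα0 _ h, zero_mul])
    have h2 : 1 - Real.cos (2 * Real.pi * (0 - q t₀)) < ε / 2 := by
      by_contra! h
      exact h0 (by rw [hβ0 _ h, mul_zero])
    rw [zero_sub, neg_sq] at h1
    rw [zero_sub, mul_neg, Real.cos_neg] at h2
    linarith
  -- A non-negative integrand, positive at t₀. By the addition formula it is a combination of the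
  -- cosine and sine coefficients, so these do not both vanish.
  have hpos : 0 < ∫ t, A t * Real.cos (2 * Real.pi * (κ * (t - t₀))) := by
    have hnn : ∀ t, 0 ≤ A t := fun t =>
      mul_nonneg (Real.smoothTransition.nonneg _) (Real.smoothTransition.nonneg _)
    refine Continuous.integral_pos_of_hasCompactSupport_nonneg_nonzero (x := t₀) (by fun_prop)
      hAcs.mul_right (fun t => ?_) ?_
    · rcases le_or_gt (1 / (8 * (|κ| + 1))) |t - t₀| with h | h
      · simp [hA0 t h]
      · refine mul_nonneg (hnn t) (Real.cos_nonneg_of_mem_Icc (abs_le.1 ?_))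
        have h1 : |κ * (t - t₀)| ≤ 1 / 8 := by
          rw [abs_mul]
          calc |κ| * |t - t₀| ≤ (|κ| + 1) * (1 / (8 * (|κ| + 1))) := by gcongr; linarith
            _ = 1 / 8 := by field_simp
        rw [abs_mul, abs_of_pos Real.two_pi_pos]
        nlinarith [Real.pi_pos]
    · have h1 : 0 < A t₀ := by
        simp only [hA, hα, hβ, sub_self, mul_zero, Real.cos_zero]
        have := Real.smoothTransition.pos_of_pos (half_pos hε)
        simp only [ne_eq, OfNat.ofNat_ne_zero, not_false_eq_true, zero_pow, sub_zero]
        positivity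
      simpa using h1.ne'
  have hint : ∀ f : ℝ → ℝ, Continuous f → Integrable (fun t => A t * f t) := fun f hf =>
    (hAc.mul hf).integrable_of_hasCompactSupport hAcs.mul_right
  have hsplit : ∫ t, A t * Real.cos (2 * Real.pi * (κ * (t - t₀))) =
      (∫ t, A t * Real.cos (2 * Real.pi * (κ * t))) * Real.cos (2 * Real.pi * (κ * t₀)) +
      (∫ t, A t * Real.sin (2 * Real.pi * (κ * t))) * Real.sin (2 * Real.pi * (κ * t₀)) := by
    rw [← integral_mul_const, ← integral_mul_const, ← integral_add
      ((hint _ (by fun_prop)).mul_const _) ((hint _ (by fun_prop)).mul_const _)]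
    congr 1
    ext1 t
    rw [mul_sub, mul_sub, Real.cos_sub]
    ring
  rw [hsplit] at hpos
  by_contra! hcon
  have hC := sq_nonneg (∫ t, A t * Real.cos (2 * Real.pi * (κ * t)))
  have hS := sq_nonneg (∫ t, A t * Real.sin (2 * Real.pi * (κ * t)))
  have h1 : (∫ t, A t * Real.cos (2 * Real.pi * (κ * t))) = 0 :=
    pow_eq_zero_iff two_ne_zero |>.1 (le_antisymm (by linarith) hC)
  have h2 : (∫ t, A t * Real.sin (2 * Real.pi * (κ * t))) = 0 :=
    pow_eq_zero_iff two_ne_zero |>.1 (le_antisymm (by linarith) hS)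
  rw [h1, h2] at hpos
  simp at hpos

end Bump

/-! ### Creating a non-degenerate critical point by a trigonometric sum -/

section Critical

variable {n : ℕ}

/-- A trigonometric polynomial of `τ - τ₀`, of degree one in each coordinate. -/
def trigSum (x : ℝ) (y : Fin n → ℝ) (τ₀ τ : E n) : ℝ :=
  ∑ i, (x * Real.cos (2 * Real.pi * (τ i - τ₀ i)) + y i * Real.sin (2 * Real.pi * (τ i - τ₀ i)))

theorem hasFDerivAt_trigSum (x : ℝ) (y : Fin n → ℝ) (τ₀ τ : E n) :
    HasFDerivAt (trigSum x y τ₀) (∑ i, (2 * Real.pi *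
      (y i * Real.cos (2 * Real.pi * (τ i - τ₀ i)) - x * Real.sin (2 * Real.pi * (τ i - τ₀ i)))) •
        (EuclideanSpace.proj i : E n →L[ℝ] ℝ)) τ := by
  unfold trigSum
  refine HasFDerivAt.fun_sum fun i _ => ?_
  have h1 : HasDerivAt (fun r : ℝ => 2 * Real.pi * (r - τ₀ i)) (2 * Real.pi) (τ i) := by
    simpa using ((hasDerivAt_id (τ i)).sub_const (τ₀ i)).const_mul (2 * Real.pi)
  have h2 := (h1.cos.const_mul x).add (h1.sin.const_mul (y i))
  refine (h2.comp_hasFDerivAt τ (EuclideanSpace.proj i : E n →L[ℝ] ℝ).hasFDerivAt).congr_fderiv ?_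
  congr 1
  ring

/-- At τ₀ the sine terms have no second derivative, so the Hessian is -4π²x times the inner product:
y controls the gradient and x the Hessian, independently. -/
theorem hasFDerivAt_fderiv_trigSum (x : ℝ) (y : Fin n → ℝ) (τ₀ : E n) :
    HasFDerivAt (fderiv ℝ (trigSum x y τ₀)) (∑ i, ((-(4 * Real.pi ^ 2 * x)) •
      (EuclideanSpace.proj i : E n →L[ℝ] ℝ)).smulRight (EuclideanSpace.proj i : E n →L[ℝ] ℝ))
      τ₀ := by
  have heq : fderiv ℝ (trigSum x y τ₀) = fun τ => ∑ i, (2 * Real.pi *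
      (y i * Real.cos (2 * Real.pi * (τ i - τ₀ i)) - x * Real.sin (2 * Real.pi * (τ i - τ₀ i)))) •
        (EuclideanSpace.proj i : E n →L[ℝ] ℝ) :=
    funext fun τ => (hasFDerivAt_trigSum x y τ₀ τ).fderiv
  rw [heq]
  refine HasFDerivAt.fun_sum fun i _ => ?_
  have h1 : HasDerivAt (fun r : ℝ => 2 * Real.pi * (r - τ₀ i)) (2 * Real.pi) (τ₀ i) := by
    simpa using ((hasDerivAt_id (τ₀ i)).sub_const (τ₀ i)).const_mul (2 * Real.pi)
  have h2 := ((h1.cos.const_mul (y i)).sub (h1.sin.const_mul x)).const_mul (2 * Real.pi)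
  have h3 := (h2.comp_hasFDerivAt τ₀ (EuclideanSpace.proj i : E n →L[ℝ] ℝ).hasFDerivAt).smul_const
    (EuclideanSpace.proj i : E n →L[ℝ] ℝ)
  refine h3.congr_fderiv ?_
  congr 2
  simp
  ring

theorem exists_isNondegCritPt_add_trigSum {f : E n → ℝ} {τ₀ : E n} (hf : ContDiffAt ℝ 2 f τ₀)
    {η : ℝ} (hη : 0 < η) (hgrad : ‖fderiv ℝ f τ₀‖ ≤ η) :
    ∃ (x : ℝ) (y : Fin n → ℝ), |x| ≤ η ∧ (∀ i, |y i| ≤ η) ∧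
      IsNondegCritPt (fun τ => f τ + trigSum x y τ₀ τ) τ₀ := by
  obtain ⟨w, hw0, hwη, hw⟩ := exists_nondegenerate_add_inner (fderiv ℝ (fderiv ℝ f) τ₀) hη
  have hπ := Real.pi_gt_three
  -- With these values the sum adds w times the inner product to the Hessian and subtracts the
  -- gradient of f. The divisors exceed 1, so the bounds by η are kept.
  set x : ℝ := -(w / (4 * Real.pi ^ 2)) with hx
  set y : Fin n → ℝ := fun i => -(fderiv ℝ f τ₀ (EuclideanSpace.single i 1) / (2 * Real.pi)) with hy
  have hts : ContDiff ℝ 2 (trigSum x y τ₀) := by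
    unfold trigSum
    fun_prop
  have hfd : ∀ᶠ τ in 𝓝 τ₀, fderiv ℝ (fun τ => f τ + trigSum x y τ₀ τ) τ =
      fderiv ℝ f τ + fderiv ℝ (trigSum x y τ₀) τ := by
    filter_upwards [hf.eventually (by simp)] with τ hτ
    exact fderiv_fun_add (hτ.differentiableAt (by norm_num))
      (hts.differentiable (by norm_num) τ)
  refine ⟨x, y, ?_, fun i => ?_, hf.add hts.contDiffAt, ?_, ?_⟩
  · rw [hx, abs_neg, abs_of_pos (by positivity)]
    exact (div_le_self hw0.le (by nlinarith)).trans hwη.le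
  · rw [hy, abs_neg, abs_div, abs_of_pos Real.two_pi_pos]
    refine (div_le_self (abs_nonneg _) (by linarith)).trans ?_
    refine ((fderiv ℝ f τ₀).le_opNorm _).trans ?_
    simpa using hgrad
  · rw [hfd.self_of_nhds, (hasFDerivAt_trigSum x y τ₀ τ₀).fderiv]
    ext v
    have hv : fderiv ℝ f τ₀ v = ∑ i, v i * fderiv ℝ f τ₀ (EuclideanSpace.single i 1) := by
      conv_lhs => rw [← (EuclideanSpace.basisFun (Fin n) ℝ).sum_repr v]
      simp
    simp only [add_apply, sum_apply, hv, zero_apply,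
      smul_apply, sub_self, mul_zero, Real.cos_zero, Real.sin_zero, sub_zero,
      mul_one, smul_eq_mul, PiLp.proj_apply, ← Finset.sum_add_distrib]
    refine Finset.sum_eq_zero fun i _ => ?_
    simp only [hy]
    field_simp
    ring
  · have hd : fderiv ℝ (fderiv ℝ (fun τ => f τ + trigSum x y τ₀ τ)) τ₀ =
        fderiv ℝ (fderiv ℝ f) τ₀ + fderiv ℝ (fderiv ℝ (trigSum x y τ₀)) τ₀ := by
      rw [Filter.EventuallyEq.fderiv_eq hfd]
      exact fderiv_fun_add ((hf.fderiv_right (m := 1) (by norm_num)).differentiableAt (by norm_num))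
        (hasFDerivAt_fderiv_trigSum x y τ₀).differentiableAt
    rw [hd, (hasFDerivAt_fderiv_trigSum x y τ₀).fderiv]
    refine (injective_iff_map_eq_zero _).2 fun v hv => hw v fun u => ?_
    have h1 := congrArg (fun B : E n →L[ℝ] ℝ => B u) hv
    simp only [add_apply, sum_apply, zero_apply,
      smul_apply, ContinuousLinearMap.smulRight_apply, smul_eq_mul,
      PiLp.proj_apply] at h1
    rw [← h1, PiLp.inner_apply, Finset.mul_sum]
    congr 1
    refine Finset.sum_congr rfl fun i _ => ?_
    simp only [hx, RCLike.inner_apply, conj_trivial]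
    field_simp

end Critical

end GlobalMelnikov
end

noncomputable section

namespace GlobalMelnikov

open Filter Topology MeasureTheory Metric Set

/-! ### Perturbations with prescribed sinusoidal Melnikov potential -/

section Waves

variable {n d : ℕ}

theorem IsCrSmall.add {F : Type*} [NormedAddCommGroup F] [NormedSpace ℝ F] {Ω : Set F}
    (hΩ : IsOpen Ω) {r : ℕ} {δ₁ δ₂ : ℝ} {f g : F → ℝ} (hf : IsCkBounded ⊤ Ω f)
    (hg : IsCkBounded ⊤ Ω g) (hf' : IsCrSmall r δ₁ Ω f) (hg' : IsCrSmall r δ₂ Ω g) :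
    IsCrSmall r (δ₁ + δ₂) Ω (fun x => f x + g x) := fun j hj x hx => by
  have hj' : (j : WithTop ℕ∞) ≤ ((⊤ : ℕ∞) : WithTop ℕ∞) := by exact_mod_cast le_top
  change ‖iteratedFDeriv ℝ j (f + g) x‖ < _
  rw [iteratedFDeriv_add_apply ((hf.1.of_le hj').contDiffAt (hΩ.mem_nhds hx))
    ((hg.1.of_le hj').contDiffAt (hΩ.mem_nhds hx))]
  exact (norm_add_le _ _).trans_lt (add_lt_add (hf' j hj x hx) (hg' j hj x hx))

theorem HasBoundedDerivs.isCkBounded {F : Type*} [NormedAddCommGroup F] [NormedSpace ℝ F]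
    {m : ℕ∞} {f : F → ℝ} (hf : HasBoundedDerivs m f) (Ω : Set F) : IsCkBounded m Ω f :=
  ⟨hf.1.contDiffOn, fun j hj => (hf.2 j hj).imp fun _ hC x _ => hC x⟩

/-- A perturbation supported near a point of the `i`-th separatrix, which depends on the angles and on
the time only through a trigonometric function of the phase `Λ (φ, t)`. -/
def wave (α β : ℝ → ℝ) (i : Fin n) (Λ : E d × ℝ →L[ℝ] ℝ) (f : ℝ → ℝ) (x : Phase n d) : ℝ :=
  α (x.1 i) * β (x.2.1 i) * f (Λ (x.2.2.2.1, x.2.2.2.2.1))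

theorem hasBoundedDerivs_wave {α β f : ℝ → ℝ} (hα : HasBoundedDerivs ⊤ α)
    (hβ : HasBoundedDerivs ⊤ β) (hf : HasBoundedDerivs ⊤ f) (i : Fin n) (Λ : E d × ℝ →L[ℝ] ℝ) :
    HasBoundedDerivs ⊤ (wave α β i Λ f) := by
  let T : E d × ℝ × ℝ →L[ℝ] E d × ℝ := (ContinuousLinearMap.fst ℝ (E d) (ℝ × ℝ)).prod
    ((ContinuousLinearMap.fst ℝ ℝ ℝ).comp (ContinuousLinearMap.snd ℝ (E d) (ℝ × ℝ)))
  let S : Phase n d →L[ℝ] E d × ℝ × ℝ := (ContinuousLinearMap.snd ℝ (E d) (E d × ℝ × ℝ)).comp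
    ((ContinuousLinearMap.snd ℝ (E n) (E d × E d × ℝ × ℝ)).comp
      (ContinuousLinearMap.snd ℝ (E n) (E n × E d × E d × ℝ × ℝ)))
  have h1 := hα.comp_clm ((EuclideanSpace.proj i : E n →L[ℝ] ℝ).comp
    (ContinuousLinearMap.fst ℝ (E n) (E n × E d × E d × ℝ × ℝ)))
  have h2 := hβ.comp_clm ((EuclideanSpace.proj i : E n →L[ℝ] ℝ).comp
    ((ContinuousLinearMap.fst ℝ (E n) (E d × E d × ℝ × ℝ)).comp
      (ContinuousLinearMap.snd ℝ (E n) (E n × E d × E d × ℝ × ℝ))))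
  have h3 := hf.comp_clm (Λ.comp (T.comp S))
  exact (h1.mul h2).mul h3

theorem isPerturbation_wave {α β f : ℝ → ℝ} (hα : HasBoundedDerivs ⊤ α)
    (hβ : HasBoundedDerivs ⊤ β) (hf : HasBoundedDerivs ⊤ f) (hβp : Function.Periodic β 1)
    (hfp : Function.Periodic f 1) (i : Fin n) {Λ : E d × ℝ →L[ℝ] ℝ}
    (hΛ : ∀ (b : Fin d → ℤ) (c : ℤ), ∃ m : ℤ, Λ (intVec b, c) = m) (Ω : Set (Phase n d)) :
    IsPerturbation ⊤ Ω (wave α β i Λ f) := by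
  refine ⟨(hasBoundedDerivs_wave hα hβ hf i Λ).isCkBounded Ω, fun a b c p q I φ t ε _ => ?_⟩
  obtain ⟨m, hm⟩ := hΛ b c
  have h1 : β (q i + a i) = β (q i) := by simpa using hβp.int_mul (a i) (q i)
  have h2 : f (Λ (φ, t) + m) = f (Λ (φ, t)) := by simpa using hfp.int_mul m (Λ (φ, t))
  have h3 : Λ (φ + intVec b, t + c) = Λ (φ, t) + m := by
    rw [← hm, ← map_add, Prod.mk_add_mk]
  simp only [wave, h3, h2, PiLp.add_apply]
  exact congrArg (fun r => α (p i) * r * f (Λ (φ, t))) h1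

/-- The Melnikov potentials of small smooth perturbations include all small waves of any phase,
travelling along a given coordinate. -/
theorem exists_wave {s : Fin n → ℝ} {V p₀ q₀ : Fin n → ℝ → ℝ}
    (hl : ∀ i, IsPendulumLoop (s i) (V i) (p₀ i) (q₀ i)) (h₀ : E d → ℝ) (I : E d) (i : Fin n)
    {Λ : E d × ℝ →L[ℝ] ℝ} (hΛ : ∀ (b : Fin d → ℤ) (c : ℤ), ∃ m : ℤ, Λ (intVec b, c) = m)
    (Ω : Set (Phase n d)) (r : ℕ) {δ : ℝ} (hδ : 0 < δ) :
    ∃ η, 0 < η ∧ ∀ x y ψ : ℝ, |x| ≤ η → |y| ≤ η → ∃ g, IsPerturbation ⊤ Ω g ∧ IsCrSmall r δ Ω g ∧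
      ∀ (τ : E n) (φ : E d) (t : ℝ), melnikovPotential h₀ p₀ q₀ g τ I φ t =
        x * Real.cos (2 * Real.pi * (Λ (φ, t) - Λ (freq h₀ I, 1) * τ i + ψ)) +
        y * Real.sin (2 * Real.pi * (Λ (φ, t) - Λ (freq h₀ I, 1) * τ i + ψ)) := by
  -- The rate at which the phase Λ advances along the unperturbed flow.
  set κ := Λ (freq h₀ I, 1) with hκ
  obtain ⟨α, β, hα, hβ, hβp, h00, hcs, hpos⟩ := (hl i).exists_bump κ
  set A : ℝ → ℝ := fun t => α (p₀ i t) * β (q₀ i t) with hA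
  set C := ∫ t, A t * Real.cos (2 * Real.pi * (κ * t)) with hC
  set S := ∫ t, A t * Real.sin (2 * Real.pi * (κ * t)) with hS
  have hAc : Continuous A := (hα.1.continuous.comp (hl i).continuous_p).mul
    (hβ.1.continuous.comp (hl i).continuous_q)
  have hint : ∀ f : ℝ → ℝ, Continuous f → Integrable (fun t => A t * f t) := fun f hf =>
    (hAc.mul hf).integrable_of_hasCompactSupport hcs.mul_right
  have hcosp : Function.Periodic (fun y : ℝ => Real.cos (2 * Real.pi * y)) 1 := fun y => by
    simp only [mul_add, mul_one, Real.cos_add_two_pi]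
  have hsinp : Function.Periodic (fun y : ℝ => Real.sin (2 * Real.pi * y)) 1 := fun y => by
    simp only [mul_add, mul_one, Real.sin_add_two_pi]
  have hwb : ∀ a b : ℝ, HasBoundedDerivs ⊤ (fun y : ℝ =>
      a * Real.cos (2 * Real.pi * y) + b * Real.sin (2 * Real.pi * y)) := fun a b =>
    hasBoundedDerivs_of_periodic (by fun_prop) fun y => by
      simpa only using congrArg₂ (fun u v => a * u + b * v) (hcosp y) (hsinp y)
  obtain ⟨B₁, hB₁, hb₁⟩ := ((hasBoundedDerivs_wave hα hβ (hwb 1 0) i Λ).of_le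
    (m' := (r : ℕ∞)) le_top).exists_bound
  obtain ⟨B₂, hB₂, hb₂⟩ := ((hasBoundedDerivs_wave hα hβ (hwb 0 1) i Λ).of_le
    (m' := (r : ℕ∞)) le_top).exists_bound
  have hwsmall : ∀ (a b : ℝ) (j : ℕ), j ≤ r → ∀ x, ‖iteratedFDeriv ℝ j (wave (n := n) α β i Λ (fun y =>
      a * Real.cos (2 * Real.pi * y) + b * Real.sin (2 * Real.pi * y))) x‖ ≤ |a| * B₁ + |b| * B₂ := by
    intro a b j hj x
    have h1 : wave (n := n) α β i Λ (fun y =>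
        a * Real.cos (2 * Real.pi * y) + b * Real.sin (2 * Real.pi * y)) =
        (fun z => a • wave α β i Λ (fun y =>
          1 * Real.cos (2 * Real.pi * y) + 0 * Real.sin (2 * Real.pi * y)) z) +
        fun z => b • wave α β i Λ (fun y =>
          0 * Real.cos (2 * Real.pi * y) + 1 * Real.sin (2 * Real.pi * y)) z := by
      ext1 z
      simp only [wave, Pi.add_apply, smul_eq_mul]
      ring
    have hj' : (j : WithTop ℕ∞) ≤ ((⊤ : ℕ∞) : WithTop ℕ∞) := by exact_mod_cast le_top
    have hc₁ := ((hasBoundedDerivs_wave hα hβ (hwb 1 0) i Λ).1.of_le hj').contDiffAt (x := x)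
    have hc₂ := ((hasBoundedDerivs_wave hα hβ (hwb 0 1) i Λ).1.of_le hj').contDiffAt (x := x)
    have hs₁ := iteratedFDeriv_const_smul_apply (a := a) hc₁
    have hs₂ := iteratedFDeriv_const_smul_apply (a := b) hc₂
    rw [h1, iteratedFDeriv_add_apply (hc₁.const_smul a) (hc₂.const_smul b)]
    refine (norm_add_le _ _).trans ((add_le_add (congrArg norm hs₁).le (congrArg norm hs₂).le).trans
      ?_)
    rw [norm_smul, norm_smul, Real.norm_eq_abs, Real.norm_eq_abs]
    exact add_le_add (mul_le_mul_of_nonneg_left (hb₁ j hj x) (abs_nonneg a))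
      (mul_le_mul_of_nonneg_left (hb₂ j hj x) (abs_nonneg b))
  -- After the translation σ ↦ σ + τ_i the integral depends on the bump only through its Fourier
  -- coefficients C and S at frequency κ.
  have hM : ∀ (a b : ℝ) (τ : E n) (φ : E d) (t : ℝ), melnikovPotential h₀ p₀ q₀ (wave α β i Λ
      (fun y => a * Real.cos (2 * Real.pi * y) + b * Real.sin (2 * Real.pi * y))) τ I φ t =
      -((a * C + b * S) * Real.cos (2 * Real.pi * (Λ (φ, t) - κ * τ i)) +
        (b * C - a * S) * Real.sin (2 * Real.pi * (Λ (φ, t) - κ * τ i))) := by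
    intro a b τ φ t
    set c := Real.cos (2 * Real.pi * (Λ (φ, t) - κ * τ i)) with hc
    set s' := Real.sin (2 * Real.pi * (Λ (φ, t) - κ * τ i)) with hs'
    have hΛσ : ∀ σ : ℝ, Λ (φ + σ • freq h₀ I, t + σ) = Λ (φ, t) + σ * κ := fun σ => by
      rw [hκ, ← smul_eq_mul, ← map_smul, ← map_add]
      simp
    have h1 : ∀ σ : ℝ, wave α β i Λ
        (fun y => a * Real.cos (2 * Real.pi * y) + b * Real.sin (2 * Real.pi * y))
          (shifted p₀ τ σ, shifted q₀ τ σ, I, φ + σ • freq h₀ I, t + σ, 0) -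
        wave α β i Λ
        (fun y => a * Real.cos (2 * Real.pi * y) + b * Real.sin (2 * Real.pi * y))
          ((0, 0, I, φ + σ • freq h₀ I, t + σ, 0) : Phase n d) =
        (fun u => A u * Real.cos (2 * Real.pi * (κ * u)) * (a * c + b * s') +
          A u * Real.sin (2 * Real.pi * (κ * u)) * (b * c - a * s')) (σ + τ i) := fun σ => by
      simp only [wave, hΛσ, shifted, PiLp.zero_apply, h00, zero_mul, sub_zero, hA]
      have h2 : 2 * Real.pi * (Λ (φ, t) + σ * κ) = 2 * Real.pi * (κ * (σ + τ i)) +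
        2 * Real.pi * (Λ (φ, t) - κ * τ i) := by ring
      rw [h2, Real.cos_add, Real.sin_add, ← hc, ← hs', add_comm (τ i) σ]
      ring
    rw [melnikovPotential]
    simp only [h1]
    rw [integral_add_right_eq_self (fun u => A u * Real.cos (2 * Real.pi * (κ * u)) *
      (a * c + b * s') + A u * Real.sin (2 * Real.pi * (κ * u)) * (b * c - a * s')) (τ i),
      integral_add ((hint _ (by fun_prop)).mul_const _) ((hint _ (by fun_prop)).mul_const _),
      integral_mul_const, integral_mul_const]
    ring
  set K := C ^ 2 + S ^ 2 with hK
  set B := B₁ + B₂ with hB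
  set L := 2 * (|C| + |S|) / K with hL
  have hL0 : 0 ≤ L := by positivity
  have hB0 : 0 < B := by linarith
  refine ⟨δ / (2 * (L * B + 1)), by positivity, fun x y ψ hx hy => ?_⟩
  set η := δ / (2 * (L * B + 1)) with hη
  have hη0 : 0 < η := by positivity
  set cψ := Real.cos (2 * Real.pi * ψ) with hcψ
  set sψ := Real.sin (2 * Real.pi * ψ) with hsψ
  -- The targets for the two amplitudes, with the phase ψ and the overall minus sign absorbed.
  -- Below, a and b solve aC + bS = u, bC - aS = v, whose determinant is C² + S² > 0.
  set u := -(x * cψ + y * sψ) with hu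
  set v := -(-(x * sψ) + y * cψ) with hv
  have hcs1 : |cψ| ≤ 1 := Real.abs_cos_le_one _
  have hss1 : |sψ| ≤ 1 := Real.abs_sin_le_one _
  have habs : ∀ {z w : ℝ}, |z| ≤ η → |w| ≤ 1 → |z * w| ≤ η := fun {z w} hz hw => by
    rw [abs_mul]
    nlinarith [abs_nonneg z, abs_nonneg w]
  have hu' : |u| ≤ 2 * η := by
    rw [hu, abs_neg]
    exact (abs_add_le _ _).trans (by linarith [habs hx hcs1, habs hy hss1])
  have hv' : |v| ≤ 2 * η := by
    rw [hv, abs_neg]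
    refine (abs_add_le _ _).trans ?_
    rw [abs_neg]
    linarith [habs hx hss1, habs hy hcs1]
  set a := (u * C - v * S) / K with ha
  set b := (u * S + v * C) / K with hb
  have hLη : L * η = (2 * η * |C| + 2 * η * |S|) / K := by rw [hL]; ring
  have ha' : |a| ≤ L * η := by
    rw [ha, abs_div, abs_of_pos hpos, hLη]
    refine div_le_div_of_nonneg_right ((abs_sub _ _).trans ?_) hpos.le
    rw [abs_mul, abs_mul]
    gcongr
  have hb' : |b| ≤ L * η := by
    rw [hb, abs_div, abs_of_pos hpos, hLη]
    refine div_le_div_of_nonneg_right ((abs_add_le _ _).trans ?_) hpos.le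
    rw [abs_mul, abs_mul, add_comm]
    gcongr
  refine ⟨_, isPerturbation_wave hα hβ (hwb a b) hβp (fun y => by
      simpa only using congrArg₂ (fun u v => a * u + b * v) (hcosp y) (hsinp y)) i hΛ Ω,
    fun j hj z _ => (hwsmall a b j hj z).trans_lt ?_, fun τ φ t => ?_⟩
  · have h1 : |a| * B₁ + |b| * B₂ ≤ η * (L * B) := by
      have h2 := mul_le_mul_of_nonneg_right ha' (by linarith : 0 ≤ B₁)
      have h3 := mul_le_mul_of_nonneg_right hb' (by linarith : 0 ≤ B₂)
      rw [hB]
      linarith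
    have h2 : η * (2 * (L * B + 1)) = δ := by rw [hη]; field_simp
    nlinarith [mul_nonneg hη0.le (mul_nonneg hL0 hB0.le)]
  · have h1 : a * C + b * S = u := by
      rw [ha, hb, hK]
      rw [hK] at hpos
      field_simp
      ring
    have h2 : b * C - a * S = v := by
      rw [ha, hb, hK]
      rw [hK] at hpos
      field_simp
      ring
    rw [hM, h1, h2, mul_add (2 * Real.pi), Real.cos_add, Real.sin_add, ← hcψ, ← hsψ, hu, hv]
    ring

/-- Sums of small waves along several coordinates, all of them of the frequency of the
perturbation. -/
theorem exists_trigSum_wave {s : Fin n → ℝ} {V p₀ q₀ : Fin n → ℝ → ℝ} {O₁ : Set (E n × E n)}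
    {O₂ : Set (E d)} {ε₁ : ℝ} (hl : ∀ i, IsPendulumLoop (s i) (V i) (p₀ i) (q₀ i))
    (hO₁ : IsSeparatrixNhd p₀ q₀ O₁) (hO₂ : IsOpen O₂) (hε₁ : 0 < ε₁) (h₀ : E d → ℝ) {I : E d}
    (hI : I ∈ O₂) (S : Finset (Fin n)) (r : ℕ) {δ : ℝ} (hδ : 0 < δ) :
    ∃ η, 0 < η ∧ ∀ (x : ℝ) (y : Fin n → ℝ) (τ₀ : E n), |x| ≤ η → (∀ i, |y i| ≤ η) →
      ∃ g, IsPerturbation ⊤ (domain O₁ O₂ ε₁) g ∧ IsCrSmall r δ (domain O₁ O₂ ε₁) g ∧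
      ∀ (τ : E n) (φ : E d), melnikovPotential h₀ p₀ q₀ g τ I φ 0 =
        ∑ i ∈ S, (x * Real.cos (2 * Real.pi * (τ i - τ₀ i)) +
          y i * Real.sin (2 * Real.pi * (τ i - τ₀ i))) := by
  have hΩ := isOpen_domain (d := d) hO₁.1 hO₂ ε₁
  induction S using Finset.induction_on generalizing δ with
  | empty =>
    refine ⟨1, one_pos, fun x y τ₀ _ _ => ⟨fun _ => 0,
      ⟨(hasBoundedDerivs_const 0).isCkBounded _, fun _ _ _ _ _ _ _ _ _ _ => rfl⟩,
      fun j _ z _ => ?_, fun τ φ => by simp [melnikovPotential]⟩⟩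
    rw [iteratedFDeriv_fun_zero]
    simpa using hδ
  | insert i S hi ih =>
    obtain ⟨η₁, hη₁, h₁⟩ := ih (half_pos hδ)
    obtain ⟨η₂, hη₂, h₂⟩ := exists_wave hl h₀ I i (Λ := ContinuousLinearMap.snd ℝ (E d) ℝ)
      (fun b c => ⟨c, rfl⟩) (domain O₁ O₂ ε₁) r (half_pos hδ)
    refine ⟨min η₁ η₂, lt_min hη₁ hη₂, fun x y τ₀ hx hy => ?_⟩
    obtain ⟨g₁, hg₁, hs₁, hM₁⟩ := h₁ x y τ₀ (hx.trans (min_le_left _ _))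
      fun j => (hy j).trans (min_le_left _ _)
    -- At t = 0 the wave in time has phase -(τ_i - τ₀_i), hence the sign of the sine amplitude.
    obtain ⟨g₂, hg₂, hs₂, hM₂⟩ := h₂ x (-y i) (τ₀ i) (hx.trans (min_le_right _ _))
      (by rw [abs_neg]; exact (hy i).trans (min_le_right _ _))
    refine ⟨fun z => g₂ z + g₁ z, hg₂.add hΩ hg₁, ?_, fun τ φ => ?_⟩
    · have := IsCrSmall.add hΩ hg₂.1 hg₁.1 hs₂ hs₁
      rwa [add_halves] at this
    · rw [melnikovPotential_add hl hO₁ hO₂ hε₁ (hg₂.of_le le_top) (hg₁.of_le le_top) τ hI φ 0,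
        Finset.sum_insert hi, hM₁, hM₂]
      have h3 : 2 * Real.pi * (ContinuousLinearMap.snd ℝ (E d) ℝ (φ, (0 : ℝ)) -
          ContinuousLinearMap.snd ℝ (E d) ℝ (freq h₀ I, (1 : ℝ)) * τ i + τ₀ i) =
          -(2 * Real.pi * (τ i - τ₀ i)) := by
        simp
        ring
      rw [h3, Real.cos_neg, Real.sin_neg]
      ring

end Waves

end GlobalMelnikov
end

noncomputable section

namespace GlobalMelnikov

open Filter Topology MeasureTheory Metric Set

/-! ### Density of H3 and H4 -/

section Density

variable {n d : ℕ} {s : Fin n → ℝ} {V p₀ q₀ : Fin n → ℝ → ℝ} {O₁ : Set (E n × E n)}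
  {O₂ : Set (E d)} {ε₁ : ℝ} {h₀ : E d → ℝ}

theorem hasFDerivAt_const_mul_sin_clm {X : Type*} [NormedAddCommGroup X] [NormedSpace ℝ X]
    (L : X →L[ℝ] ℝ) (b a c : ℝ) {x : X} (hx : L x + c = 0) :
    HasFDerivAt (fun x => b * Real.sin (2 * Real.pi * (a * (L x + c)))) ((2 * Real.pi * b * a) • L)
      x := by
  have h1 : HasDerivAt (fun r : ℝ => 2 * Real.pi * (a * (r + c))) (2 * Real.pi * a) (L x) := by
    simpa using (((hasDerivAt_id (L x)).add_const c).const_mul a).const_mul (2 * Real.pi)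
  refine ((h1.sin.const_mul b).comp_hasFDerivAt x L.hasFDerivAt).congr_fderiv ?_
  rw [hx, mul_zero, mul_zero, Real.cos_zero]
  congr 1
  ring

/-- The order of choices matters: amplitudes η₁ available for the waves in time, then τ₀ with
gradient below η₁ / 2, then an angular wave that adds at most η₁ / 2 to it, and only then the
correction at τ₀. -/
theorem isSmoothDense_H4 (hn : 1 ≤ n) (hd : 1 ≤ d) {m : ℕ∞} (hm : 3 ≤ m)
    (hl : ∀ i, IsPendulumLoop (s i) (V i) (p₀ i) (q₀ i))
    (hO₁ : IsSeparatrixNhd p₀ q₀ O₁) (hO₂ : IsOpen O₂) (hne : O₂.Nonempty) (hε₁ : 0 < ε₁)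
    (hh₀ : ContDiffOn ℝ 3 h₀ O₂) :
    IsSmoothDense m (domain O₁ O₂ ε₁) (H4 h₀ p₀ q₀ O₂) := by
  intro h hh r δ hδ
  obtain ⟨I, hI⟩ := hne
  have hΩ := isOpen_domain (d := d) hO₁.1 hO₂ ε₁
  have hh3 := hh.of_le hm
  let i₀ : Fin n := ⟨0, hn⟩
  let j₀ : Fin d := ⟨0, hd⟩
  let π₁ : E n →L[ℝ] ℝ := EuclideanSpace.proj i₀
  let π₂ : E d →L[ℝ] ℝ := EuclideanSpace.proj j₀
  have hπ₁ : ‖π₁‖ ≤ 1 := ContinuousLinearMap.opNorm_le_bound _ zero_le_one fun v => by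
    rw [one_mul]; exact PiLp.norm_apply_le v i₀
  have hπ₂ : π₂ ≠ 0 := fun h0 => by
    have := congrArg (fun L : E d →L[ℝ] ℝ => L (EuclideanSpace.single j₀ 1)) h0
    simp [π₂] at this
  set κ := freq h₀ I j₀ with hκ
  have hpi := Real.pi_pos
  obtain ⟨η₁, hη₁, hW₁⟩ := exists_trigSum_wave hl hO₁ hO₂ hε₁ h₀ hI Finset.univ r (half_pos hδ)
  obtain ⟨η₂, hη₂, hW₂⟩ := exists_wave hl h₀ I i₀ (Λ := π₂.comp (ContinuousLinearMap.fst ℝ (E d) ℝ))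
    (fun b c => ⟨b j₀, rfl⟩) (domain O₁ O₂ ε₁) r (half_pos hδ)
  obtain ⟨A, -, hA⟩ := hh3.exists_isC3Bound
  obtain ⟨C, hC⟩ := integrable_loopDiff hl hO₁ hO₂ hε₁
  obtain ⟨τ₀, hτ₀⟩ := exists_norm_fderiv_lt (f := fun τ => melnikovPotential h₀ p₀ q₀ h τ I 0 0)
    (fun τ => (contDiffAt_melnikovPotential_tau hl hO₁ hO₂ hε₁ hh₀ hh3 τ hI 0 0).differentiableAt
      (by norm_num))
    (fun τ => by
      simp only [melnikovPotential_eq]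
      exact (hC h A hh3 hA (τ, I, 0, 0, freq h₀ I) hI).2) (half_pos hη₁)
  have hfC := contDiffAt_melnikovPotential_tau hl hO₁ hO₂ hε₁ hh₀ hh3 τ₀ hI 0 0
  -- The second bound gives 2π|b||κ| ≤ η₁ / 2, the largest contribution to the τ-gradient that is
  -- allowed.
  set b₀ := min η₂ (η₁ / (2 * (2 * Real.pi * |κ| + 1))) with hb₀
  have hb₀pos : 0 < b₀ := lt_min hη₂ (by positivity)
  -- No angular wave is needed if the angle derivative is already non-zero at τ₀.
  obtain ⟨b, hb, hbne⟩ : ∃ b, |b| ≤ b₀ ∧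
      angleDeriv h₀ p₀ q₀ h τ₀ I 0 0 + (2 * Real.pi * b * 1) • π₂ ≠ 0 := by
    by_cases h0 : angleDeriv h₀ p₀ q₀ h τ₀ I 0 0 = 0
    · refine ⟨b₀, (abs_of_pos hb₀pos).le, ?_⟩
      rw [h0, zero_add]
      exact smul_ne_zero (by positivity) hπ₂
    · exact ⟨0, by simpa using hb₀pos.le, by simpa using h0⟩
  -- This phase makes the sine vanish at τ = τ₀, φ = 0, where its derivatives are explicit.
  obtain ⟨g₂, hg₂, hs₂, hM₂⟩ := hW₂ 0 b (κ * τ₀ i₀) (by simpa using hη₂.le)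
    (hb.trans (min_le_left _ _))
  have hM₂' : ∀ (τ : E n) (φ : E d), melnikovPotential h₀ p₀ q₀ g₂ τ I φ 0 =
      b * Real.sin (2 * Real.pi * (φ j₀ - κ * τ i₀ + κ * τ₀ i₀)) := fun τ φ => by
    rw [hM₂, zero_mul, zero_add]
    rfl
  have hd₁ : HasFDerivAt (fun τ => melnikovPotential h₀ p₀ q₀ g₂ τ I 0 0)
      ((2 * Real.pi * b * (-κ)) • π₁) τ₀ := by
    have := hasFDerivAt_const_mul_sin_clm π₁ b (-κ) (-τ₀ i₀) (x := τ₀) (add_neg_cancel (τ₀ i₀))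
    refine this.congr_of_eventuallyEq (Eventually.of_forall fun τ => ?_)
    simp only [hM₂', PiLp.zero_apply]
    congr 3
    simp only [π₁, PiLp.proj_apply]
    ring
  have hd₂ : HasFDerivAt (fun φ => melnikovPotential h₀ p₀ q₀ g₂ τ₀ I φ 0)
      ((2 * Real.pi * b * 1) • π₂) 0 := by
    have := hasFDerivAt_const_mul_sin_clm π₂ b 1 0 (x := 0) (by simp)
    refine this.congr_of_eventuallyEq (Eventually.of_forall fun φ => ?_)
    simp only [hM₂']
    congr 3
    simp only [π₂, PiLp.proj_apply]
    ring
  have hgrad : ‖fderiv ℝ (fun τ => melnikovPotential h₀ p₀ q₀ h τ I 0 0 +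
      melnikovPotential h₀ p₀ q₀ g₂ τ I 0 0) τ₀‖ ≤ η₁ := by
    rw [fderiv_fun_add (hfC.differentiableAt (by norm_num)) hd₁.differentiableAt, hd₁.fderiv]
    refine (norm_add_le _ _).trans ?_
    have h1 : ‖(2 * Real.pi * b * (-κ)) • π₁‖ ≤ η₁ / 2 := by
      rw [norm_smul, Real.norm_eq_abs, abs_mul, abs_mul, abs_of_pos Real.two_pi_pos, abs_neg]
      have h2 := hb.trans (min_le_right _ _)
      rw [le_div_iff₀ (by positivity)] at h2
      have h3 : 2 * Real.pi * |b| * |κ| ≤ η₁ / 2 := by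
        nlinarith [abs_nonneg b]
      exact (mul_le_of_le_one_right (by positivity) hπ₁).trans h3
    linarith
  have hg₂C : ContDiffAt ℝ 2 (fun τ => melnikovPotential h₀ p₀ q₀ g₂ τ I 0 0) τ₀ :=
    contDiffAt_melnikovPotential_tau hl hO₁ hO₂ hε₁ hh₀ (hg₂.of_le le_top) τ₀ hI 0 0
  obtain ⟨x, y, hx, hy, hcrit⟩ := exists_isNondegCritPt_add_trigSum (hfC.add hg₂C) hη₁ hgrad
  obtain ⟨g₁, hg₁, hs₁, hM₁⟩ := hW₁ x y τ₀ hx hy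
  have hg := hg₂.add hΩ hg₁
  have hM : ∀ (τ : E n) (φ : E d),
      melnikovPotential h₀ p₀ q₀ (fun z => h z + (g₂ z + g₁ z)) τ I φ 0 =
      melnikovPotential h₀ p₀ q₀ h τ I φ 0 + melnikovPotential h₀ p₀ q₀ g₂ τ I φ 0 +
        trigSum x y τ₀ τ := fun τ φ => by
    rw [melnikovPotential_add hl hO₁ hO₂ hε₁ hh3 (hg.of_le le_top) τ hI φ 0,
      melnikovPotential_add hl hO₁ hO₂ hε₁ (hg₂.of_le le_top) (hg₁.of_le le_top) τ hI φ 0, hM₁,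
      trigSum, add_assoc]
  refine ⟨fun z => g₂ z + g₁ z, hg, ?_, ?_⟩
  · have := IsCrSmall.add hΩ hg₂.1 hg₁.1 hs₂ hs₁
    rwa [add_halves] at this
  refine (H4_iff hl hO₁ hO₂ hε₁ hh₀ (hh3.add hΩ (hg.of_le le_top))).2 ⟨I, hI, 0, 0, τ₀, ?_, ?_⟩
  · simp only [hM]
    exact hcrit
  · have hdiff : DifferentiableAt ℝ (fun φ => melnikovPotential h₀ p₀ q₀ h τ₀ I φ 0) 0 :=
      ((contDiffAt_melnikovPotential_tau_phi hl hO₁ hO₂ hε₁ hh₀ hh3 (0, τ₀) hI 0).differentiableAt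
        (by norm_num)).comp (f := fun φ => (φ, τ₀)) 0 (by fun_prop)
    -- The trigonometric sum does not depend on φ and drops out of the angle derivative.
    simp only [angleDeriv, hM]
    rw [fderiv_add_const, fderiv_fun_add hdiff hd₂.differentiableAt, hd₂.fderiv]
    exact hbne

theorem H4.toH3 {h : Phase n d → ℝ} (hh : H4 h₀ p₀ q₀ O₂ h) : H3 h₀ p₀ q₀ O₂ h := by
  obtain ⟨c, r, O, τs, R, hr, hsub, hfam, -⟩ := hh
  exact ⟨c, r, O, τs, hr, hsub, hfam⟩

theorem isSmoothDense_H3 (hn : 1 ≤ n) (hd : 1 ≤ d) {m : ℕ∞} (hm : 3 ≤ m)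
    (hl : ∀ i, IsPendulumLoop (s i) (V i) (p₀ i) (q₀ i))
    (hO₁ : IsSeparatrixNhd p₀ q₀ O₁) (hO₂ : IsOpen O₂) (hne : O₂.Nonempty) (hε₁ : 0 < ε₁)
    (hh₀ : ContDiffOn ℝ 3 h₀ O₂) :
    IsSmoothDense m (domain O₁ O₂ ε₁) (H3 h₀ p₀ q₀ O₂) := fun h hh r δ hδ => by
  obtain ⟨g, hg, hsmall, hP⟩ := isSmoothDense_H4 hn hd hm hl hO₁ hO₂ hne hε₁ hh₀ h hh r δ hδ
  exact ⟨g, hg, hsmall, hP.toH3⟩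

end Density

end GlobalMelnikov
end

/-! ### The proposition -/

open GlobalMelnikov in
theorem mainTheorem3 {n d : ℕ} (hn : 1 ≤ n) (hd : 1 ≤ d) (k : ℕ∞) (hk : 2 ≤ k)
    (s : Fin n → ℝ) (hs : ∀ i, s i = 1 ∨ s i = -1)
    (V : Fin n → ℝ → ℝ)
    (hVsmooth : ∀ i, ContDiff ℝ ((k + 1 : ℕ∞) : WithTop ℕ∞) (V i))
    (hVper : ∀ i, Function.Periodic (V i) 1)
    (hVmax : ∀ i, IsLocalMax (V i) 0)
    (hVnondeg : ∀ i, iteratedDeriv 2 (V i) 0 < 0)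
    (p₀ q₀ : Fin n → ℝ → ℝ)
    (hpq : ∀ i, IsHomoclinic (s i) (V i) (p₀ i) (q₀ i))
    (O₁ : Set (E n × E n)) (hO₁ : IsSeparatrixNhd p₀ q₀ O₁)
    (I₀ : E d) (ρ : ℝ) (hρ : 0 < ρ)
    (h₀ : E d → ℝ) (hh₀ : IsCkBounded (k + 1) (Metric.ball I₀ ρ) h₀)
    (ε₁ : ℝ) (hε₁ : 0 < ε₁) :
    (IsCrOpen 3 (k + 1) (domain O₁ (Metric.ball I₀ ρ) ε₁) (H3 h₀ p₀ q₀ (Metric.ball I₀ ρ)) ∧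
      IsSmoothDense (k + 1) (domain O₁ (Metric.ball I₀ ρ) ε₁)
        (H3 h₀ p₀ q₀ (Metric.ball I₀ ρ))) ∧
    (IsCrOpen 3 (k + 1) (domain O₁ (Metric.ball I₀ ρ) ε₁) (H4 h₀ p₀ q₀ (Metric.ball I₀ ρ)) ∧
      IsSmoothDense (k + 1) (domain O₁ (Metric.ball I₀ ρ) ε₁)
        (H4 h₀ p₀ q₀ (Metric.ball I₀ ρ))) := by
  -- The hypothesis k ≥ 2 enters only here: three derivatives of V, h₀ and h suffice throughout.
  have hk3 : (3 : ℕ∞) ≤ k + 1 := by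
    calc (3 : ℕ∞) = 2 + 1 := by norm_num
      _ ≤ k + 1 := by gcongr
  have hk3' : (3 : WithTop ℕ∞) ≤ ((k + 1 : ℕ∞) : WithTop ℕ∞) := WithTop.coe_le_coe.2 hk3
  have hl : ∀ i, IsPendulumLoop (s i) (V i) (p₀ i) (q₀ i) := fun i =>
    { sign := hs i
      contDiff := (hVsmooth i).of_le hk3'
      periodic := hVper i
      deriv_zero := (hVmax i).deriv_eq_zero
      deriv_deriv_neg := by
        have := hVnondeg i
        rwa [iteratedDeriv_succ, iteratedDeriv_one] at this
      homoclinic := hpq i }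
  have hO₂ : IsOpen (Metric.ball I₀ ρ) := Metric.isOpen_ball
  have hne : (Metric.ball I₀ ρ).Nonempty := Metric.nonempty_ball.2 hρ
  have hC : ContDiffOn ℝ 3 h₀ (Metric.ball I₀ ρ) := hh₀.1.of_le hk3'
  exact ⟨⟨isCrOpen_H3 hn hk3 hl hO₁ hO₂ hε₁ hC, isSmoothDense_H3 hn hd hk3 hl hO₁ hO₂ hne hε₁ hC⟩,
    isCrOpen_H4 hn hk3 hl hO₁ hO₂ hε₁ hC, isSmoothDense_H4 hn hd hk3 hl hO₁ hO₂ hne hε₁ hC⟩
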